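/- **Setting.** Let $\lambda>0$, $p\in(0,1)$, $q\in[0,1]$, $\alpha>2$, $v\ge 0$, $T>0$, $p_A=p$, $p_B=1-p$. Devices form a homogeneous Poisson point process $\Phi$ of intensity $\lambda$ in $\mathbb R^2$. Independently of the locations and of each other, each device $y\in\Phi$ caches file A with probability $p_A$ and file B with probability $p_B$ ($\Phi_A,\Phi_B$ denote the corresponding devices), and carries an independent fading variable $h_y\sim\exp(1)$ and an independent activity indicator $t_y$ with $\mathbb P(t_y=1)=q=1-\mathbb P(t_y=0)$. Location 1 is $(-v,0)$ and location 2 is the origin. Let $x\in\Phi$ be the device closest to location 1; the file it caches is called file 1, the other one file 2. Let $R_1=\|x-(-v,0)\|$, let $\Theta\in[0,\pi]$ be the angle at location 1 between the direction of $x$ and the direction $(1,0)$, let $z$ be the device closest to location 2 among those caching file 2, and $R_2=\|z\|$. The signal-to-interference ratio of file 2 at location 2 is $$\mathtt{SIR}=\frac{h_z\|z\|^{-\alpha}}{\sum_{y\in\Phi\setminus\{z\}}t_yh_y\|y\|^{-\alpha}}$$ (read as $\infty$ if the denominator is $0$). Subcase $\mathcal Y$ is the event that file 1 is file B, and $P_{c_2}^{(\mathcal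 Y)}=\mathbb P(\mathtt{SIR}>T\mid\mathcal Y)$. Let $\mathcal C_1$, $\mathcal C_2$ be the closed disks of radius $R_1$ around location 1 and of radius $R_2$ around location 2, and $$I_1=t_xh_x\|x\|^{-\alpha},\quad I_2=\sum_{y\in\Phi_B\setminus\mathcal C_1}t_yh_y\|y\|^{-\alpha},\quad I_3=\sum_{y\in\Phi_A\setminus(\mathcal C_1\cup\mathcal C_2)}t_yh_y\|y\|^{-\alpha}.$$ **Theorem.** With $z_1=\max(0,r_1-v)$, $$P_{c_2}^{(\mathcal Y)}=\int_0^\infty\int_{z_1}^\infty\int_0^\pi \mathcal L_{I_1|R_1,\Theta}(Tr_2^\alpha|r_1,\theta)\,\mathcal L_{I_2|R_1}(Tr_2^\alpha|r_1)\,\mathcal L_{I_3|R_1,R_2}(Tr_2^\alpha|r_1,r_2)\,f_{R_2|R_1}(r_2|r_1)f_{R_1}(r_1)f_\Theta(\theta)\,d\theta\,dr_2\,dr_1,$$ and the integrand is integrable over the region $r_1>0$, $r_2>z_1$, $0<\theta<\pi$. Here: 1. $f_{R_1}(r_1)=2\pi\lambda r_1e^{-\lambda\pi r_1^2}$, $f_\Theta(\theta)=1/\pi$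 and $f_{R_2|R_1}(r_2|r_1)=\frac{d}{dr_2}\bigl(1-e^{-p_A\lambda|\mathcal A|}\bigr)$, where $|\mathcal A|=\pi r_2^2$ if $r_2\le|v-r_1|$, $|\mathcal A|=\mathcal A_{\rm lune}$ if $|v-r_1|<r_2<v+r_1$, $|\mathcal A|=\pi(r_2^2-r_1^2)$ if $r_2\ge v+r_1$, and $$\mathcal A_{\rm lune}=\pi r_2^2+\tfrac12\sqrt{[(r_1+v)^2-r_2^2][r_2^2-(r_1-v)^2]}-r_1^2\cos^{-1}\tfrac{r_1^2+v^2-r_2^2}{2vr_1}-r_2^2\cos^{-1}\tfrac{r_2^2+v^2-r_1^2}{2vr_2}.$$ Conditionally on $\mathcal Y$, $R_1$ has density $f_{R_1}$ on $(0,\infty)$, $\Theta$ has density $f_\Theta$ on $(0,\pi)$, and $(R_1,R_2,\Theta)$ has joint density $f_{R_2|R_1}(r_2|r_1)f_{R_1}(r_1)f_\Theta(\theta)$ on $\{r_1>0,\ r_2>z_1,\ 0<\theta<\pi\}$. 2. Conditionally on $\mathcal Y$, $I_1,I_2,I_3$ are almost surely finite, and for every $s>0$ the conditional expectations of $e^{-sI_1}$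 given $(R_1,\Theta)$, of $e^{-sI_2}$ given $R_1$, and of $e^{-sI_3}$ given $(R_1,R_2)$ are almost surely $\mathcal L_{I_1|R_1,\Theta}(s|R_1,\Theta)$, $\mathcal L_{I_2|R_1}(s|R_1)$ and $\mathcal L_{I_3|R_1,R_2}(s|R_1,R_2)$, where, with $f(r,r_1)=\cos^{-1}\frac{r^2+v^2-r_1^2}{2rv}$, $$\mathcal L_{I_1|R_1,\Theta}(s|r_1,\theta)=1-q+\frac{q}{1+s(r_1^2+v^2-2r_1v\cos\theta)^{-\alpha/2}},$$ $$\mathcal L_{I_2|R_1}(s|r_1)=\exp\Bigl(-2p_Bq\lambda\Bigl(\int_{z_1}^\infty\frac{\pi r\,dr}{1+r^\alpha/s}-\int_{|v-r_1|}^{v+r_1}\frac{f(r,r_1)\,r\,dr}{1+r^\alpha/s}\Bigr)\Bigr),$$ $$\mathcal L_{I_3|R_1,R_2}(s|r_1,r_2)=\exp\Bigl(-p_Aq\lambda\int_{r_2}^\infty\frac{2\pi r\,dr}{1+r^\alpha/s}\Bigr)\exp\bigl(p_Aq\lambda\,\mathcal B\bigr),$$ and $\mathcal B=\int_{v-r_1}^{v+r_1}\frac{2f(r,r_1)r\,dr}{1+r^\alpha/s}$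 if $v\ge r_1+r_2$, $\mathcal B=\int_{r_2}^{v+r_1}\frac{2f(r,r_1)r\,dr}{1+r^\alpha/s}$ if $r_2-r_1<v<r_1+r_2$, $\mathcal B=0$ if $v\le r_2-r_1$. -/

import Mathlib

open MeasureTheory ProbabilityTheory Set Filter
open scoped ENNReal NNReal Topology

noncomputable section

namespace D2D

/-- The plane `ℝ²` with its Euclidean norm and Lebesgue measure. -/
abbrev Plane : Type := EuclideanSpace ℝ (Fin 2)

/-- Number of indices `n` for which the random point `X n` lies in `B`. -/
def pointCount {Ω E : Type*} (X : ℕ → Ω → E) (B : Set E) (ω : Ω) : ℕ∞ :=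
  Set.encard {n | X n ω ∈ B}

/-- The random points `X 0, X 1, …` are an enumeration of a Poisson point process with intensity
measure `L`: the numbers of points in sets of finite intensity are Poisson, and the numbers of
points in pairwise disjoint sets are independent. -/
structure IsPoissonProcess {Ω E : Type*} [MeasurableSpace Ω] [MeasurableSpace E]
    (μ : Measure Ω) (X : ℕ → Ω → E) (L : Measure E) : Prop where
  measurable : ∀ n, Measurable (X n)
  law : ∀ B : Set E, MeasurableSet B → L B ≠ ∞ →
    μ.map (pointCount X B) = (poissonMeasure (L B).toNNReal).map (fun k : ℕ => (k : ℕ∞))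
  indep : ∀ (m : ℕ) (B : Fin m → Set E), (∀ i, MeasurableSet (B i)) →
    Pairwise (fun i j => Disjoint (B i) (B j)) → iIndepFun (fun i => pointCount X (B i)) μ

/-- The network of devices. The locations `X n` form a homogeneous Poisson point process of
intensity `lam`; independently of the locations and of each other, device `n` caches file A
(`cachesA n = true`) with probability `p` and file B otherwise, its link to the user at location 2
has fading `h n ∼ exp(1)`, and it is active as an interferer (`t n = true`) with probability `q`. -/
structure Network {Ω : Type*} [MeasurableSpace Ω] (μ : Measure Ω) (lam : ℝ)
    (p q : unitInterval) where
  X : ℕ → Ω → Plane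
  cachesA : ℕ → Ω → Bool
  h : ℕ → Ω → ℝ
  t : ℕ → Ω → Bool
  poisson : IsPoissonProcess μ X (ENNReal.ofReal lam • (volume : Measure Plane))
  measurable_cachesA : ∀ n, Measurable (cachesA n)
  measurable_h : ∀ n, Measurable (h n)
  measurable_t : ∀ n, Measurable (t n)
  mark_law : ∀ n, μ.map (fun ω => (cachesA n ω, h n ω, t n ω)) =
    (bernoulliMeasure true false p).prod ((expMeasure 1).prod (bernoulliMeasure true false q))
  mark_indep : iIndepFun (fun n ω => (cachesA n ω, h n ω, t n ω)) μ
  indep : IndepFun (fun ω n => X n ω) (fun ω n => (cachesA n ω, h n ω, t n ω)) μ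

/-- The (least) index in `S` whose point is closest to `z`. -/
def nearestIdx (y : ℕ → Plane) (S : Set ℕ) (z : Plane) : ℕ :=
  sInf {n | n ∈ S ∧ ∀ m ∈ S, dist (y n) z ≤ dist (y m) z}

/-- Location 1 is `(-v, 0)`; location 2 is the origin. -/
def loc1 (v : ℝ) : Plane := !₂[-v, 0]

namespace Network

variable {Ω : Type*} [MeasurableSpace Ω] {μ : Measure Ω} {lam : ℝ} {p q : unitInterval}

/-- The device closest to location 1. -/
def server1 (N : Network μ lam p q) (v : ℝ) (ω : Ω) : ℕ :=
  nearestIdx (fun n => N.X n ω) Set.univ (loc1 v)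

/-- The device closest to location 2 among those caching file 2, that is, the file portion that
is not cached by the device closest to location 1. -/
def server2 (N : Network μ lam p q) (v : ℝ) (ω : Ω) : ℕ :=
  nearestIdx (fun n => N.X n ω) {n | N.cachesA n ω ≠ N.cachesA (N.server1 v ω) ω} 0

/-- Subcase `𝒴`: file 1 is file B. -/
def subcaseY (N : Network μ lam p q) (v : ℝ) : Set Ω :=
  {ω | N.cachesA (N.server1 v ω) ω = false}

/-- Distance from location 1 to the closest device (with file 1). -/
def R1 (N : Network μ lam p q) (v : ℝ) (ω : Ω) : ℝ :=
  dist (N.X (N.server1 v ω) ω) (loc1 v)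

/-- Distance from location 2 to the closest device with file 2. -/
def R2 (N : Network μ lam p q) (v : ℝ) (ω : Ω) : ℝ :=
  ‖N.X (N.server2 v ω) ω‖

/-- The angle in `[0, π]` at location 1 between the direction of its closest device and the
direction `(1, 0)` of location 2. -/
def Theta (N : Network μ lam p q) (v : ℝ) (ω : Ω) : ℝ :=
  InnerProductGeometry.angle (N.X (N.server1 v ω) ω - loc1 v) (!₂[1, 0] : Plane)

/-- Power received at location 2 from device `n` when it transmits. -/
def power (N : Network μ lam p q) (α : ℝ) (ω : Ω) (n : ℕ) : ℝ≥0∞ :=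
  ENNReal.ofReal (N.h n ω * ‖N.X n ω‖ ^ (-α))

/-- Interference power at location 2 from device `n` (zero if it is not active). -/
def interf (N : Network μ lam p q) (α : ℝ) (ω : Ω) (n : ℕ) : ℝ≥0∞ :=
  if N.t n ω then N.power α ω n else 0

/-- The signal-to-interference ratio of file 2 at location 2, with values in `[0, ∞]` (it is `∞`
when a positive signal meets no interference). -/
def SIR (N : Network μ lam p q) (α v : ℝ) (ω : Ω) : ℝ≥0∞ :=
  N.power α ω (N.server2 v ω) /
    ∑' n, Set.indicator {n | n ≠ N.server2 v ω} (N.interf α ω) n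

/-- Interference at location 2 from the device that served location 1. -/
def I1 (N : Network μ lam p q) (α v : ℝ) (ω : Ω) : ℝ≥0∞ :=
  N.interf α ω (N.server1 v ω)

/-- Interference at location 2 from the devices with file B outside the disk `𝒞₁`. -/
def I2 (N : Network μ lam p q) (α v : ℝ) (ω : Ω) : ℝ≥0∞ :=
  ∑' n, Set.indicator {n | N.cachesA n ω = false ∧
    N.X n ω ∉ Metric.closedBall (loc1 v) (N.R1 v ω)} (N.interf α ω) n

/-- Interference at location 2 from the devices with file A outside the disks `𝒞₁` and `𝒞₂`. -/
def I3 (N : Network μ lam p q) (α v : ℝ) (ω : Ω) : ℝ≥0∞ :=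
  ∑' n, Set.indicator {n | N.cachesA n ω = true ∧
    N.X n ω ∉ Metric.closedBall (loc1 v) (N.R1 v ω) ∪ Metric.closedBall 0 (N.R2 v ω)}
      (N.interf α ω) n

/-- Coverage probability of file 2 at location 2 in subcase `𝒴`: the conditional probability that
the signal-to-interference ratio exceeds the threshold `T`. -/
def coverageY (N : Network μ lam p q) (α v T : ℝ) : ℝ :=
  (cond μ (N.subcaseY v)).real {ω | ENNReal.ofReal T < N.SIR α v ω}

end Network

/-- `z₁ = max (0, r₁ - v)`. -/
def z1 (v r₁ : ℝ) : ℝ := max 0 (r₁ - v)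

/-- Area of the lune `𝒞₂ \ 𝒞₁` for partially overlapping disks. -/
def luneArea (v r₁ r₂ : ℝ) : ℝ :=
  Real.pi * r₂ ^ 2
    + 1 / 2 * Real.sqrt (((r₁ + v) ^ 2 - r₂ ^ 2) * (r₂ ^ 2 - (r₁ - v) ^ 2))
    - r₁ ^ 2 * Real.arccos ((r₁ ^ 2 + v ^ 2 - r₂ ^ 2) / (2 * v * r₁))
    - r₂ ^ 2 * Real.arccos ((r₂ ^ 2 + v ^ 2 - r₁ ^ 2) / (2 * v * r₂))

/-- The area `|𝒜|` of `𝒞₂ \ 𝒞₁`, for `r₂ > z₁`. -/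
def exclArea (v r₁ r₂ : ℝ) : ℝ :=
  if r₂ ≤ |v - r₁| then Real.pi * r₂ ^ 2
  else if r₂ < v + r₁ then luneArea v r₁ r₂
  else Real.pi * (r₂ ^ 2 - r₁ ^ 2)

/-- The density `f_{R₁}`. -/
def fR1 (lam r₁ : ℝ) : ℝ :=
  2 * Real.pi * lam * r₁ * Real.exp (-(lam * Real.pi * r₁ ^ 2))

/-- The conditional density `f_{R₂ | R₁}(r₂ | r₁)` in subcase `𝒴`, where the devices with file 2
have intensity `p λ`. -/
def fR2 (lam p v r₁ r₂ : ℝ) : ℝ :=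
  deriv (fun r => 1 - Real.exp (-(p * lam * exclArea v r₁ r))) r₂

/-- The density `f_Θ` of the uniform distribution on `[0, π]`. -/
def fTheta (_θ : ℝ) : ℝ := 1 / Real.pi

/-- The half-angle `f(r, r₁)`. -/
def halfAngle (v r₁ r : ℝ) : ℝ := Real.arccos ((r ^ 2 + v ^ 2 - r₁ ^ 2) / (2 * r * v))

/-- Laplace transform of `I₁` at `s`, given `R₁ = r₁` and `Θ = θ`. -/
def lap1 (q α v s r₁ θ : ℝ) : ℝ :=
  1 - q + q / (1 + s * (r₁ ^ 2 + v ^ 2 - 2 * r₁ * v * Real.cos θ) ^ (-α / 2))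

/-- Laplace transform of `I₂` at `s`, given `R₁ = r₁`. -/
def lap2 (lam p q α v s r₁ : ℝ) : ℝ :=
  Real.exp (-(2 * (1 - p) * q * lam *
    ((∫ r in Ioi (z1 v r₁), Real.pi * r / (1 + r ^ α / s))
      - ∫ r in |v - r₁|..(v + r₁), halfAngle v r₁ r * r / (1 + r ^ α / s))))

/-- The integral `ℬ(r₁, r₂, v)` over `𝒞₁ \ 𝒞₂`: disjoint, intersecting and engulfed disks. -/
def Bint (α v s r₁ r₂ : ℝ) : ℝ :=
  if r₁ + r₂ ≤ v then ∫ r in (v - r₁)..(v + r₁), 2 * halfAngle v r₁ r * r / (1 + r ^ α / s)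
  else if r₂ - r₁ < v then ∫ r in r₂..(v + r₁), 2 * halfAngle v r₁ r * r / (1 + r ^ α / s)
  else 0

/-- Laplace transform of `I₃` at `s`, given `R₁ = r₁` and `R₂ = r₂`. -/
def lap3 (lam p q α v s r₁ r₂ : ℝ) : ℝ :=
  Real.exp (-(p * q * lam * ∫ r in Ioi r₂, 2 * Real.pi * r / (1 + r ^ α / s)))
    * Real.exp (p * q * lam * Bint α v s r₁ r₂)

/-- The integrand of the coverage probability. -/
def integrand (lam p q α v T r₁ r₂ θ : ℝ) : ℝ :=
  lap1 q α v (T * r₂ ^ α) r₁ θ * lap2 lam p q α v (T * r₂ ^ α) r₁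
    * lap3 lam p q α v (T * r₂ ^ α) r₁ r₂ * fR2 lam p v r₁ r₂ * fR1 lam r₁ * fTheta θ

/-- The region of integration in the variables `(r₁, r₂, θ)`. -/
def region (v : ℝ) : Set (ℝ × ℝ × ℝ) :=
  {x | 0 < x.1 ∧ z1 v x.1 < x.2.1 ∧ x.2.2 ∈ Ioo 0 Real.pi}

end D2D

end

/-! The devices with their marks form a Poisson process on `Device`, so all expectations can be read
off from its Laplace functional. Given 𝒴, almost surely exactly one pair (x, z) satisfies the
following: x caches B and no other device is as close to location 1, while z caches A and no other
device with file A is as close to location 2. A functional of this pair and of the configuration is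
therefore a double sum over devices with a single nonzero term. Mecke's formula for pairs
(`mecke_pair`) turns its expectation into an integral over x and y of an expectation for an ordinary
Poisson configuration to which x and y have been added.

For that enlarged configuration, being the pair of servers means that the original configuration has
no device in 𝒞₁ and no device with file A in 𝒞₂. The indicator of this event, e^{-bI₂} and e^{-cI₃}
merge into one exponential e^{-∑f}, where f = ∞ on the forbidden devices. The three contributions
live on disjoint sets of devices, so the Laplace functional factors (`lintegral_one_sub_expNeg`)
into e^{-λπr₁²}, the probability that 𝒞₂ \ 𝒞₁ contains no device with file A, and the transforms of
I₂ and I₃. The mark of x supplies the transform of I₁. In polar coordinates around the origin only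
the arc of length `arcLength` outside 𝒞₁ counts. This arc length is the derivative of the area of 𝒞₂
\ 𝒞₁ (`hasDerivAt_luneArea` on the lune), which makes pλ times arc length times void probability
equal to f_{R₂|R₁} (`fR2_eq`).

The outcome is one formula, `lintegral_pairEvent_expNeg`, with free parameters a, b, c for the three
interference terms. Zero parameters give the density of (R₁, R₂, Θ), a single nonzero parameter
gives a conditional Laplace transform, and all three equal to T r₂^α give the coverage probability:
the fading of z is exponential and independent of the rest, so the probability that it exceeds T
r₂^α I is e^{-T r₂^α I}. The one-point Mecke formula shows that 𝒴 has probability 1 - p, which is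
also the total mass of the pair formula, so ties between devices can be ignored.

Mecke's formula is obtained by differentiating the Laplace functional in the direction of an
indicator (`lintegral_mul_expNeg`), together with the fact that Laplace functionals determine laws
of random measures (`ext_of_laplace`). -/

namespace D2D

/-! ### The exponential e^{-x} on [0, ∞] -/

/-- The function `x ↦ exp (-x)` on `[0, ∞]`. -/
noncomputable def expNeg (x : ℝ≥0∞) : ℝ≥0∞ := EReal.exp (-(x : EReal))

@[simp] lemma expNeg_zero : expNeg 0 = 1 := by simp [expNeg]

@[simp] lemma expNeg_top : expNeg ∞ = 0 := by simp [expNeg]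

lemma expNeg_add (x y : ℝ≥0∞) : expNeg (x + y) = expNeg x * expNeg y := by
  unfold expNeg
  rw [← EReal.exp_add, EReal.coe_ennreal_add, EReal.neg_add]
  · rfl
  · exact Or.inl (EReal.coe_ennreal_ne_bot x)
  · exact Or.inr (EReal.coe_ennreal_ne_bot y)

lemma expNeg_sum {ι : Type*} (s : Finset ι) (f : ι → ℝ≥0∞) :
    expNeg (∑ i ∈ s, f i) = ∏ i ∈ s, expNeg (f i) := by
  classical
  induction s using Finset.induction_on with
  | empty => simp
  | insert a s ha ih => rw [Finset.sum_insert ha, Finset.prod_insert ha, expNeg_add, ih]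

lemma expNeg_mul_natCast (x : ℝ≥0∞) (k : ℕ) : expNeg (x * k) = expNeg x ^ k := by
  have := expNeg_sum (Finset.range k) (fun _ => x)
  simpa [mul_comm] using this

lemma expNeg_ofReal {x : ℝ} (hx : 0 ≤ x) :
    expNeg (ENNReal.ofReal x) = ENNReal.ofReal (Real.exp (-x)) := by
  rw [expNeg, EReal.coe_ennreal_ofReal, max_eq_left hx, ← EReal.coe_neg, EReal.exp_coe]

lemma expNeg_antitone : Antitone expNeg := fun x y h => by
  unfold expNeg
  exact EReal.exp_monotone (EReal.neg_le_neg_iff.2 (EReal.coe_ennreal_le_coe_ennreal_iff.2 h))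

lemma expNeg_le_one (x : ℝ≥0∞) : expNeg x ≤ 1 := by
  simpa using expNeg_antitone (zero_le (a := x))

lemma expNeg_ne_top (x : ℝ≥0∞) : expNeg x ≠ ∞ :=
  ((expNeg_le_one x).trans_lt ENNReal.one_lt_top).ne

@[fun_prop] lemma continuous_expNeg : Continuous expNeg := by
  unfold expNeg
  exact ENNReal.continuous_exp.comp (continuous_neg.comp continuous_coe_ennreal_ereal)

@[fun_prop] lemma measurable_expNeg : Measurable expNeg := continuous_expNeg.measurable

/-- The inverse of `expNeg` on `[0, 1]`. -/
noncomputable def negLog (x : ℝ≥0∞) : ℝ≥0∞ := (-(ENNReal.log x)).toENNReal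

lemma expNeg_negLog {x : ℝ≥0∞} (hx : x ≤ 1) : expNeg (negLog x) = x := by
  unfold expNeg negLog
  have h0 : 0 ≤ -(ENNReal.log x) := by
    rw [EReal.le_neg]
    simpa using ENNReal.log_monotone hx
  rw [EReal.coe_toENNReal h0, neg_neg, ENNReal.exp_log]

lemma measurable_negLog : Measurable negLog := by
  unfold negLog
  exact measurable_ereal_toENNReal.comp (continuous_neg.measurable.comp ENNReal.measurable_log)

/-- This is the generating function of the Poisson law at e^{-c}. Allowing c = ∞ includes the
probability of the value 0. -/
lemma lintegral_expNeg_poissonMeasure (c : ℝ≥0∞) (r : ℝ≥0) :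
    ∫⁻ k, expNeg (c * (k : ℝ≥0∞)) ∂(poissonMeasure r) = expNeg ((1 - expNeg c) * r) := by
  obtain ⟨x, hx⟩ : ∃ x : ℝ≥0, expNeg c = x := ⟨_, (ENNReal.coe_toNNReal (expNeg_ne_top c)).symm⟩
  have hx1 : x ≤ 1 := by exact_mod_cast hx ▸ expNeg_le_one c
  rw [lintegral_countable']
  simp_rw [expNeg_mul_natCast, poissonMeasure_singleton, hx]
  have h1 : ∀ k : ℕ, (x : ℝ≥0∞) ^ k * ENNReal.ofReal (Real.exp (-r) * r ^ k / k.factorial) =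
      ENNReal.ofReal (Real.exp (-r) * ((x * r : ℝ) ^ k / k.factorial)) := by
    intro k
    rw [← ENNReal.ofReal_coe_nnreal, ← ENNReal.ofReal_pow x.coe_nonneg, ← ENNReal.ofReal_mul (by positivity)]
    congr 1
    rw [mul_pow]; ring
  simp_rw [h1]
  have hs : HasSum (fun k : ℕ => (x * r : ℝ) ^ k / k.factorial) (Real.exp (x * r)) := by
    rw [Real.exp_eq_exp_ℝ]
    exact NormedSpace.expSeries_div_hasSum_exp (x * r : ℝ)
  have hs := hs.mul_left (Real.exp (-r))
  rw [← ENNReal.ofReal_tsum_of_nonneg (fun k => by positivity) hs.summable, hs.tsum_eq,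
    ← Real.exp_add]
  have h2 : (1 - (x : ℝ≥0∞)) * r = ENNReal.ofReal ((1 - x) * r) := by
    rw [ENNReal.ofReal_mul (by simpa using hx1), ENNReal.ofReal_sub _ x.coe_nonneg]
    simp
  rw [h2, expNeg_ofReal (mul_nonneg (by simpa using hx1) r.coe_nonneg)]
  congr 2; ring

/-! ### From counts to the Laplace functional of a Poisson process -/

section PointMeasure

variable {Ω E : Type*} [MeasurableSpace E]

/-- The random measure `∑ δ_{X n}`. -/
noncomputable def pointMeasure (X : ℕ → Ω → E) (ω : Ω) : Measure E :=
  Measure.sum fun n => Measure.dirac (X n ω)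

lemma lintegral_pointMeasure (X : ℕ → Ω → E) (ω : Ω) {f : E → ℝ≥0∞} (hf : Measurable f) :
    ∫⁻ x, f x ∂(pointMeasure X ω) = ∑' n, f (X n ω) := by
  rw [pointMeasure, lintegral_sum_measure]
  simp_rw [lintegral_dirac' _ hf]

lemma pointMeasure_apply (X : ℕ → Ω → E) (ω : Ω) {B : Set E} (hB : MeasurableSet B) :
    pointMeasure X ω B = ∑' n, B.indicator 1 (X n ω) := by
  rw [← lintegral_indicator_one hB, lintegral_pointMeasure X ω (measurable_one.indicator hB)]

lemma pointMeasure_apply_eq_pointCount (X : ℕ → Ω → E) (ω : Ω) {B : Set E}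
    (hB : MeasurableSet B) : pointMeasure X ω B = (pointCount X B ω : ℝ≥0∞) := by
  rw [pointMeasure_apply X ω hB, pointCount, ← ENNReal.tsum_set_one,
    tsum_subtype {n | X n ω ∈ B} (fun _ => (1 : ℝ≥0∞))]
  rfl

lemma measurable_pointMeasure [MeasurableSpace Ω] {X : ℕ → Ω → E} (hX : ∀ n, Measurable (X n)) :
    Measurable (pointMeasure X) := by
  refine Measure.measurable_of_measurable_coe _ fun B hB => ?_
  simp_rw [pointMeasure_apply X _ hB]
  exact Measurable.tsum fun n => (measurable_one.indicator hB).comp (hX n)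

lemma measurable_pointCount [MeasurableSpace Ω] {X : ℕ → Ω → E} (hX : ∀ n, Measurable (X n)) {B : Set E}
    (hB : MeasurableSet B) : Measurable (pointCount X B) := by
  refine measurable_encard.comp ?_
  rw [measurable_set_iff]
  exact fun n => measurable_mem.2 (hX n hB) 

/-- The random points `X 0, X 1, …` have the Laplace functional of a Poisson process with intensity
measure `L`. -/
structure HasPoissonLaplace [MeasurableSpace Ω] (μ : Measure Ω) (X : ℕ → Ω → E) (L : Measure E) :
    Prop where
  measurable : ∀ n, Measurable (X n)
  laplace : ∀ f : E → ℝ≥0∞, Measurable f →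
    ∫⁻ ω, expNeg (∑' n, f (X n ω)) ∂μ = expNeg (∫⁻ x, (1 - expNeg (f x)) ∂L)

variable [MeasurableSpace Ω] {μ : Measure Ω} {X : ℕ → Ω → E} {L : Measure E}

lemma IsPoissonProcess.lintegral_expNeg_mul (hX : IsPoissonProcess μ X L) {B : Set E}
    (hB : MeasurableSet B) (hLB : L B ≠ ∞) (c : ℝ≥0∞) :
    ∫⁻ ω, expNeg (c * (pointCount X B ω : ℝ≥0∞)) ∂μ = expNeg ((1 - expNeg c) * L B) := by
  have hm := measurable_pointCount hX.measurable hB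
  have h1 : Measurable fun k : ℕ∞ => expNeg (c * (k : ℝ≥0∞)) := Measurable.of_discrete
  rw [← lintegral_map (f := fun k : ℕ∞ => expNeg (c * (k : ℝ≥0∞))) h1 hm, hX.law B hB hLB,
    lintegral_map h1 Measurable.of_discrete]
  simp only [ENat.toENNReal_coe]
  rw [lintegral_expNeg_poissonMeasure, ENNReal.coe_toNNReal hLB]

/-- The sum of f over the points is ∑ c · N(f⁻¹{c}), and the counts on the disjoint fibers are
independent and Poisson, so the expectation is a finite product of Poisson transforms. -/
lemma IsPoissonProcess.laplace_simpleFunc (hX : IsPoissonProcess μ X L) (f : SimpleFunc E ℝ≥0∞)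
    (hf : ∀ c ≠ 0, L (f ⁻¹' {c}) ≠ ∞) :
    ∫⁻ ω, expNeg (∑' n, f (X n ω)) ∂μ = expNeg (∫⁻ x, (1 - expNeg (f x)) ∂L) := by
  classical
  -- The value 0 is left out: it contributes nothing, and its fiber may have infinite intensity.
  set S := f.range.filter (· ≠ 0) with hS
  have hsum : ∀ (g : ℝ≥0∞ → ℝ≥0∞), g 0 = 0 → ∀ M : Measure E,
      ∫⁻ x, g (f x) ∂M = ∑ c ∈ S, g c * M (f ⁻¹' {c}) := by
    intro g hg M
    have := (f.map g).lintegral_eq_lintegral M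
    rw [SimpleFunc.map_lintegral] at this
    simp only [SimpleFunc.coe_map, Function.comp_apply] at this
    rw [this, hS, Finset.sum_filter]
    refine Finset.sum_congr rfl fun c _ => ?_
    by_cases hc : c = 0
    · simp [hc, hg]
    · simp [hc]
  rw [hsum (fun c => 1 - expNeg c) (by simp), expNeg_sum]
  have h1 : ∀ ω, expNeg (∑' n, f (X n ω)) =
      ∏ c ∈ S, expNeg (c * (pointCount X (f ⁻¹' {c}) ω : ℝ≥0∞)) := by
    intro ω
    rw [← lintegral_pointMeasure X ω f.measurable, hsum (fun c => c) rfl, expNeg_sum]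
    refine Finset.prod_congr rfl fun c _ => ?_
    rw [pointMeasure_apply_eq_pointCount X ω (f.measurableSet_fiber c)]
  simp_rw [h1]
  let e := S.equivFin
  have hind := hX.indep S.card (fun i => f ⁻¹' {((e.symm i : S) : ℝ≥0∞)})
    (fun i => f.measurableSet_fiber _) (by
      intro i j hij
      refine Disjoint.preimage _ ?_
      rw [Set.disjoint_singleton]
      intro h
      exact hij (e.symm.injective (Subtype.ext h)))
  have hind2 := hind.comp (fun i (k : ℕ∞) => expNeg (((e.symm i : S) : ℝ≥0∞) * (k : ℝ≥0∞)))
    (fun i => Measurable.of_discrete)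
  have h2 := lintegral_prod_eq_prod_lintegral_of_indepFun Finset.univ _ hind2 (fun i =>
    (Measurable.of_discrete (f := fun k : ℕ∞ => expNeg (((e.symm i : S) : ℝ≥0∞) * (k : ℝ≥0∞)))).comp
      (measurable_pointCount hX.measurable (f.measurableSet_fiber _)))
  simp only [Function.comp_apply] at h2
  have h3 : ∀ g : ℝ≥0∞ → ℝ≥0∞, ∏ c ∈ S, g c = ∏ i : Fin S.card, g (e.symm i : S) := by
    intro g
    rw [← Finset.prod_coe_sort, ← e.symm.prod_comp]
  simp_rw [h3]
  rw [h2]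
  refine Finset.prod_congr rfl fun i _ => ?_
  exact hX.lintegral_expNeg_mul (f.measurableSet_fiber _)
    (hf _ (Finset.mem_filter.1 (e.symm i).2).2) _

lemma IsPoissonProcess.hasPoissonLaplace [IsProbabilityMeasure μ] [SigmaFinite L]
    (hX : IsPoissonProcess μ X L) : HasPoissonLaplace μ X L where
  measurable := hX.measurable
  laplace f hf := by
    let W := spanningSets L
    -- Cutting the simple approximations down to sets of finite intensity gives their nonzero fibers
    -- finite intensity and keeps them increasing to f.
    let F : ℕ → SimpleFunc E ℝ≥0∞ := fun n => (SimpleFunc.eapprox f n).restrict (W n)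
    have hFapp : ∀ n x, F n x = (W n).indicator (SimpleFunc.eapprox f n) x := fun n x => by
      simp only [F, SimpleFunc.restrict_apply _ (measurableSet_spanningSets L n), W]
    have hFmono : Monotone fun n x => F n x := by
      intro m n hmn x
      simp only [hFapp]
      refine (Set.indicator_le_indicator (SimpleFunc.monotone_eapprox f hmn x)).trans ?_
      exact Set.indicator_le_indicator_of_subset (monotone_spanningSets L hmn)
        (fun _ => zero_le) x
    have hFlim : ∀ x, Tendsto (fun n => F n x) atTop (𝓝 (f x)) := by
      intro x
      refine (SimpleFunc.tendsto_eapprox hf x).congr' ?_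
      obtain ⟨N, hN⟩ : ∃ N, x ∈ W N := by
        have : x ∈ ⋃ i, W i := by simp [W, iUnion_spanningSets]
        simpa using this
      filter_upwards [eventually_ge_atTop N] with n hn
      rw [hFapp, Set.indicator_of_mem (monotone_spanningSets L hn hN)]
    have hfin : ∀ n, ∀ c ≠ 0, L (F n ⁻¹' {c}) ≠ ∞ := by
      intro n c hc
      refine ((measure_mono ?_).trans_lt (measure_spanningSets_lt_top L n)).ne
      intro x hx
      by_contra hxn
      apply hc
      rw [← (show F n x = c from hx), hFapp, Set.indicator_of_notMem hxn]
    have hkey := fun n => hX.laplace_simpleFunc (F n) (hfin n)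
    have hR : Tendsto (fun n => expNeg (∫⁻ x, (1 - expNeg (F n x)) ∂L)) atTop
        (𝓝 (expNeg (∫⁻ x, (1 - expNeg (f x)) ∂L))) := by
      refine (continuous_expNeg.tendsto _).comp ?_
      refine lintegral_tendsto_of_tendsto_of_monotone ?_ ?_ ?_
      · exact fun n => (measurable_const.sub
          (measurable_expNeg.comp (F n).measurable)).aemeasurable
      · refine ae_of_all _ fun x m n hmn => ?_
        exact tsub_le_tsub_left (expNeg_antitone (hFmono hmn x)) _
      · refine ae_of_all _ fun x => ?_
        exact ENNReal.Tendsto.sub tendsto_const_nhds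
          ((continuous_expNeg.tendsto _).comp (hFlim x)) (Or.inl ENNReal.one_ne_top)
    have hLs : Tendsto (fun n => ∫⁻ ω, expNeg (∑' k, F n (X k ω)) ∂μ) atTop
        (𝓝 (∫⁻ ω, expNeg (∑' k, f (X k ω)) ∂μ)) := by
      refine tendsto_lintegral_of_dominated_convergence (fun _ => 1) ?_ ?_ ?_ ?_
      · exact fun n => measurable_expNeg.comp
          (Measurable.tsum fun k => (F n).measurable.comp (hX.measurable k))
      · exact fun n => ae_of_all _ fun ω => expNeg_le_one _
      · simp
      · refine ae_of_all _ fun ω => (continuous_expNeg.tendsto _).comp ?_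
        simp_rw [← lintegral_pointMeasure X ω (F _).measurable, ← lintegral_pointMeasure X ω hf]
        exact lintegral_tendsto_of_tendsto_of_monotone (fun n => (F n).measurable.aemeasurable)
          (ae_of_all _ fun x m n hmn => hFmono hmn x) (ae_of_all _ hFlim)
    simp_rw [hkey] at hLs
    exact tendsto_nhds_unique hLs hR

end PointMeasure

end D2D

/-! ### Independent marking -/

namespace D2D

section Marking

variable {Ω E M : Type*} [MeasurableSpace Ω] [MeasurableSpace E] [MeasurableSpace M]
  {μ : Measure Ω} [IsProbabilityMeasure μ]

/-- Independence gives the product formula for partial sums, and the bound e^{-x} ≤ 1 allows the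
passage to the limit. The numbers `G n` are the logarithmic transforms of the summands. -/
lemma lintegral_expNeg_tsum_eq {m : ℕ → Ω → M} (hm : ∀ n, Measurable (m n)) (hind : iIndepFun m μ)
    {ν : Measure M} (hlaw : ∀ n, μ.map (m n) = ν) {g : ℕ → M → ℝ≥0∞} (hg : ∀ n, Measurable (g n))
    {G : ℕ → ℝ≥0∞} (hG : ∀ n, expNeg (G n) = ∫⁻ y, expNeg (g n y) ∂ν) :
    ∫⁻ ω, expNeg (∑' n, g n (m n ω)) ∂μ = expNeg (∑' n, G n) := by
  have hkey : ∀ K, ∫⁻ ω, expNeg (∑ n ∈ Finset.range K, g n (m n ω)) ∂μ =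
      expNeg (∑ n ∈ Finset.range K, G n) := by
    intro K
    simp_rw [expNeg_sum]
    have h2 := lintegral_prod_eq_prod_lintegral_of_indepFun (Finset.range K) _
      (hind.comp (fun n y => expNeg (g n y)) fun n => measurable_expNeg.comp (hg n))
      (fun n => (measurable_expNeg.comp (hg n)).comp (hm n))
    simp only [Function.comp_apply] at h2
    rw [h2]
    refine Finset.prod_congr rfl fun n _ => ?_
    rw [hG, ← hlaw n, lintegral_map (f := fun y => expNeg (g n y))
      (measurable_expNeg.comp (hg n)) (hm n)]
  have hR : Tendsto (fun K => expNeg (∑ n ∈ Finset.range K, G n)) atTop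
      (𝓝 (expNeg (∑' n, G n))) :=
    (continuous_expNeg.tendsto _).comp ENNReal.summable.hasSum.tendsto_sum_nat
  have hLs : Tendsto (fun K => ∫⁻ ω, expNeg (∑ n ∈ Finset.range K, g n (m n ω)) ∂μ) atTop
      (𝓝 (∫⁻ ω, expNeg (∑' n, g n (m n ω)) ∂μ)) := by
    refine tendsto_lintegral_of_dominated_convergence (fun _ => 1) ?_ ?_ ?_ ?_
    · exact fun K => measurable_expNeg.comp
        (Finset.measurable_sum _ fun n _ => (hg n).comp (hm n))
    · exact fun K => ae_of_all _ fun ω => expNeg_le_one _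
    · simp
    · exact ae_of_all _ fun ω => (continuous_expNeg.tendsto _).comp
        ENNReal.summable.hasSum.tendsto_sum_nat
  simp_rw [hkey] at hLs
  exact tendsto_nhds_unique hLs hR

/-- Independent marking of a Poisson process yields a Poisson process on the product space. -/
lemma HasPoissonLaplace.marked {X : ℕ → Ω → E} {L : Measure E} (hX : HasPoissonLaplace μ X L)
    {m : ℕ → Ω → M} (hm : ∀ n, Measurable (m n)) (hind : iIndepFun m μ)
    {ν : Measure M} [IsProbabilityMeasure ν] (hlaw : ∀ n, μ.map (m n) = ν)
    (hXm : IndepFun (fun ω n => X n ω) (fun ω n => m n ω) μ) :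
    HasPoissonLaplace μ (fun n ω => (X n ω, m n ω)) (L.prod ν) where
  measurable n := (hX.measurable n).prodMk (hm n)
  laplace f hf := by
    have hXs : Measurable fun ω n => X n ω := measurable_pi_iff.2 hX.measurable
    have hms : Measurable fun ω n => m n ω := measurable_pi_iff.2 hm
    have hmeas : Measurable fun z : (ℕ → E) × (ℕ → M) => expNeg (∑' n, f (z.1 n, z.2 n)) := by
      refine measurable_expNeg.comp (Measurable.tsum fun n => hf.comp ?_)
      exact ((measurable_pi_apply n).comp measurable_fst).prodMk
        ((measurable_pi_apply n).comp measurable_snd)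
    have hf1 : Measurable fun x => ∫⁻ y, expNeg (f (x, y)) ∂ν :=
      (measurable_expNeg.comp hf).lintegral_prod_right'
    -- Independence of marks and locations lets the marks be averaged with the locations frozen.
    have h1 : ∫⁻ ω, expNeg (∑' n, f (X n ω, m n ω)) ∂μ =
        ∫⁻ ω, ∫⁻ ω', expNeg (∑' n, f (X n ω, m n ω')) ∂μ ∂μ := by
      have := (indepFun_iff_map_prod_eq_prod_map_map hXs.aemeasurable hms.aemeasurable).1 hXm
      have h2 := lintegral_map (μ := μ) hmeas (hXs.prodMk hms)
      rw [this, lintegral_prod _ hmeas.aemeasurable,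
        lintegral_map hmeas.lintegral_prod_right' hXs] at h2
      rw [← h2]
      refine lintegral_congr fun ω => ?_
      exact lintegral_map (hmeas.comp measurable_prodMk_left) hms
    rw [h1]
    -- Averaging the marks replaces f by g, where e^{-g(x)} is the mean of e^{-f(x, ·)}; g is ∞
    -- where that mean vanishes. The Laplace functional of the locations applied to g is the one
    -- claimed for the product space.
    let g : E → ℝ≥0∞ := fun x => negLog (∫⁻ y, expNeg (f (x, y)) ∂ν)
    have hg : Measurable g := measurable_negLog.comp hf1
    have hge : ∀ x, expNeg (g x) = ∫⁻ y, expNeg (f (x, y)) ∂ν := fun x => by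
      refine expNeg_negLog ?_
      calc ∫⁻ y, expNeg (f (x, y)) ∂ν ≤ ∫⁻ y, 1 ∂ν := lintegral_mono fun y => expNeg_le_one _
        _ = 1 := by simp
    have h3 : ∀ ω, ∫⁻ ω', expNeg (∑' n, f (X n ω, m n ω')) ∂μ = expNeg (∑' n, g (X n ω)) :=
      fun ω => lintegral_expNeg_tsum_eq hm hind hlaw
        (g := fun n y => f (X n ω, y)) (fun n => hf.comp measurable_prodMk_left) fun n => hge _
    simp_rw [h3]
    have hm1 : Measurable fun z => 1 - expNeg (f z) :=
      measurable_const.sub (measurable_expNeg.comp hf)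
    rw [hX.laplace g hg, lintegral_prod _ hm1.aemeasurable]
    congr 1
    refine lintegral_congr fun x => ?_
    have hm2 : Measurable fun y => expNeg (f (x, y)) :=
      measurable_expNeg.comp (hf.comp measurable_prodMk_left)
    rw [hge, lintegral_sub hm2]
    · simp
    · rw [← hge]; exact expNeg_ne_top _
    · exact ae_of_all _ fun y => expNeg_le_one _

end Marking

/-! ### Laplace functionals determine laws of random measures -/

section Uniqueness

variable {E : Type*} [MeasurableSpace E]

open scoped BoundedContinuousFunction

lemma expNeg_injective : Function.Injective expNeg := fun x y h => by
  unfold expNeg at h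
  have h2 := neg_injective (EReal.exp_strictMono.injective h)
  exact EReal.coe_ennreal_injective h2

/-- The continuous function `x ↦ exp (-x i)` on a product of copies of `[0, ∞]`. -/
noncomputable def expCoord {ι : Type*} (i : ι) : (ι → ℝ≥0∞) →ᵇ ℝ :=
  BoundedContinuousFunction.mkOfCompact
    ⟨fun x => (expNeg (x i)).toReal, ENNReal.continuousOn_toReal.comp_continuous
      (continuous_expNeg.comp (continuous_apply i)) fun _ => expNeg_ne_top _⟩

lemma expCoord_apply {ι : Type*} (i : ι) (x : ι → ℝ≥0∞) :
    expCoord i x = (expNeg (x i)).toReal := rfl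

/-- A finite measure on a finite product of copies of `[0, ∞]` is determined by its Laplace
transform at integer points. -/
lemma ext_of_monomials {ι : Type*} [Fintype ι] {P Q : Measure (ι → ℝ≥0∞)} [IsFiniteMeasure P]
    [IsFiniteMeasure Q]
    (h : ∀ k : ι → ℕ, ∫⁻ x, expNeg (∑ i, k i * x i) ∂P = ∫⁻ x, expNeg (∑ i, k i * x i) ∂Q) :
    P = Q := by
  classical
  let S : Set ((ι → ℝ≥0∞) →ᵇ ℝ) := range expCoord
  let A : StarSubalgebra ℝ ((ι → ℝ≥0∞) →ᵇ ℝ) :=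
    { Algebra.adjoin ℝ S with
      star_mem' := fun {a} ha => by
        have : star a = a := by ext x; simp
        rwa [this] }
  -- The algebra generated by the functions exp(-xᵢ) separates points of a Polish space, so it
  -- suffices to compare integrals over it; as a vector space it is spanned by monomials.
  refine ext_of_forall_mem_subalgebra_integral_eq_of_polish (A := A) ?_ ?_
  · intro x y hxy
    obtain ⟨i, hi⟩ := Function.ne_iff.1 hxy
    refine ⟨expCoord i, ⟨BoundedContinuousFunction.toContinuousMapStarₐ ℝ (expCoord i),
      ⟨expCoord i, Algebra.subset_adjoin (mem_range_self i), rfl⟩, rfl⟩, ?_⟩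
    rw [expCoord_apply, expCoord_apply, Ne,
      ENNReal.toReal_eq_toReal_iff' (expNeg_ne_top _) (expNeg_ne_top _)]
    exact fun h => hi (expNeg_injective h)
  · intro g hg
    have hg' : g ∈ Submodule.span ℝ (Submonoid.closure S : Set ((ι → ℝ≥0∞) →ᵇ ℝ)) := by
      rw [← Algebra.adjoin_eq_span]; exact hg
    induction hg' using Submodule.span_induction with
    | mem f hf =>
      have : ∃ k : ι → ℕ, ∀ x, f x = (expNeg (∑ i, k i * x i)).toReal := by
        induction hf using Submonoid.closure_induction with
        | mem f hf =>
          obtain ⟨i, rfl⟩ := hf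
          refine ⟨Pi.single i 1, fun x => ?_⟩
          rw [expCoord_apply, Finset.sum_eq_single i]
          · simp
          · intro j _ hj; simp [hj]
          · simp
        | one => exact ⟨0, fun x => by simp⟩
        | mul a b _ _ iha ihb =>
          have hA : ∀ c ∈ Submonoid.closure S, c ∈ A := fun c hc => by
            have : c ∈ Submodule.span ℝ (Submonoid.closure S : Set ((ι → ℝ≥0∞) →ᵇ ℝ)) :=
              Submodule.subset_span hc
            rw [← Algebra.adjoin_eq_span] at this
            exact this
          obtain ⟨k, hk⟩ := iha (hA _ ‹_›)
          obtain ⟨l, hl⟩ := ihb (hA _ ‹_›)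
          refine ⟨k + l, fun x => ?_⟩
          rw [BoundedContinuousFunction.mul_apply, hk, hl, ← ENNReal.toReal_mul, ← expNeg_add,
            ← Finset.sum_add_distrib]
          simp [add_mul]
      obtain ⟨k, hk⟩ := this
      have hm : Measurable fun x : ι → ℝ≥0∞ => expNeg (∑ i, k i * x i) :=
        measurable_expNeg.comp (Finset.measurable_sum _ fun i _ =>
          (measurable_pi_apply i).const_mul _)
      simp_rw [hk]
      rw [integral_toReal hm.aemeasurable (ae_of_all _ fun x => (expNeg_ne_top _).lt_top),
        integral_toReal hm.aemeasurable (ae_of_all _ fun x => (expNeg_ne_top _).lt_top), h k]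
    | zero => simp
    | add a b ha hb iha ihb =>
      rw [← Algebra.adjoin_eq_span] at ha hb
      simp only [BoundedContinuousFunction.coe_add, Pi.add_apply]
      rw [integral_add (a.integrable P) (b.integrable P),
        integral_add (a.integrable Q) (b.integrable Q), iha ha, ihb hb]
    | smul c a ha iha =>
      rw [← Algebra.adjoin_eq_span] at ha
      simp only [BoundedContinuousFunction.coe_smul]
      rw [integral_smul, integral_smul, iha ha]

/-- A finite measure on the space of measures is determined by its Laplace functional. -/
lemma ext_of_laplace {P Q : Measure (Measure E)} [IsFiniteMeasure P] [IsFiniteMeasure Q]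
    (h : ∀ f : E → ℝ≥0∞, Measurable f →
      ∫⁻ ξ, expNeg (∫⁻ x, f x ∂ξ) ∂P = ∫⁻ ξ, expNeg (∫⁻ x, f x ∂ξ) ∂Q) : P = Q := by
  classical
  let ι := {D : Set E // MeasurableSet D}
  let T : Measure E → ι → ℝ≥0∞ := fun ξ D => ξ D.1
  have hT : Measurable T := measurable_pi_iff.2 fun D => Measure.measurable_coe D.2
  -- The σ-algebra on measures is generated by the evaluations ξ ↦ ξ(D), so a law is determined by
  -- the joint law of all evaluations, hence by the laws of finitely many at a time.
  have hcomap : Measure.instMeasurableSpace ≤ MeasurableSpace.comap T MeasurableSpace.pi := by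
    refine iSup₂_le fun D hD => ?_
    have : Measurable[MeasurableSpace.comap T MeasurableSpace.pi] fun ξ : Measure E => ξ D :=
      (measurable_pi_apply (⟨D, hD⟩ : ι)).comp (comap_measurable T)
    exact this.comap_le
  have hmap : P.map T = Q.map T := by
    refine IsProjectiveLimit.unique (P := fun I : Finset ι => (Q.map T).map I.restrict)
      (fun I => ?_) fun I => rfl
    have hI : Measurable (I.restrict : (ι → ℝ≥0∞) → _) := Finset.measurable_restrict I
    -- A Laplace transform of finitely many evaluations is the Laplace functional at a combination
    -- of indicators.
    have key : ∀ (R : Measure (Measure E)) (k : I → ℕ),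
        ∫⁻ x, expNeg (∑ i, k i * x i) ∂((R.map T).map I.restrict) =
        (∫⁻ ξ, expNeg (∫⁻ x, (∑ i : I, (k i : ℝ≥0∞) * (i.1.1 : Set E).indicator 1 x) ∂ξ) ∂ R) := by
      intro R k
      have hm : Measurable fun x : I → ℝ≥0∞ => expNeg (∑ i, k i * x i) :=
        measurable_expNeg.comp (Finset.measurable_sum _ fun i _ =>
          (measurable_pi_apply i).const_mul _)
      rw [Measure.map_map hI hT, lintegral_map hm (hI.comp hT)]
      refine lintegral_congr fun ξ => ?_
      rw [lintegral_finsetSum _ fun i _ => (measurable_one.indicator i.1.2).const_mul _]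
      congr 1
      refine Finset.sum_congr rfl fun i _ => ?_
      rw [lintegral_const_mul _ (measurable_one.indicator i.1.2), lintegral_indicator_one i.1.2]
      rfl
    refine ext_of_monomials fun k => ?_
    rw [key, key]
    exact h _ (Finset.measurable_sum _ fun i _ => (measurable_one.indicator i.1.2).const_mul _)
  ext S hS
  obtain ⟨A, hA, rfl⟩ := hcomap S hS
  rw [← Measure.map_apply hT hA, hmap, Measure.map_apply hT hA]

end Uniqueness

end D2D

/-! ### Difference quotients at 0 along powers of 1/2 -/

namespace D2D

lemma tendsto_two_pow_mul {f : ℝ → ℝ} {c : ℝ} (hf : HasDerivAt f c 0) (h0 : f 0 = 0) :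
    Tendsto (fun k : ℕ => 2 ^ k * f ((2 ^ k)⁻¹)) atTop (𝓝 c) := by
  have h1 := hasDerivAt_iff_tendsto_slope_zero.1 hf
  have h2 : Tendsto (fun k : ℕ => ((2 : ℝ) ^ k)⁻¹) atTop (𝓝[≠] 0) := by
    refine tendsto_nhdsWithin_iff.2 ⟨?_, Eventually.of_forall fun k => by simp⟩
    exact tendsto_inv_atTop_zero.comp (tendsto_pow_atTop_atTop_of_one_lt one_lt_two)
  have := h1.comp h2
  simpa [Function.comp_def, h0] using this

/-- The function t ↦ 1 - e^{-tN} is concave, so its difference quotients at 0 grow as t is halved.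
Halving gives the elementary form 1 - a² ≤ 2(1 - a), and monotone convergence will then need no
integrability. -/
lemma monotone_two_pow_mul_expNeg (N : ℝ≥0∞) :
    Monotone fun k : ℕ => (2 : ℝ≥0∞) ^ k * (1 - expNeg ((2 ^ k)⁻¹ * N)) := by
  refine monotone_nat_of_le_succ fun k => ?_
  have h1 : ((2 : ℝ≥0∞) ^ k)⁻¹ * N = (2 ^ (k + 1))⁻¹ * N + (2 ^ (k + 1))⁻¹ * N := by
    rw [← two_mul, ← mul_assoc, pow_succ, ENNReal.mul_inv (by simp) (by simp), mul_comm 2,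
      mul_assoc (_⁻¹), ENNReal.inv_mul_cancel (by simp) (by simp), mul_one]
  rw [h1, expNeg_add, pow_succ, mul_assoc]
  gcongr
  set a := expNeg ((2 ^ (k + 1))⁻¹ * N)
  have ha : a ≤ 1 := expNeg_le_one _
  calc 1 - a * a ≤ (1 - a) + (a - a * a) := tsub_le_tsub_add_tsub
    _ = (1 - a) + a * (1 - a) := by
      rw [ENNReal.mul_sub (fun _ _ => (ha.trans_lt ENNReal.one_lt_top).ne), mul_one]
    _ ≤ (1 - a) + 1 * (1 - a) := by gcongr
    _ = 2 * (1 - a) := by ring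

lemma one_sub_expNeg_ofReal {x : ℝ} (hx : 0 ≤ x) :
    1 - expNeg (ENNReal.ofReal x) = ENNReal.ofReal (1 - Real.exp (-x)) := by
  rw [expNeg_ofReal hx, ENNReal.ofReal_sub _ (Real.exp_nonneg _), ENNReal.ofReal_one]

lemma two_pow_eq_ofReal (k : ℕ) : (2 : ℝ≥0∞) ^ k = ENNReal.ofReal (2 ^ k) := by
  rw [ENNReal.ofReal_pow (by norm_num)]; simp

lemma two_pow_inv_eq_ofReal (k : ℕ) : ((2 : ℝ≥0∞) ^ k)⁻¹ = ENNReal.ofReal (2 ^ k)⁻¹ := by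
  rw [ENNReal.ofReal_inv_of_pos (by positivity), two_pow_eq_ofReal]

lemma tendsto_two_pow_mul_expNeg (N : ℝ≥0∞) :
    Tendsto (fun k : ℕ => (2 : ℝ≥0∞) ^ k * (1 - expNeg ((2 ^ k)⁻¹ * N))) atTop (𝓝 N) := by
  by_cases hN : N = ∞
  · subst hN
    have : ∀ k : ℕ, (2 : ℝ≥0∞) ^ k * (1 - expNeg ((2 ^ k)⁻¹ * ∞)) = 2 ^ k := by
      intro k
      rw [ENNReal.mul_top (by simp)]; simp
    simp_rw [this]
    exact ENNReal.tendsto_pow_atTop_nhds_top_iff.2 (by norm_num)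
  · obtain ⟨x, hx, rfl⟩ : ∃ x : ℝ, 0 ≤ x ∧ N = ENNReal.ofReal x :=
      ⟨N.toReal, ENNReal.toReal_nonneg, (ENNReal.ofReal_toReal hN).symm⟩
    have h1 : HasDerivAt (fun t : ℝ => 1 - Real.exp (-(t * x))) x 0 := by
      have := (((hasDerivAt_id (0 : ℝ)).mul_const x).neg.exp).const_sub 1
      simpa using this
    have h2 := tendsto_two_pow_mul h1 (by simp)
    refine ((ENNReal.continuous_ofReal.tendsto _).comp h2).congr fun k => ?_
    have hk : (0 : ℝ) ≤ (2 ^ k)⁻¹ := by positivity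
    simp only [Function.comp_apply]
    rw [two_pow_inv_eq_ofReal, ← ENNReal.ofReal_mul hk, one_sub_expNeg_ofReal (by positivity),
      two_pow_eq_ofReal, ← ENNReal.ofReal_mul (by positivity)]

/-- A derivative at 0 of 1 minus the transform of a Poisson variable with mean b; it yields that
mean. -/
lemma tendsto_two_pow_mul_expNeg_expNeg {b : ℝ≥0∞} (hb : b ≠ ∞) :
    Tendsto (fun k : ℕ => (2 : ℝ≥0∞) ^ k * (1 - expNeg ((1 - expNeg (2 ^ k)⁻¹) * b)))
      atTop (𝓝 b) := by
  obtain ⟨x, hx, rfl⟩ : ∃ x : ℝ, 0 ≤ x ∧ b = ENNReal.ofReal x :=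
    ⟨b.toReal, ENNReal.toReal_nonneg, (ENNReal.ofReal_toReal hb).symm⟩
  have h1 : HasDerivAt (fun t : ℝ => 1 - Real.exp (-((1 - Real.exp (-t)) * x))) x 0 := by
    have := ((((hasDerivAt_id (0 : ℝ)).neg.exp.const_sub 1).mul_const x).neg.exp).const_sub 1
    simpa using this
  have h2 := tendsto_two_pow_mul h1 (by simp)
  refine ((ENNReal.continuous_ofReal.tendsto _).comp h2).congr fun k => ?_
  have hk : (0 : ℝ) ≤ (2 ^ k)⁻¹ := by positivity
  have hk2 : 0 ≤ 1 - Real.exp (-(2 ^ k)⁻¹ : ℝ) := by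
    rw [sub_nonneg, Real.exp_le_one_iff]; linarith
  simp only [Function.comp_apply]
  rw [two_pow_inv_eq_ofReal, one_sub_expNeg_ofReal hk, ← ENNReal.ofReal_mul hk2,
    one_sub_expNeg_ofReal (by positivity), two_pow_eq_ofReal, ← ENNReal.ofReal_mul (by positivity)]

/-! ### Measurable integration against a locally finite random measure -/

section LocallyFinite

variable {E : Type*} [MeasurableSpace E]

/-- The kernel `ξ ↦ ξ` on measures, cut down to the pieces of a `σ`-finite partition on which
`ξ` is finite, so that it becomes `s`-finite. -/
noncomputable def locFinPiece (L : Measure E) [SigmaFinite L] (j : ℕ × ℕ) :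
    Kernel (Measure E) E where
  toFun ξ := by
    classical
    exact if ((j.2 : ℝ≥0∞) ≤ ξ (disjointed (spanningSets L) j.1) ∧
      ξ (disjointed (spanningSets L) j.1) < (j.2 + 1 : ℕ)) then
      ξ.restrict (disjointed (spanningSets L) j.1) else 0
  measurable' := by
    classical
    have hD : MeasurableSet (disjointed (spanningSets L) j.1) :=
      MeasurableSet.disjointed (measurableSet_spanningSets L) _
    have hr : Measurable fun ξ : Measure E => ξ.restrict (disjointed (spanningSets L) j.1) := by
      refine Measure.measurable_of_measurable_coe _ fun B hB => ?_
      simp_rw [Measure.restrict_apply hB]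
      exact Measure.measurable_coe (hB.inter hD)
    refine Measurable.ite ?_ hr measurable_const
    exact (measurableSet_le measurable_const (Measure.measurable_coe hD)).inter
      (measurableSet_lt (Measure.measurable_coe hD) measurable_const)

instance (L : Measure E) [SigmaFinite L] (j : ℕ × ℕ) : IsFiniteKernel (locFinPiece L j) := by
  refine ⟨⟨(j.2 + 1 : ℕ), ENNReal.natCast_lt_top _, fun ξ => ?_⟩⟩
  simp only [locFinPiece, Kernel.coe_mk]
  split_ifs with h
  · rw [Measure.restrict_apply_univ]; exact h.2.le
  · simp

/-- An `s`-finite kernel that agrees with the identity on locally finite measures. -/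
noncomputable def locFin (L : Measure E) [SigmaFinite L] : Kernel (Measure E) E :=
  Kernel.sum (locFinPiece L)

instance (L : Measure E) [SigmaFinite L] : IsSFiniteKernel (locFin L) :=
  Kernel.isSFiniteKernel_sum

/-- On each piece of the partition exactly one index c satisfies c ≤ ξ(piece) < c + 1, so the sum
over c returns the restriction of ξ once, and the pieces add up to ξ. -/
lemma locFin_apply (L : Measure E) [SigmaFinite L] {ξ : Measure E}
    (h : ∀ j, ξ (disjointed (spanningSets L) j) < ∞) : locFin L ξ = ξ := by
  have hD : ∀ j, MeasurableSet (disjointed (spanningSets L) j) := fun j =>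
    MeasurableSet.disjointed (measurableSet_spanningSets L) _
  ext B hB
  rw [locFin, Kernel.sum_apply' _ _ hB, ENNReal.tsum_prod' (f := fun p => locFinPiece L p ξ B)]
  have h1 : ∀ j, ∑' c, locFinPiece L (j, c) ξ B = ξ.restrict (disjointed (spanningSets L) j) B := by
    intro j
    obtain ⟨r, hr⟩ : ∃ r : ℝ≥0, ξ (disjointed (spanningSets L) j) = r :=
      ⟨_, (ENNReal.coe_toNNReal (h j).ne).symm⟩
    rw [tsum_eq_single ⌊r⌋₊]
    · simp only [locFinPiece, Kernel.coe_mk]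
      rw [if_pos]
      rw [hr]
      exact ⟨by exact_mod_cast Nat.floor_le r.2, by exact_mod_cast Nat.lt_floor_add_one r⟩
    · intro c hc
      simp only [locFinPiece, Kernel.coe_mk]
      rw [if_neg]
      · simp
      rw [hr]
      rintro ⟨h1, h2⟩
      refine hc ((Nat.floor_eq_iff r.2).2 ⟨by exact_mod_cast h1, by exact_mod_cast h2⟩).symm
  simp_rw [h1, ← Measure.sum_apply _ hB]
  rw [← Measure.restrict_iUnion (disjoint_disjointed _) hD, iUnion_disjointed, iUnion_spanningSets,
    Measure.restrict_univ]

/-- The purpose of `locFin`: `s`-finiteness makes the integral jointly measurable in the parameter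
and the measure. -/
lemma measurable_lintegral_locFin {α : Type*} [MeasurableSpace α] (L : Measure E) [SigmaFinite L]
    {G : α → E → ℝ≥0∞} (hG : Measurable (Function.uncurry G)) {κ : α → Measure E}
    (hκ : Measurable κ) : Measurable fun a => ∫⁻ y, G a y ∂(locFin L (κ a)) :=
  Measurable.lintegral_kernel_prod_right (κ := (locFin L).comap κ hκ) hG

lemma measurable_locFin_apply {α : Type*} [MeasurableSpace α] (L : Measure E) [SigmaFinite L]
    {S : Set (α × E)} (hS : MeasurableSet S) {κ : α → Measure E} (hκ : Measurable κ) :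
    Measurable fun a => locFin L (κ a) {w | (a, w) ∈ S} :=
  Kernel.measurable_kernel_prodMk_left (κ := (locFin L).comap κ hκ) hS

end LocallyFinite

/-! ### Mecke's formula for one and for two points -/

section Mecke

variable {Ω E : Type*} [MeasurableSpace Ω] [MeasurableSpace E] {μ : Measure Ω}
  {X : ℕ → Ω → E} {L : Measure E}

/-- This is the derivative at t = 0 of the Laplace functional at f + t·1_B. For each t the
difference of the two functionals is explicit; multiplying by 2^k at t = 2^{-k} and letting k grow
gives both sides. -/
lemma HasPoissonLaplace.lintegral_mul_expNeg (hX : HasPoissonLaplace μ X L) {B : Set E}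
    (hB : MeasurableSet B) (hLB : L B ≠ ∞) {f : E → ℝ≥0∞} (hf : Measurable f) :
    ∫⁻ ω, pointMeasure X ω B * expNeg (∑' n, f (X n ω)) ∂μ =
      (∫⁻ x in B, expNeg (f x) ∂L) * expNeg (∫⁻ x, (1 - expNeg (f x)) ∂L) := by
  set A := ∫⁻ x, (1 - expNeg (f x)) ∂L
  set b := ∫⁻ x in B, expNeg (f x) ∂L
  have hb : b ≠ ∞ := by
    refine ((setLIntegral_mono measurable_one fun x _ => expNeg_le_one (f x)).trans_lt ?_).ne
    simpa using hLB.lt_top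
  have hPM := measurable_pointMeasure hX.measurable
  have hN : Measurable fun ω => pointMeasure X ω B := (Measure.measurable_coe hB).comp hPM
  have hS : Measurable fun ω => expNeg (∑' n, f (X n ω)) :=
    measurable_expNeg.comp (Measurable.tsum fun n => hf.comp (hX.measurable n))
  have key : ∀ t : ℝ≥0∞, ∫⁻ ω, (1 - expNeg (t * pointMeasure X ω B)) * expNeg (∑' n, f (X n ω)) ∂μ
      = (1 - expNeg ((1 - expNeg t) * b)) * expNeg A := by
    intro t
    let g : E → ℝ≥0∞ := fun x => f x + t * B.indicator 1 x
    have hg : Measurable g := hf.add ((measurable_one.indicator hB).const_mul t)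
    have h1 : ∀ ω, (1 - expNeg (t * pointMeasure X ω B)) * expNeg (∑' n, f (X n ω)) =
        expNeg (∑' n, f (X n ω)) - expNeg (∑' n, g (X n ω)) := by
      intro ω
      rw [ENNReal.sub_mul (fun _ _ => expNeg_ne_top _), one_mul, ← expNeg_add, ENNReal.tsum_add,
        ENNReal.tsum_mul_left, pointMeasure_apply X ω hB, add_comm]
    simp_rw [h1]
    have hSg : Measurable fun ω => expNeg (∑' n, g (X n ω)) :=
      measurable_expNeg.comp (Measurable.tsum fun n => hg.comp (hX.measurable n))
    rw [lintegral_sub hSg, hX.laplace f hf, hX.laplace g hg]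
    · have h2 : ∫⁻ x, (1 - expNeg (g x)) ∂L = A + (1 - expNeg t) * b := by
        have h3 : ∀ x, 1 - expNeg (g x) =
            (1 - expNeg (f x)) + (1 - expNeg t) * B.indicator (fun x => expNeg (f x)) x := by
          intro x
          by_cases hx : x ∈ B
          · simp only [g, indicator_of_mem hx, Pi.one_apply, mul_one]
            rw [expNeg_add, ENNReal.sub_mul (fun _ _ => expNeg_ne_top _), one_mul,
              mul_comm (expNeg t)]
            refine (tsub_add_tsub_cancel (expNeg_le_one _) ?_).symm
            exact mul_le_of_le_one_right' (expNeg_le_one _)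
          · simp [g, indicator_of_notMem hx]
        simp_rw [h3]
        have hfe : Measurable fun x => expNeg (f x) := measurable_expNeg.comp hf
        have hfe1 : Measurable fun x => 1 - expNeg (f x) := measurable_const.sub hfe
        rw [lintegral_add_left hfe1,
          lintegral_const_mul _ (hfe.indicator hB), lintegral_indicator hB]
      rw [h2, expNeg_add, ENNReal.sub_mul (fun _ _ => expNeg_ne_top _), one_mul, mul_comm (expNeg A)]
    · rw [hX.laplace g hg]; exact expNeg_ne_top _
    · refine ae_of_all _ fun ω => expNeg_antitone (ENNReal.tsum_le_tsum fun n => le_self_add)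
  have hL : Tendsto (fun k : ℕ => (2 : ℝ≥0∞) ^ k * ∫⁻ ω, (1 - expNeg ((2 ^ k)⁻¹ *
      pointMeasure X ω B)) * expNeg (∑' n, f (X n ω)) ∂μ) atTop
      (𝓝 (∫⁻ ω, pointMeasure X ω B * expNeg (∑' n, f (X n ω)) ∂μ)) := by
    have hm : ∀ k : ℕ, Measurable fun ω => (1 - expNeg (((2 : ℝ≥0∞) ^ k)⁻¹ *
      pointMeasure X ω B)) * expNeg (∑' n, f (X n ω)) := fun k =>
      (measurable_const.sub (measurable_expNeg.comp (hN.const_mul _))).mul hS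
    simp_rw [← lintegral_const_mul _ (hm _)]
    refine lintegral_tendsto_of_tendsto_of_monotone
      (fun k => ((hm k).const_mul _).aemeasurable) (ae_of_all _ fun ω => ?_)
      (ae_of_all _ fun ω => ?_)
    · intro k l hkl
      simp only [← mul_assoc]
      exact mul_le_mul_left (monotone_two_pow_mul_expNeg _ hkl) _
    · simp only [← mul_assoc]
      exact ENNReal.Tendsto.mul_const (tendsto_two_pow_mul_expNeg _) (Or.inr (expNeg_ne_top _))
  have hR : Tendsto (fun k : ℕ => (2 : ℝ≥0∞) ^ k * ((1 - expNeg ((1 - expNeg (2 ^ k)⁻¹) * b)) *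
      expNeg A)) atTop (𝓝 (b * expNeg A)) := by
    simp only [← mul_assoc]
    exact ENNReal.Tendsto.mul_const (tendsto_two_pow_mul_expNeg_expNeg hb)
      (Or.inr (expNeg_ne_top _))
  simp_rw [key] at hL
  exact tendsto_nhds_unique hL hR

lemma HasPoissonLaplace.intensity (hX : HasPoissonLaplace μ X L) {B : Set E}
    (hB : MeasurableSet B) (hLB : L B ≠ ∞) : ∫⁻ ω, pointMeasure X ω B ∂μ = L B := by
  have := hX.lintegral_mul_expNeg hB hLB measurable_zero
  simpa using this

lemma HasPoissonLaplace.ae_locallyFinite (hX : HasPoissonLaplace μ X L) [SigmaFinite L] :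
    ∀ᵐ ω ∂μ, ∀ j, pointMeasure X ω (disjointed (spanningSets L) j) < ∞ := by
  rw [ae_all_iff]
  intro j
  have hD : MeasurableSet (disjointed (spanningSets L) j) :=
    MeasurableSet.disjointed (measurableSet_spanningSets L) _
  have hLD : L (disjointed (spanningSets L) j) ≠ ∞ :=
    ((measure_mono (disjointed_le _ _)).trans_lt (measure_spanningSets_lt_top L j)).ne
  refine ae_lt_top ((Measure.measurable_coe hD).comp (measurable_pointMeasure hX.measurable)) ?_
  rw [hX.intensity hD hLD]
  exact hLD

variable [IsProbabilityMeasure μ]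

lemma measurable_add_dirac {α : Type*} [MeasurableSpace α] {κ : α → Measure E} (hκ : Measurable κ)
    {g : α → E} (hg : Measurable g) : Measurable fun a => κ a + Measure.dirac (g a) := by
  refine Measure.measurable_of_measurable_coe _ fun B hB => ?_
  simp only [Measure.coe_add, Pi.add_apply]
  exact ((Measure.measurable_coe hB).comp hκ).add
    ((Measure.measurable_coe hB).comp (Measure.measurable_dirac.comp hg))

/-- The law of the configuration weighted by its number of points in B and the image of `(L.restrict
B).prod μ` under adding a point are finite measures. Their Laplace functionals agree by
`lintegral_mul_expNeg`, so `ext_of_laplace` identifies them. -/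
lemma HasPoissonLaplace.mecke_rect (hX : HasPoissonLaplace μ X L) [SigmaFinite L] {B : Set E}
    (hB : MeasurableSet B) (hLB : L B ≠ ∞) {S : Set (Measure E)} (hS : MeasurableSet S) :
    ∫⁻ ω in pointMeasure X ⁻¹' S, pointMeasure X ω B ∂μ =
      ((L.restrict B).prod μ) {z | pointMeasure X z.2 + Measure.dirac z.1 ∈ S} := by
  have hPM := measurable_pointMeasure hX.measurable
  have hN : Measurable fun ω => pointMeasure X ω B := (Measure.measurable_coe hB).comp hPM
  have hadd : Measurable fun z : E × Ω => pointMeasure X z.2 + Measure.dirac z.1 :=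
    measurable_add_dirac (hPM.comp measurable_snd) measurable_fst
  have : IsFiniteMeasure (L.restrict B) := ⟨by simpa using hLB.lt_top⟩
  have : IsFiniteMeasure (μ.withDensity fun ω => pointMeasure X ω B) :=
    isFiniteMeasure_withDensity (by rw [hX.intensity hB hLB]; exact hLB)
  have h : (μ.withDensity fun ω => pointMeasure X ω B).map (pointMeasure X) =
      ((L.restrict B).prod μ).map fun z => pointMeasure X z.2 + Measure.dirac z.1 := by
    refine ext_of_laplace fun f hf => ?_
    have hm : Measurable fun ξ : Measure E => expNeg (∫⁻ x, f x ∂ξ) :=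
      measurable_expNeg.comp (Measure.measurable_lintegral hf)
    have hm1 : Measurable fun ω => expNeg (∫⁻ x, f x ∂pointMeasure X ω) := hm.comp hPM
    have hm2 : Measurable fun z : E × Ω =>
      expNeg (∫⁻ x, f x ∂(pointMeasure X z.2 + Measure.dirac z.1)) := hm.comp hadd
    rw [lintegral_map hm hPM, lintegral_map hm hadd,
      lintegral_withDensity_eq_lintegral_mul _ hN hm1, lintegral_prod _ hm2.aemeasurable]
    simp only [Pi.mul_apply, lintegral_add_measure, expNeg_add,
      lintegral_pointMeasure X _ hf, lintegral_dirac' _ hf]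
    have hS : Measurable fun ω => expNeg (∑' n, f (X n ω)) :=
      measurable_expNeg.comp (Measurable.tsum fun n => hf.comp (hX.measurable n))
    simp_rw [lintegral_mul_const _ hS, hX.laplace f hf]
    have hfe : Measurable fun x => expNeg (f x) := measurable_expNeg.comp hf
    rw [hX.lintegral_mul_expNeg hB hLB hf, lintegral_const_mul _ hfe, mul_comm]
  have h2 := congrArg (fun M => M S) h
  simp only [Measure.map_apply hPM hS, Measure.map_apply hadd hS,
    withDensity_apply _ (hPM hS)] at h2
  exact h2

/-- Mecke's formula. -/
theorem HasPoissonLaplace.mecke (hX : HasPoissonLaplace μ X L) [SigmaFinite L]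
    {G : E × Measure E → ℝ≥0∞} (hG : Measurable G) :
    ∫⁻ ω, ∑' n, G (X n ω, pointMeasure X ω) ∂μ =
      ∫⁻ x, ∫⁻ ω, G (x, pointMeasure X ω + Measure.dirac x) ∂μ ∂L := by
  have hPM := measurable_pointMeasure hX.measurable
  have hadd : Measurable fun z : E × Ω => (z.1, pointMeasure X z.2 + Measure.dirac z.1) :=
    measurable_fst.prodMk (measurable_add_dirac (hPM.comp measurable_snd) measurable_fst)
  have hpt : ∀ n, Measurable fun ω => (X n ω, pointMeasure X ω) := fun n =>
    (hX.measurable n).prodMk hPM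
  -- Both sides of the formula integrate G against a measure on `E × Measure E`. These two measures
  -- agree on rectangles with a side of finite intensity, and such rectangles determine them.
  have h : (Measure.sum fun n => μ.map fun ω => (X n ω, pointMeasure X ω)) =
      (L.prod μ).map fun z => (z.1, pointMeasure X z.2 + Measure.dirac z.1) := by
    have hcov : ⋃ j, (spanningSets L j ×ˢ (univ : Set (Measure E))) = univ := by
      rw [← iUnion_prod_const, iUnion_spanningSets, univ_prod_univ]
    have hrect : ∀ j, ∀ s : Set E, ∀ t : Set (Measure E), MeasurableSet s → MeasurableSet t →
        (Measure.sum fun n => μ.map fun ω => (X n ω, pointMeasure X ω))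
          ((s ∩ spanningSets L j) ×ˢ t) =
        (L.prod μ).map (fun z => (z.1, pointMeasure X z.2 + Measure.dirac z.1))
          ((s ∩ spanningSets L j) ×ˢ t) := by
      intro j s t hs ht
      have hB : MeasurableSet (s ∩ spanningSets L j) := hs.inter (measurableSet_spanningSets L j)
      have hLB : L (s ∩ spanningSets L j) ≠ ∞ :=
        ((measure_mono inter_subset_right).trans_lt (measure_spanningSets_lt_top L j)).ne
      have h1 := hX.mecke_rect hB hLB ht
      rw [Measure.map_apply hadd (hB.prod ht), Measure.sum_apply _ (hB.prod ht)]
      simp_rw [Measure.map_apply (hpt _) (hB.prod ht)]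
      have h2 : ∀ n, μ ((fun ω => (X n ω, pointMeasure X ω)) ⁻¹' ((s ∩ spanningSets L j) ×ˢ t)) =
          ∫⁻ ω in pointMeasure X ⁻¹' t, (s ∩ spanningSets L j).indicator 1 (X n ω) ∂μ := by
        intro n
        have : ∀ ω, (s ∩ spanningSets L j).indicator (1 : E → ℝ≥0∞) (X n ω) =
          (X n ⁻¹' (s ∩ spanningSets L j)).indicator 1 ω := fun ω => rfl
        simp_rw [this]
        rw [lintegral_indicator_one (hX.measurable n hB),
          Measure.restrict_apply (hX.measurable n hB)]
        rfl
      simp_rw [h2]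
      have hm : ∀ n, Measurable fun ω =>
          (s ∩ spanningSets L j).indicator (1 : E → ℝ≥0∞) (X n ω) := fun n =>
        (measurable_one.indicator hB).comp (hX.measurable n)
      rw [← lintegral_tsum fun n => (hm n).aemeasurable]
      simp_rw [← pointMeasure_apply X _ hB]
      rw [h1, ← Measure.restrict_univ (μ := μ), Measure.prod_restrict, Measure.restrict_apply,
        Measure.restrict_univ]
      · congr 1
        ext z
        simp [and_comm]
      · exact hadd.snd ht
    refine (Measure.ext_iff_of_iUnion_eq_univ hcov).2 fun j => ?_
    have hW : MeasurableSet (spanningSets L j ×ˢ (univ : Set (Measure E))) :=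
      (measurableSet_spanningSets L j).prod MeasurableSet.univ
    have : IsFiniteMeasure ((Measure.sum fun n => μ.map fun ω => (X n ω, pointMeasure X ω)).restrict
        (spanningSets L j ×ˢ (univ : Set (Measure E)))) := by
      refine ⟨?_⟩
      have := hrect j univ univ MeasurableSet.univ MeasurableSet.univ
      rw [univ_inter] at this
      rw [Measure.restrict_apply_univ, this, Measure.map_apply hadd hW]
      have : (fun z : E × Ω => (z.1, pointMeasure X z.2 + Measure.dirac z.1)) ⁻¹'
          (spanningSets L j ×ˢ univ) = spanningSets L j ×ˢ univ := by
        ext z; simp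
      rw [this, Measure.prod_prod, measure_univ, mul_one]
      exact measure_spanningSets_lt_top L j
    refine Measure.ext_prod fun {s t} hs ht => ?_
    rw [Measure.restrict_apply (hs.prod ht), Measure.restrict_apply (hs.prod ht), prod_inter_prod,
      inter_univ]
    exact hrect j s t hs ht
  have h2 := congrArg (fun M => ∫⁻ z, G z ∂M) h
  simp only [lintegral_sum_measure] at h2
  have hm : Measurable fun z : E × Ω => G (z.1, pointMeasure X z.2 + Measure.dirac z.1) :=
    hG.comp hadd
  rw [lintegral_map hG hadd, lintegral_prod _ hm.aemeasurable] at h2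
  simp_rw [lintegral_map hG (hpt _)] at h2
  have hm1 : ∀ n, Measurable fun ω => G (X n ω, pointMeasure X ω) := fun n => hG.comp (hpt n)
  rw [← h2, lintegral_tsum fun n => (hm1 n).aemeasurable]

/-- Mecke's formula for pairs of points. -/
theorem HasPoissonLaplace.mecke_pair (hX : HasPoissonLaplace μ X L) [SigmaFinite L]
    {G : E → E → Measure E → ℝ≥0∞}
    (hG : Measurable fun z : E × E × Measure E => G z.1 z.2.1 z.2.2)
    (hdiag : ∀ x ξ, G x x ξ = 0) :
    ∫⁻ ω, ∑' n, ∑' m, G (X n ω) (X m ω) (pointMeasure X ω) ∂μ =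
      ∫⁻ x, ∫⁻ y, ∫⁻ ω,
        G x y (pointMeasure X ω + Measure.dirac x + Measure.dirac y) ∂μ ∂L ∂L := by
  -- The inner sum is an integral against the configuration itself, so the pair formula is the
  -- one-point formula for H followed by a second one-point formula with x already added.
  let H : E × Measure E → ℝ≥0∞ := fun z => ∫⁻ y, G z.1 y z.2 ∂(locFin L z.2)
  have hH : Measurable H := by
    refine measurable_lintegral_locFin L (G := fun (z : E × Measure E) y => G z.1 y z.2)
      ?_ measurable_snd
    exact hG.comp ((measurable_fst.fst).prodMk (measurable_snd.prodMk measurable_fst.snd))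
  have hsec : ∀ x ξ, Measurable fun y => G x y ξ := fun x ξ =>
    hG.comp (measurable_const.prodMk (measurable_id.prodMk measurable_const))
  have h1 : ∫⁻ ω, ∑' n, ∑' m, G (X n ω) (X m ω) (pointMeasure X ω) ∂μ =
      ∫⁻ ω, ∑' n, H (X n ω, pointMeasure X ω) ∂μ := by
    refine lintegral_congr_ae ?_
    filter_upwards [hX.ae_locallyFinite] with ω hω
    refine tsum_congr fun n => ?_
    simp only [H]
    rw [locFin_apply L hω, lintegral_pointMeasure X ω (hsec _ _)]
  rw [h1, hX.mecke hH]
  refine lintegral_congr fun x => ?_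
  have h2 := hX.mecke (G := fun z => G x z.1 (z.2 + Measure.dirac x))
    (hG.comp (measurable_const.prodMk (measurable_fst.prodMk
      (measurable_add_dirac measurable_snd measurable_const))))
  have h3 : ∀ ω y, pointMeasure X ω + Measure.dirac x + Measure.dirac y =
      pointMeasure X ω + Measure.dirac y + Measure.dirac x := fun ω y => by
    rw [add_assoc, add_assoc, add_comm (Measure.dirac x)]
  simp_rw [h3]
  rw [← h2]
  refine lintegral_congr_ae ?_
  filter_upwards [hX.ae_locallyFinite] with ω hω
  simp only [H]
  -- The added atom at x would pair x with itself; `hdiag` removes this term.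
  rw [locFin_apply L, lintegral_add_measure, lintegral_dirac' _ (hsec _ _), hdiag, add_zero,
    lintegral_pointMeasure X ω (hsec _ _)]
  intro j
  rw [Measure.add_apply]
  exact ENNReal.add_lt_top.2 ⟨hω j, measure_lt_top _ _⟩

end Mecke

end D2D

/-! ### Devices, servers and the decomposition of the interference -/

namespace D2D

/-- A device: its location, whether it caches file A, its fading and whether it is active. -/
abbrev Device : Type := Plane × Bool × ℝ × Bool

/-- The law of the marks of a device. -/
noncomputable def markLaw (p q : unitInterval) : Measure (Bool × ℝ × Bool) :=
  (bernoulliMeasure true false p).prod ((expMeasure 1).prod (bernoulliMeasure true false q))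

instance : IsProbabilityMeasure (expMeasure 1) := isProbabilityMeasure_expMeasure one_pos

instance (p q : unitInterval) : IsProbabilityMeasure (markLaw p q) := by
  unfold markLaw; infer_instance

/-- The intensity measure of the locations. -/
noncomputable def planeIntensity (lam : ℝ) : Measure Plane :=
  ENNReal.ofReal lam • (volume : Measure Plane)

instance (lam : ℝ) : SigmaFinite (planeIntensity lam) :=
  inferInstanceAs (SigmaFinite (lam.toNNReal • (volume : Measure Plane)))

/-- The intensity measure of the devices. -/
noncomputable def deviceIntensity (lam : ℝ) (p q : unitInterval) : Measure Device :=
  (planeIntensity lam).prod (markLaw p q)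

instance (lam : ℝ) (p q : unitInterval) : SigmaFinite (deviceIntensity lam p q) :=
  Measure.prod.instSigmaFinite (μ := planeIntensity lam) (ν := markLaw p q)

lemma lintegral_bernoulliMeasure (p : unitInterval) (f : Bool → ℝ≥0∞) :
    ∫⁻ b, f b ∂(bernoulliMeasure true false p) =
      ENNReal.ofReal p * f true + ENNReal.ofReal (1 - p) * f false := by
  rw [bernoulliMeasure_def, lintegral_add_measure]
  simp only [lintegral_smul_measure, lintegral_dirac]
  have h1 : (unitInterval.toNNReal p : ℝ≥0) = (p : ℝ).toNNReal :=
    NNReal.eq (Real.coe_toNNReal _ p.2.1).symm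
  have h2 : (unitInterval.toNNReal (unitInterval.symm p) : ℝ≥0) = (1 - p : ℝ).toNNReal :=
    NNReal.eq (Real.coe_toNNReal _ (sub_nonneg.2 p.2.2)).symm
  rw [h1, h2]
  rfl

lemma lintegral_deviceIntensity (lam : ℝ) (p q : unitInterval) {f : Device → ℝ≥0∞}
    (hf : Measurable f) : ∫⁻ x, f x ∂(deviceIntensity lam p q) =
      ENNReal.ofReal lam * ∫⁻ x : Plane,
        (ENNReal.ofReal p * ∫⁻ m, f (x, true, m) ∂((expMeasure 1).prod (bernoulliMeasure true false q))
        + ENNReal.ofReal (1 - p) *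
          ∫⁻ m, f (x, false, m) ∂((expMeasure 1).prod (bernoulliMeasure true false q))) := by
  rw [deviceIntensity, lintegral_prod _ hf.aemeasurable, planeIntensity, lintegral_smul_measure]
  congr 1
  refine lintegral_congr fun x => ?_
  have hfx : Measurable fun m => f (x, m) := hf.comp measurable_prodMk_left
  rw [markLaw, lintegral_prod _ hfx.aemeasurable, lintegral_bernoulliMeasure]

namespace Device

/-- Interference power of a device at the origin. -/
noncomputable def interf (α : ℝ) (w : Device) : ℝ≥0∞ :=
  if w.2.2.2 then ENNReal.ofReal (w.2.2.1 * ‖w.1‖ ^ (-α)) else 0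

/-- Devices at most as far from location 1 as `x`. -/
def near1 (v : ℝ) (x : Device) : Set Device := {w | dist w.1 (loc1 v) ≤ dist x.1 (loc1 v)}

/-- Devices with file A at most as far from location 2 as `y`. -/
def near2 (y : Device) : Set Device := {w | w.2.1 = true ∧ ‖w.1‖ ≤ ‖y.1‖}

/-- Interference of a device with file B farther from location 1 than `x`. -/
noncomputable def interfB (α v : ℝ) (x w : Device) : ℝ≥0∞ := by
  classical
  exact if w.2.1 = false ∧ dist x.1 (loc1 v) < dist w.1 (loc1 v) then interf α w else 0

/-- Interference of a device with file A farther from location 1 than `x` and farther from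
location 2 than `y`. -/
noncomputable def interfA (α v : ℝ) (x y w : Device) : ℝ≥0∞ := by
  classical
  exact if w.2.1 = true ∧ dist x.1 (loc1 v) < dist w.1 (loc1 v) ∧ ‖y.1‖ < ‖w.1‖
    then interf α w else 0

lemma measurable_interf (α : ℝ) : Measurable (interf α) := by
  unfold interf
  refine Measurable.ite ?_ ?_ measurable_const
  · exact measurable_snd.snd.snd (measurableSet_singleton true)
  · fun_prop

lemma measurableSet_near1 (v : ℝ) :
    MeasurableSet {z : Device × Device | z.2 ∈ near1 v z.1} := by
  refine measurableSet_le (f := fun z : Device × Device => dist z.2.1 (loc1 v))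
    (g := fun z : Device × Device => dist z.1.1 (loc1 v)) ?_ ?_ <;> fun_prop

lemma measurableSet_isA : MeasurableSet {w : Device | w.2.1 = true} :=
  measurable_snd.fst (measurableSet_singleton true)

lemma measurableSet_isB : MeasurableSet {w : Device | w.2.1 = false} :=
  measurable_snd.fst (measurableSet_singleton false)

lemma measurableSet_near2 :
    MeasurableSet {z : Device × Device | z.2 ∈ near2 z.1} := by
  refine (measurable_snd measurableSet_isA).inter ?_
  refine measurableSet_le (f := fun z : Device × Device => ‖z.2.1‖)
    (g := fun z : Device × Device => ‖z.1.1‖) ?_ ?_ <;> fun_prop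

lemma measurable_interfB (α v : ℝ) : Measurable fun z : Device × Device => interfB α v z.1 z.2 := by
  unfold interfB
  refine Measurable.ite ?_ ((measurable_interf α).comp measurable_snd) measurable_const
  refine (measurable_snd measurableSet_isB).inter ?_
  refine measurableSet_lt (g := fun z : Device × Device => dist z.2.1 (loc1 v))
    (f := fun z : Device × Device => dist z.1.1 (loc1 v)) ?_ ?_ <;> fun_prop

lemma measurable_interfA (α v : ℝ) :
    Measurable fun z : (Device × Device) × Device => interfA α v z.1.1 z.1.2 z.2 := by
  unfold interfA
  refine Measurable.ite ?_ ((measurable_interf α).comp measurable_snd) measurable_const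
  refine (measurable_snd measurableSet_isA).inter (MeasurableSet.inter ?_ ?_)
  · refine measurableSet_lt (g := fun z : (Device × Device) × Device => dist z.2.1 (loc1 v))
      (f := fun z : (Device × Device) × Device => dist z.1.1.1 (loc1 v)) ?_ ?_ <;> fun_prop
  · refine measurableSet_lt (g := fun z : (Device × Device) × Device => ‖z.2.1‖)
      (f := fun z : (Device × Device) × Device => ‖z.1.2.1‖) ?_ ?_ <;> fun_prop

lemma measurable_interfB_right (α v : ℝ) (x : Device) : Measurable (interfB α v x) :=
  (measurable_interfB α v).comp measurable_prodMk_left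

lemma measurable_interfA_right (α v : ℝ) (x y : Device) : Measurable (interfA α v x y) :=
  (measurable_interfA α v).comp (measurable_prodMk_left (x := (x, y)))

lemma measurableSet_near1_right (v : ℝ) (x : Device) : MeasurableSet (near1 v x) :=
  measurable_prodMk_left (measurableSet_near1 v)

lemma measurableSet_near2_right (y : Device) : MeasurableSet (near2 y) :=
  measurable_prodMk_left measurableSet_near2

/-- In the configuration `ξ`, the device `x` has file B and is the only one closest to location 1,
and `y` is the only one closest to location 2 among those with file A. -/
def IsServerPair (v : ℝ) (x y : Device) (ξ : Measure Device) : Prop :=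
  x.2.1 = false ∧ y.2.1 = true ∧ dist x.1 (loc1 v) < dist y.1 (loc1 v) ∧
    ξ (near1 v x) = 1 ∧ ξ (near2 y) = 1

end Device

open Device

namespace Network

variable {Ω : Type*} [MeasurableSpace Ω] {μ : Measure Ω} {lam : ℝ} {p q : unitInterval}

/-- The `n`-th device. -/
def dev (N : Network μ lam p q) (n : ℕ) (ω : Ω) : Device :=
  (N.X n ω, N.cachesA n ω, N.h n ω, N.t n ω)

lemma hasPoissonLaplace [IsProbabilityMeasure μ] (N : Network μ lam p q) :
    HasPoissonLaplace μ N.dev (deviceIntensity lam p q) :=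
  HasPoissonLaplace.marked
    (IsPoissonProcess.hasPoissonLaplace (L := planeIntensity lam) N.poisson)
    (fun n => (N.measurable_cachesA n).prodMk ((N.measurable_h n).prodMk (N.measurable_t n)))
    N.mark_indep N.mark_law N.indep

end Network

/-- If a point is strictly closer to `z` than all others, it is the nearest one. -/
lemma nearestIdx_eq {y : ℕ → Plane} {S : Set ℕ} {z : Plane} {n : ℕ} (hn : n ∈ S)
    (h : ∀ m ∈ S, m ≠ n → dist (y n) z < dist (y m) z) : nearestIdx y S z = n := by
  have : {n | n ∈ S ∧ ∀ m ∈ S, dist (y n) z ≤ dist (y m) z} = {n} := by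
    ext k
    simp only [mem_ofPred_eq, mem_singleton_iff]
    constructor
    · rintro ⟨hk, hk2⟩
      by_contra hkn
      exact absurd (hk2 n hn) (not_le.2 (h k hk hkn))
    · rintro rfl
      refine ⟨hn, fun m hm => ?_⟩
      by_cases hmk : m = k
      · rw [hmk]
      · exact (h m hm hmk).le
  rw [nearestIdx, this, csInf_singleton]

/-- Points are counted with multiplicity, so two indices in B would give mass at least 2, even if
their points coincide. -/
lemma eq_of_pointMeasure_eq_one {Ω E : Type*} [MeasurableSpace E] {X : ℕ → Ω → E} {ω : Ω}
    {B : Set E} (hB : MeasurableSet B) (h : pointMeasure X ω B = 1) {k n : ℕ} (hk : X k ω ∈ B)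
    (hn : X n ω ∈ B) : k = n := by
  by_contra hkn
  rw [pointMeasure_apply X ω hB] at h
  have h2 := ENNReal.sum_le_tsum (f := fun n => B.indicator (1 : E → ℝ≥0∞) (X n ω)) {k, n}
  rw [Finset.sum_pair hkn, h, indicator_of_mem hk, indicator_of_mem hn] at h2
  norm_num at h2

lemma measurable_nat_sInf {Ω : Type*} [MeasurableSpace Ω] {S : Ω → Set ℕ}
    (hS : ∀ n, MeasurableSet {ω | n ∈ S ω}) : Measurable fun ω => sInf (S ω) := by
  refine measurable_to_countable' fun n => ?_
  have h1 : MeasurableSet {ω | n ∈ S ω ∧ ∀ k < n, k ∉ S ω} := by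
    refine (hS n).inter ?_
    have : {ω | ∀ k < n, k ∉ S ω} = ⋂ k, ⋂ (_ : k < n), {ω | k ∈ S ω}ᶜ := by
      ext ω; simp
    change MeasurableSet {ω | ∀ k < n, k ∉ S ω}
    rw [this]
    exact MeasurableSet.iInter fun k => MeasurableSet.iInter fun _ => (hS k).compl
  -- The infimum of the empty set is 0, so the value 0 has a second source.
  have h2 : MeasurableSet {ω | n = 0 ∧ ∀ k, k ∉ S ω} := by
    refine (MeasurableSet.const _).inter ?_
    have : {ω | ∀ k, k ∉ S ω} = ⋂ k, {ω | k ∈ S ω}ᶜ := by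
      ext ω; simp
    change MeasurableSet {ω | ∀ k, k ∉ S ω}
    rw [this]
    exact MeasurableSet.iInter fun k => (hS k).compl
  convert! h1.union h2 using 1
  ext ω
  simp only [mem_preimage, mem_singleton_iff, mem_union, mem_ofPred_eq]
  constructor
  · intro h
    by_cases hne : (S ω).Nonempty
    · left
      refine ⟨h ▸ Nat.sInf_mem hne, fun k hk hk2 => ?_⟩
      exact absurd (Nat.sInf_le hk2) (by omega)
    · right
      rw [not_nonempty_iff_eq_empty] at hne
      simp [hne] at h
      simp [hne, h]
  · rintro (⟨h1, h2⟩ | ⟨rfl, h⟩)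
    · refine le_antisymm (Nat.sInf_le h1) ?_
      by_contra hlt
      exact h2 _ (not_le.1 hlt) (Nat.sInf_mem ⟨n, h1⟩)
    · rw [eq_empty_iff_forall_notMem.2 h, Nat.sInf_empty]

lemma measurable_nearestIdx {Ω : Type*} [MeasurableSpace Ω] {y : ℕ → Ω → Plane}
    (hy : ∀ n, Measurable (y n)) {S : Ω → Set ℕ} (hS : ∀ n, MeasurableSet {ω | n ∈ S ω})
    (z : Plane) : Measurable fun ω => nearestIdx (fun n => y n ω) (S ω) z := by
  refine measurable_nat_sInf fun n => ?_
  refine (hS n).inter ?_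
  have : {ω | ∀ m ∈ S ω, dist (y n ω) z ≤ dist (y m ω) z} =
      ⋂ m, ({ω | m ∈ S ω}ᶜ ∪ {ω | dist (y n ω) z ≤ dist (y m ω) z}) := by
    ext ω
    simp only [mem_ofPred_eq, mem_iInter, mem_union, mem_compl_iff]
    exact forall_congr' fun m => by tauto
  change MeasurableSet {ω | ∀ m ∈ S ω, dist (y n ω) z ≤ dist (y m ω) z}
  rw [this]
  exact MeasurableSet.iInter fun m => (hS m).compl.union
    (measurableSet_le ((hy n).dist measurable_const) ((hy m).dist measurable_const))

lemma measurable_apply_index {Ω E : Type*} [MeasurableSpace Ω] [MeasurableSpace E]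
    {f : ℕ → Ω → E} (hf : ∀ n, Measurable (f n)) {s : Ω → ℕ} (hs : Measurable s) :
    Measurable fun ω => f (s ω) ω := by
  have : Measurable fun z : ℕ × Ω => f z.1 z.2 := measurable_from_prod_countable_right fun n => hf n
  exact this.comp (hs.prodMk measurable_id)

namespace Network

variable {Ω : Type*} [MeasurableSpace Ω] {μ : Measure Ω} {lam : ℝ} {p q : unitInterval}
  (N : Network μ lam p q)

lemma measurable_dev (n : ℕ) : Measurable (N.dev n) :=
  (N.poisson.measurable n).prodMk
    ((N.measurable_cachesA n).prodMk ((N.measurable_h n).prodMk (N.measurable_t n)))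

lemma measurable_server1 (v : ℝ) : Measurable (N.server1 v) :=
  measurable_nearestIdx N.poisson.measurable (S := fun _ => univ) (fun _ => by simp) _

lemma measurable_server2 (v : ℝ) : Measurable (N.server2 v) := by
  refine measurable_nearestIdx N.poisson.measurable
    (S := fun ω => {n | N.cachesA n ω ≠ N.cachesA (N.server1 v ω) ω}) (fun n => ?_) _
  have h1 := measurable_apply_index N.measurable_cachesA (N.measurable_server1 v)
  exact (measurableSet_eq_fun (N.measurable_cachesA n) h1).compl

/-- The device that serves location 1. -/
noncomputable def dev1 (v : ℝ) (ω : Ω) : Device := N.dev (N.server1 v ω) ω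

/-- The device that serves location 2. -/
noncomputable def dev2 (v : ℝ) (ω : Ω) : Device := N.dev (N.server2 v ω) ω

lemma measurable_dev1 (v : ℝ) : Measurable (N.dev1 v) :=
  measurable_apply_index N.measurable_dev (N.measurable_server1 v)

lemma measurable_dev2 (v : ℝ) : Measurable (N.dev2 v) :=
  measurable_apply_index N.measurable_dev (N.measurable_server2 v)

lemma measurableSet_subcaseY (v : ℝ) : MeasurableSet (N.subcaseY v) :=
  N.measurable_dev1 v measurableSet_isB

/-- The configuration of devices. -/
noncomputable def config (ω : Ω) : Measure Device := pointMeasure N.dev ω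

lemma measurable_config : Measurable N.config := measurable_pointMeasure N.measurable_dev

lemma I1_eq (α v : ℝ) (ω : Ω) : N.I1 α v ω = Device.interf α (N.dev1 v ω) := rfl

lemma I2_eq (α v : ℝ) (ω : Ω) :
    N.I2 α v ω = ∫⁻ w, interfB α v (N.dev1 v ω) w ∂(N.config ω) := by
  classical
  rw [config, lintegral_pointMeasure _ _ (measurable_interfB_right _ _ _), I2]
  refine tsum_congr fun n => ?_
  simp only [indicator_apply, mem_ofPred_eq, interfB, Metric.mem_closedBall, not_le]
  rfl

lemma I3_eq (α v : ℝ) (ω : Ω) :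
    N.I3 α v ω = ∫⁻ w, interfA α v (N.dev1 v ω) (N.dev2 v ω) w ∂(N.config ω) := by
  classical
  rw [config, lintegral_pointMeasure _ _ (measurable_interfA_right _ _ _ _), I3]
  refine tsum_congr fun n => ?_
  simp only [indicator_apply, mem_ofPred_eq, interfA, Metric.mem_closedBall, not_le, mem_union,
    not_or, dist_zero_right]
  rfl

lemma measurable_I1 (α v : ℝ) : Measurable (N.I1 α v) :=
  (measurable_interf α).comp (N.measurable_dev1 v)

lemma measurable_I2 (α v : ℝ) : Measurable (N.I2 α v) := by
  simp_rw [funext (N.I2_eq α v), config,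
    lintegral_pointMeasure _ _ (measurable_interfB_right _ _ _)]
  exact Measurable.tsum fun n =>
    (measurable_interfB α v).comp ((N.measurable_dev1 v).prodMk (N.measurable_dev n))

lemma measurable_I3 (α v : ℝ) : Measurable (N.I3 α v) := by
  simp_rw [funext (N.I3_eq α v), config,
    lintegral_pointMeasure _ _ (measurable_interfA_right _ _ _ _)]
  exact Measurable.tsum fun n => (measurable_interfA α v).comp
    (((N.measurable_dev1 v).prodMk (N.measurable_dev2 v)).prodMk (N.measurable_dev n))

variable {N} in
lemma server1_eq_of_unique {v : ℝ} {ω : Ω} {n : ℕ} (h : N.config ω (near1 v (N.dev n ω)) = 1) :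
    N.server1 v ω = n := by
  refine nearestIdx_eq (mem_univ _) fun k _ hk => ?_
  by_contra hle
  exact hk (eq_of_pointMeasure_eq_one (measurableSet_near1_right _ _) h (not_lt.1 hle)
    (le_refl (dist (N.X n ω) (loc1 v))))

variable {N} in
lemma server_eq_of_isServerPair {v : ℝ} {ω : Ω} {n m : ℕ}
    (h : IsServerPair v (N.dev n ω) (N.dev m ω) (N.config ω)) :
    N.server1 v ω = n ∧ N.server2 v ω = m := by
  obtain ⟨hn, hm, -, h1, h2⟩ := h
  have hs := server1_eq_of_unique h1
  refine ⟨hs, ?_⟩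
  have hn' : N.cachesA n ω = false := hn
  have hm' : N.cachesA m ω = true := hm
  have hS : ∀ k, k ∈ {k | N.cachesA k ω ≠ N.cachesA (N.server1 v ω) ω} ↔ N.cachesA k ω = true := by
    intro k
    rw [mem_ofPred_eq, hs, hn']; simp
  refine nearestIdx_eq ((hS m).2 hm) fun k hk hkm => ?_
  rw [dist_zero_right, dist_zero_right]
  by_contra hle
  exact hkm (eq_of_pointMeasure_eq_one (measurableSet_near2_right _) h2
    ⟨(hS k).1 hk, not_lt.1 hle⟩ ⟨hm, le_refl ‖N.X m ω‖⟩)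

/-- The event that the servers are unique and file 1 is file B. -/
def pairEvent (v : ℝ) : Set Ω := {ω | IsServerPair v (N.dev1 v ω) (N.dev2 v ω) (N.config ω)}

lemma pairEvent_subset (v : ℝ) : N.pairEvent v ⊆ N.subcaseY v := fun _ h => h.1

/-- A sum over all pairs of devices picks out the pair of servers. -/
lemma tsum_tsum_isServerPair (v : ℝ) (ω : Ω) (K : Device → Device → ℝ≥0∞) :
    ∑' n, ∑' m, {z : Device × Device | IsServerPair v z.1 z.2 (N.config ω)}.indicator
        (fun z => K z.1 z.2) (N.dev n ω, N.dev m ω) =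
      (N.pairEvent v).indicator (fun ω => K (N.dev1 v ω) (N.dev2 v ω)) ω := by
  classical
  rw [tsum_eq_single (N.server1 v ω), tsum_eq_single (N.server2 v ω)]
  · simp only [indicator_apply, pairEvent, mem_ofPred_eq, dev1, dev2]
  · intro m hm
    rw [indicator_of_notMem]
    exact fun h => hm (server_eq_of_isServerPair h).2.symm
  · intro n hn
    rw [ENNReal.tsum_eq_zero]
    intro m
    rw [indicator_of_notMem]
    exact fun h => hn (server_eq_of_isServerPair h).1.symm

/-- On the event that the servers are unique, the interference is the sum of the three parts. -/
lemma tsum_interf_eq {α v : ℝ} {ω : Ω} (h : ω ∈ N.pairEvent v) :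
    ∑' n, Set.indicator {n | n ≠ N.server2 v ω} (N.interf α ω) n =
      N.I1 α v ω + N.I2 α v ω + N.I3 α v ω := by
  classical
  obtain ⟨hB, hA, hlt, h1, h2⟩ := h
  have hI1 : N.I1 α v ω = ∑' n, if n = N.server1 v ω then N.interf α ω n else 0 := by
    rw [tsum_ite_eq]; rfl
  rw [hI1, I2, I3, ← ENNReal.tsum_add, ← ENNReal.tsum_add]
  refine tsum_congr fun n => ?_
  have hB' : N.cachesA (N.server1 v ω) ω = false := hB
  have hA' : N.cachesA (N.server2 v ω) ω = true := hA
  have hR1 : N.R1 v ω = dist (N.X (N.server1 v ω) ω) (loc1 v) := rfl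
  have hR2 : N.R2 v ω = ‖N.X (N.server2 v ω) ω‖ := rfl
  have hn1 : n ≠ N.server1 v ω → N.X n ω ∉ Metric.closedBall (loc1 v) (N.R1 v ω) := by
    intro hn hmem
    exact hn (eq_of_pointMeasure_eq_one (measurableSet_near1_right _ _) h1 hmem
      (le_refl (dist (N.X (N.server1 v ω) ω) (loc1 v))))
  have hn2 : n ≠ N.server2 v ω → N.cachesA n ω = true →
      N.X n ω ∉ Metric.closedBall (0 : Plane) (N.R2 v ω) := by
    intro hn hc hmem
    rw [mem_closedBall_zero_iff] at hmem
    exact hn (eq_of_pointMeasure_eq_one (measurableSet_near2_right _) h2 ⟨hc, hmem⟩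
      ⟨hA, le_refl ‖N.X (N.server2 v ω) ω‖⟩)
  -- Server 1 lies on the boundary of the closed disk 𝒞₁, so it is counted in I₁ only.
  by_cases hns1 : n = N.server1 v ω
  · have hc : N.cachesA n ω = false := hns1 ▸ hB'
    have hne : n ≠ N.server2 v ω := fun h => by rw [h, hA'] at hc; simp at hc
    have hin : N.X n ω ∈ Metric.closedBall (loc1 v) (N.R1 v ω) := by
      rw [Metric.mem_closedBall, hns1]; exact le_rfl
    rw [indicator_of_mem (by exact hne), if_pos hns1, indicator_of_notMem (fun h => h.2 hin),
      indicator_of_notMem (fun h => h.2 (Or.inl hin)), add_zero, add_zero]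
  rw [if_neg hns1, zero_add]
  -- Server 2 caches A and lies on the boundary of 𝒞₂, so it enters none of the three terms. Every
  -- further device is outside 𝒞₁, and outside 𝒞₂ if it caches A.
  by_cases hns2 : n = N.server2 v ω
  · have hc : N.cachesA n ω = true := hns2 ▸ hA'
    have hin : N.X n ω ∈ Metric.closedBall (0 : Plane) (N.R2 v ω) := by
      rw [mem_closedBall_zero_iff, hns2]; exact le_rfl
    rw [indicator_of_notMem (s := {n | n ≠ N.server2 v ω}) (fun h => h hns2), indicator_of_notMem (fun h => by simp [hc] at h),
      indicator_of_notMem (fun h => h.2 (Or.inr hin)), add_zero]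
  · have h3 := hn1 hns1
    rw [indicator_of_mem (by exact hns2)]
    cases hc : N.cachesA n ω
    · rw [indicator_of_mem (by exact ⟨hc, h3⟩), indicator_of_notMem (fun h => by simp [hc] at h),
        add_zero]
    · have h4 := hn2 hns2 hc
      rw [indicator_of_notMem (fun h => by simp [hc] at h),
        indicator_of_mem (by exact ⟨hc, fun h => h.elim h3 h4⟩), zero_add]

/-- Clearing the denominator is legitimate also when it is 0 or ∞: in `ℝ≥0∞` one has 0/0 = 0, P/0 =
∞ for P > 0, and P/∞ = 0, so both sides have the same truth value. -/
lemma lt_SIR_iff {α v T : ℝ} (hT : 0 < T) {ω : Ω} (h : ω ∈ N.pairEvent v) :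
    ENNReal.ofReal T < N.SIR α v ω ↔
      ENNReal.ofReal T * (N.I1 α v ω + N.I2 α v ω + N.I3 α v ω) <
        ENNReal.ofReal ((N.dev2 v ω).2.2.1 * ‖(N.dev2 v ω).1‖ ^ (-α)) := by
  rw [SIR, N.tsum_interf_eq h]
  set D := N.I1 α v ω + N.I2 α v ω + N.I3 α v ω
  change _ < ENNReal.ofReal ((N.dev2 v ω).2.2.1 * ‖(N.dev2 v ω).1‖ ^ (-α)) / D ↔ _
  set P := ENNReal.ofReal ((N.dev2 v ω).2.2.1 * ‖(N.dev2 v ω).1‖ ^ (-α)) with hP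
  have hPt : P ≠ ∞ := ENNReal.ofReal_ne_top
  have hT0 : ENNReal.ofReal T ≠ 0 := by simpa using hT
  by_cases hD0 : D = 0
  · rw [hD0, mul_zero]
    by_cases hP0 : P = 0
    · simp [hP0]
    · rw [ENNReal.div_zero hP0]
      simp [pos_iff_ne_zero, hP0]
  by_cases hDt : D = ∞
  · simp [hDt, ENNReal.mul_top hT0]
  exact ENNReal.lt_div_iff_mul_lt (Or.inl hD0) (Or.inl hDt)

end Network

end D2D

/-! ### Exponential fading and polar coordinates -/

namespace D2D

lemma lintegral_expMeasure {f : ℝ → ℝ≥0∞} (hf : Measurable f) :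
    ∫⁻ x, f x ∂(expMeasure 1) = ∫⁻ x in Ioi 0, ENNReal.ofReal (Real.exp (-x)) * f x := by
  have h1 : expMeasure 1 = volume.withDensity (exponentialPDF 1) := rfl
  have h2 : Measurable (exponentialPDF 1) := (measurable_exponentialPDFReal 1).ennreal_ofReal
  rw [h1, lintegral_withDensity_eq_lintegral_mul _ h2 hf, ← setLIntegral_univ,
    ← lintegral_add_compl _ (measurableSet_Ioi (a := (0 : ℝ)))]
  simp only [Measure.restrict_univ]
  have h3 : ∫⁻ x in (Ioi 0)ᶜ, (exponentialPDF 1 * f) x = 0 := by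
    rw [compl_Ioi, ← restrict_Iio_eq_restrict_Iic]
    rw [setLIntegral_congr_fun measurableSet_Iio (g := fun _ => 0)]
    · simp
    · intro x hx
      simp only [Pi.mul_apply]
      rw [exponentialPDF_of_neg hx, zero_mul]
  rw [h3, add_zero]
  refine setLIntegral_congr_fun measurableSet_Ioi fun x hx => ?_
  simp only [Pi.mul_apply]
  rw [exponentialPDF_of_nonneg (le_of_lt hx)]
  simp

lemma lintegral_Ioi_exp_neg_mul {k : ℝ} (hk : 0 < k) (c : ℝ) :
    ∫⁻ x in Ioi c, ENNReal.ofReal (Real.exp (-(k * x))) =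
      ENNReal.ofReal (Real.exp (-(k * c)) / k) := by
  have h := integrableOn_exp_mul_Ioi (neg_lt_zero.2 hk) c
  simp only [neg_mul] at h
  rw [← ofReal_integral_eq_lintegral_ofReal h (ae_of_all _ fun x => (Real.exp_nonneg _))]
  congr 1
  have := integral_exp_mul_Ioi (neg_lt_zero.2 hk) c
  simp only [neg_mul] at this
  rw [this]
  field_simp

lemma lintegral_expNeg_expMeasure {k : ℝ} (hk : 0 ≤ k) :
    ∫⁻ x, expNeg (ENNReal.ofReal (x * k)) ∂(expMeasure 1) = ENNReal.ofReal (1 / (1 + k)) := by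
  rw [lintegral_expMeasure (by fun_prop)]
  have h := lintegral_Ioi_exp_neg_mul (k := 1 + k) (by linarith) 0
  simp only [mul_zero, neg_zero, Real.exp_zero] at h
  rw [← h]
  refine setLIntegral_congr_fun measurableSet_Ioi fun x hx => ?_
  have hx : 0 < x := hx
  rw [expNeg_ofReal (by positivity), ← ENNReal.ofReal_mul (Real.exp_nonneg _), ← Real.exp_add]
  congr 2; ring

/-- The exponential tail is itself a value of `expNeg`; this is what converts coverage into a
Laplace transform of the interference. For V = ∞ both sides vanish. -/
lemma expMeasure_lt_ofReal_mul {k : ℝ} (hk : 0 < k) (V : ℝ≥0∞) :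
    expMeasure 1 {x | V < ENNReal.ofReal (x * k)} = expNeg (ENNReal.ofReal k⁻¹ * V) := by
  have hm : MeasurableSet {x : ℝ | V < ENNReal.ofReal (x * k)} :=
    measurableSet_lt measurable_const (by fun_prop)
  by_cases hV : V = ∞
  · subst hV
    rw [ENNReal.mul_top (by simpa using hk)]
    simp
  obtain ⟨u, hu, rfl⟩ : ∃ u : ℝ, 0 ≤ u ∧ V = ENNReal.ofReal u :=
    ⟨V.toReal, ENNReal.toReal_nonneg, (ENNReal.ofReal_toReal hV).symm⟩
  have hset : {x : ℝ | ENNReal.ofReal u < ENNReal.ofReal (x * k)} = Ioi (u / k) := by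
    ext x
    simp only [mem_ofPred_eq, mem_Ioi]
    rw [ENNReal.ofReal_lt_ofReal_iff', div_lt_iff₀ hk]
    exact ⟨fun h => h.1, fun h => ⟨h, hu.trans_lt h⟩⟩
  rw [hset, ← lintegral_indicator_one measurableSet_Ioi,
    lintegral_expMeasure (measurable_one.indicator measurableSet_Ioi),
    ← ENNReal.ofReal_mul (by positivity), expNeg_ofReal (by positivity)]
  have h1 : ∀ x, ENNReal.ofReal (Real.exp (-x)) * (Ioi (u / k)).indicator 1 x =
      (Ioi (u / k)).indicator (fun x => ENNReal.ofReal (Real.exp (-x))) x := by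
    intro x
    by_cases hx : x ∈ Ioi (u / k)
    · simp only [indicator_of_mem hx]; simp
    · simp only [indicator_of_notMem hx]; simp
  simp_rw [h1]
  rw [setLIntegral_indicator measurableSet_Ioi, inter_eq_left.2 (Ioi_subset_Ioi (by positivity))]
  have h := lintegral_Ioi_exp_neg_mul one_pos (u / k)
  simp only [one_mul, div_one] at h
  rw [h]
  congr 2
  ring

section Plane

lemma lintegral_plane {f : Plane → ℝ≥0∞} (hf : Measurable f) :
    ∫⁻ w, f w = ∫⁻ r in Ioi (0 : ℝ), ∫⁻ θ in Ioo (-Real.pi) Real.pi,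
      ENNReal.ofReal r * f !₂[r * Real.cos θ, r * Real.sin θ] := by
  have hm : Measurable fun z : ℝ × ℝ => (!₂[z.1, z.2] : Plane) := by
    refine (PiLp.continuous_toLp 2 _).measurable.comp ?_
    refine measurable_pi_iff.2 fun i => ?_
    fin_cases i
    · exact measurable_fst
    · exact measurable_snd
  have h1 : ∫⁻ w, f w = ∫⁻ z : ℝ × ℝ, f !₂[z.1, z.2] := by
    have e1 := (PiLp.volume_preserving_toLp (Fin 2)).comp
      (volume_preserving_finTwoArrow ℝ).symm
    have := e1.lintegral_comp hf
    rw [← this]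
    rfl
  rw [h1, ← lintegral_comp_polarCoord_symm fun z => f !₂[z.1, z.2]]
  have h2 : polarCoord.target = Ioi (0 : ℝ) ×ˢ Ioo (-Real.pi) Real.pi := rfl
  have hm2 : Measurable fun z : ℝ × ℝ =>
      ENNReal.ofReal z.1 * f !₂[z.1 * Real.cos z.2, z.1 * Real.sin z.2] := by
    have hm3 : Measurable fun z : ℝ × ℝ => (z.1 * Real.cos z.2, z.1 * Real.sin z.2) := by fun_prop
    exact Measurable.mul (by fun_prop) (hf.comp (hm.comp hm3))
  rw [h2, Measure.volume_eq_prod, ← Measure.prod_restrict]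
  exact lintegral_prod _ hm2.aemeasurable

lemma norm_polar {r : ℝ} (hr : 0 ≤ r) (θ : ℝ) :
    ‖(!₂[r * Real.cos θ, r * Real.sin θ] : Plane)‖ = r := by
  rw [EuclideanSpace.norm_eq, Real.sqrt_eq_iff_mul_self_eq (by positivity) hr]
  simp only [Fin.sum_univ_two, Real.norm_eq_abs, sq_abs]
  simp
  nlinarith [Real.sin_sq_add_cos_sq θ]

lemma norm_add_loc1_sq (v r θ : ℝ) :
    ‖(!₂[r * Real.cos θ, r * Real.sin θ] : Plane) + loc1 v‖ ^ 2 =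
      r ^ 2 + v ^ 2 - 2 * r * v * Real.cos θ := by
  rw [EuclideanSpace.norm_eq, Real.sq_sqrt (by positivity)]
  simp only [Fin.sum_univ_two, Real.norm_eq_abs, sq_abs, loc1]
  simp
  nlinarith [Real.sin_sq_add_cos_sq θ]

lemma dist_polar_loc1_sq (v r θ : ℝ) :
    dist (!₂[r * Real.cos θ, r * Real.sin θ] : Plane) (loc1 v) ^ 2 =
      r ^ 2 + v ^ 2 + 2 * r * v * Real.cos θ := by
  rw [EuclideanSpace.dist_eq, Real.sq_sqrt (by positivity)]
  simp only [Fin.sum_univ_two, Real.dist_eq, sq_abs, loc1]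
  simp
  nlinarith [Real.sin_sq_add_cos_sq θ]

lemma angle_polar {r θ : ℝ} (hr : 0 < r) (hθ : θ ∈ Ioo (-Real.pi) Real.pi) :
    InnerProductGeometry.angle (!₂[r * Real.cos θ, r * Real.sin θ] : Plane) !₂[1, 0] = |θ| := by
  rw [InnerProductGeometry.angle, norm_polar hr.le]
  have h1 : ‖(!₂[1, 0] : Plane)‖ = 1 := by
    rw [EuclideanSpace.norm_eq]; simp
  have h2 : inner ℝ (!₂[r * Real.cos θ, r * Real.sin θ] : Plane) !₂[1, 0] = r * Real.cos θ := by
    simp [PiLp.inner_apply]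
  rw [h1, h2, mul_one, mul_div_cancel_left₀ _ hr.ne', ← Real.cos_abs,
    Real.arccos_cos (abs_nonneg _) (abs_le.2 ⟨hθ.1.le, hθ.2.le⟩)]

/-- The half-width of the disk of radius `r₁` around location 1, seen from the origin at
distance `r`; this is `halfAngle` unless `v = 0`. -/
noncomputable def halfWidth (v r₁ r : ℝ) : ℝ :=
  if v = 0 then (if r ≤ r₁ then Real.pi else 0) else halfAngle v r₁ r

lemma halfWidth_nonneg (v r₁ r : ℝ) : 0 ≤ halfWidth v r₁ r := by
  unfold halfWidth
  split_ifs
  · exact Real.pi_pos.le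
  · exact le_rfl
  · exact Real.arccos_nonneg _

lemma halfWidth_le_pi (v r₁ r : ℝ) : halfWidth v r₁ r ≤ Real.pi := by
  unfold halfWidth
  split_ifs
  · exact le_rfl
  · exact Real.pi_pos.le
  · exact Real.arccos_le_pi _

/-- The length of the part of the circle of radius `r` around the origin that lies outside the
disk of radius `r₁` around location 1. -/
noncomputable def arcLength (v r₁ r : ℝ) : ℝ := 2 * r * (Real.pi - halfWidth v r₁ r)

lemma arcLength_nonneg (v r₁ : ℝ) {r : ℝ} (hr : 0 ≤ r) : 0 ≤ arcLength v r₁ r :=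
  mul_nonneg (by linarith) (sub_nonneg.2 (halfWidth_le_pi v r₁ r))

lemma measurable_halfWidth (v : ℝ) : Measurable fun z : ℝ × ℝ => halfWidth v z.1 z.2 := by
  unfold halfWidth halfAngle
  refine Measurable.ite (MeasurableSet.const _) (Measurable.ite ?_ measurable_const
    measurable_const) ?_
  · exact measurableSet_le measurable_snd measurable_fst
  · exact Real.continuous_arccos.measurable.comp (by fun_prop)

lemma measurable_arcLength (v : ℝ) : Measurable fun z : ℝ × ℝ => arcLength v z.1 z.2 := by
  unfold arcLength
  exact (measurable_snd.const_mul 2).mul ((measurable_halfWidth v).const_sub _)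

/-- By the law of cosines the squared distance to (-v, 0) is r² + v² + 2rv cos θ. A point is thus
outside the disk exactly when cos θ > -u, where u is the argument of `arccos` in `halfAngle`, and π
- arccos u = arccos(-u). -/
lemma lt_dist_polar_loc1_iff {v r₁ r θ : ℝ} (hv : 0 ≤ v) (hr₁ : 0 ≤ r₁) (hr : 0 < r)
    (hθ : θ ∈ Ioo (-Real.pi) Real.pi) :
    r₁ < dist (!₂[r * Real.cos θ, r * Real.sin θ] : Plane) (loc1 v) ↔
      |θ| < Real.pi - halfWidth v r₁ r := by
  rw [← sq_lt_sq₀ hr₁ dist_nonneg, dist_polar_loc1_sq]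
  have hθ' : |θ| < Real.pi := abs_lt.2 hθ
  unfold halfWidth
  split_ifs with h0 h1
  · have : ¬ |θ| < Real.pi - Real.pi := by simp
    simp only [this, iff_false, h0]
    nlinarith
  · simp only [h0, sub_zero, hθ', iff_true]
    nlinarith
  · have hv' : 0 < v := lt_of_le_of_ne hv (Ne.symm h0)
    rw [halfAngle, ← Real.arccos_neg]
    set u := (r ^ 2 + v ^ 2 - r₁ ^ 2) / (2 * r * v) with hu
    have hpos : 0 < 2 * r * v := by positivity
    have h2 : u * (2 * r * v) = r ^ 2 + v ^ 2 - r₁ ^ 2 := div_mul_cancel₀ _ hpos.ne'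
    have h3 : r₁ ^ 2 < r ^ 2 + v ^ 2 + 2 * r * v * Real.cos θ ↔ -u < Real.cos θ := by
      constructor
      · intro h
        by_contra hle
        nlinarith [mul_le_mul_of_nonneg_right (not_lt.1 hle) hpos.le]
      · intro h
        nlinarith [mul_lt_mul_of_pos_right h hpos]
    rw [h3, ← Real.cos_abs]
    -- When u is outside [-1, 1] the circle does not cross the boundary of the disk. The constant
    -- values of `arccos` there match: u > 1 puts the circle wholly outside, u < -1 wholly inside.
    rcases lt_or_ge (-u) (-1) with h4 | h4
    · rw [Real.arccos_of_le_neg_one h4.le]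
      exact ⟨fun _ => hθ', fun _ => h4.trans_le (Real.neg_one_le_cos _)⟩
    rcases lt_or_ge 1 (-u) with h5 | h5
    · rw [Real.arccos_of_one_le h5.le]
      exact ⟨fun h => absurd (h5.trans h) (not_lt.2 (Real.cos_le_one _)),
        fun h => absurd h (not_lt.2 (abs_nonneg _))⟩
    constructor
    · intro h
      by_contra hle
      have := Real.cos_le_cos_of_nonneg_of_le_pi (Real.arccos_nonneg _) hθ'.le (not_lt.1 hle)
      rw [Real.cos_arccos h4 h5] at this
      linarith
    · intro h
      have := Real.cos_lt_cos_of_nonneg_of_le_pi (abs_nonneg _) (Real.arccos_le_pi _) h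
      rwa [Real.cos_arccos h4 h5] at this

/-- Integration of a radial function over the complement of the disk around location 1. -/
lemma lintegral_compl_disk {v r₁ : ℝ} (hv : 0 ≤ v) (hr₁ : 0 ≤ r₁) {F : ℝ → ℝ≥0∞}
    (hF : Measurable F) :
    ∫⁻ w in {w : Plane | r₁ < dist w (loc1 v)}, F ‖w‖ =
      ∫⁻ r in Ioi (0 : ℝ), F r * ENNReal.ofReal (arcLength v r₁ r) := by
  have hS : MeasurableSet {w : Plane | r₁ < dist w (loc1 v)} :=
    measurableSet_lt measurable_const (by fun_prop)
  have hFn : Measurable fun w : Plane => F ‖w‖ := hF.comp measurable_norm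
  rw [← lintegral_indicator hS, lintegral_plane (hFn.indicator hS)]
  refine setLIntegral_congr_fun measurableSet_Ioi fun r hr => ?_
  have hr : 0 < r := hr
  have h1 : ∀ θ ∈ Ioo (-Real.pi) Real.pi, ENNReal.ofReal r *
      {w : Plane | r₁ < dist w (loc1 v)}.indicator (fun w => F ‖w‖)
        !₂[r * Real.cos θ, r * Real.sin θ] =
      (Ioo (-(Real.pi - halfWidth v r₁ r)) (Real.pi - halfWidth v r₁ r)).indicator
        (fun _ => ENNReal.ofReal r * F r) θ := by
    intro θ hθ
    have h := lt_dist_polar_loc1_iff hv hr₁ hr hθ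
    by_cases hc : |θ| < Real.pi - halfWidth v r₁ r
    · rw [indicator_of_mem (by exact h.2 hc), indicator_of_mem (by exact abs_lt.1 hc),
        norm_polar hr.le]
    · rw [indicator_of_notMem (s := {w : Plane | r₁ < dist w (loc1 v)}) (fun hx => hc (h.1 hx)),
        mul_zero, indicator_of_notMem (s := Ioo _ _) (fun hx => hc (abs_lt.2 hx))]
  rw [setLIntegral_congr_fun measurableSet_Ioo h1, setLIntegral_indicator measurableSet_Ioo,
    inter_eq_left.2]
  · rw [setLIntegral_const, Real.volume_Ioo, mul_comm (ENNReal.ofReal r), mul_assoc,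
      ← ENNReal.ofReal_mul hr.le]
    congr 2
    unfold arcLength; ring
  · have := halfWidth_nonneg v r₁ r
    exact Ioo_subset_Ioo (by linarith) (by linarith)

/-- Integration in polar coordinates around location 1. -/
lemma lintegral_plane_loc1 (v : ℝ) {f : ℝ → ℝ → ℝ → ℝ≥0∞}
    (hf : Measurable fun z : ℝ × ℝ × ℝ => f z.1 z.2.1 z.2.2) :
    ∫⁻ x : Plane, f (dist x (loc1 v))
        (InnerProductGeometry.angle (x - loc1 v) (!₂[1, 0] : Plane)) ‖x‖ =
      ∫⁻ r in Ioi (0 : ℝ), ∫⁻ θ in Ioo 0 Real.pi, ENNReal.ofReal (2 * r) *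
        f r θ (Real.sqrt (r ^ 2 + v ^ 2 - 2 * r * v * Real.cos θ)) := by
  have hang : Measurable fun u : Plane => InnerProductGeometry.angle u (!₂[1, 0] : Plane) := by
    unfold InnerProductGeometry.angle
    exact Real.continuous_arccos.measurable.comp (by fun_prop)
  have htr : ∫⁻ x : Plane, f (dist x (loc1 v))
        (InnerProductGeometry.angle (x - loc1 v) (!₂[1, 0] : Plane)) ‖x‖ =
      ∫⁻ u : Plane, f ‖u‖ (InnerProductGeometry.angle u (!₂[1, 0] : Plane)) ‖u + loc1 v‖ := by
    rw [← lintegral_add_right_eq_self _ (loc1 v)]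
    simp [dist_eq_norm]
  rw [htr, lintegral_plane]
  · refine setLIntegral_congr_fun measurableSet_Ioi fun r hr => ?_
    have hr : 0 < r := hr
    have h1 : ∀ θ ∈ Ioo (-Real.pi) Real.pi, ENNReal.ofReal r *
        f ‖(!₂[r * Real.cos θ, r * Real.sin θ] : Plane)‖
          (InnerProductGeometry.angle (!₂[r * Real.cos θ, r * Real.sin θ] : Plane) !₂[1, 0])
          ‖(!₂[r * Real.cos θ, r * Real.sin θ] : Plane) + loc1 v‖ =
        ENNReal.ofReal r * f r |θ| (Real.sqrt (r ^ 2 + v ^ 2 - 2 * r * v * Real.cos |θ|)) := by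
      intro θ hθ
      rw [norm_polar hr.le, angle_polar hr hθ, Real.cos_abs, ← norm_add_loc1_sq,
        Real.sqrt_sq (norm_nonneg _)]
    rw [setLIntegral_congr_fun measurableSet_Ioo h1]
    set g : ℝ → ℝ≥0∞ := fun θ => f r θ (Real.sqrt (r ^ 2 + v ^ 2 - 2 * r * v * Real.cos θ)) with hg
    have hgm : Measurable g := by
      refine hf.comp (measurable_const.prodMk (measurable_id.prodMk ?_))
      exact Real.continuous_sqrt.measurable.comp (by fun_prop)
    -- The angle with (1, 0) is |θ|, so the two half-planes contribute equally; this is the factor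
    -- 2.
    have hU : Ioo (-Real.pi) Real.pi = Ioo (-Real.pi) 0 ∪ Ico 0 Real.pi :=
      (Ioo_union_Ico_eq_Ioo (by linarith [Real.pi_pos]) Real.pi_pos.le).symm
    rw [hU, lintegral_union measurableSet_Ico]
    · have e1 : ∫⁻ θ in Ico 0 Real.pi, ENNReal.ofReal r * g |θ| =
          ∫⁻ θ in Ioo 0 Real.pi, ENNReal.ofReal r * g θ := by
        rw [← restrict_Ioo_eq_restrict_Ico]
        refine setLIntegral_congr_fun measurableSet_Ioo fun θ hθ => ?_
        rw [abs_of_pos hθ.1]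
      have e2 : ∫⁻ θ in Ioo (-Real.pi) 0, ENNReal.ofReal r * g |θ| =
          ∫⁻ θ in Ioo 0 Real.pi, ENNReal.ofReal r * g θ := by
        have hmp := (Measure.measurePreserving_neg (volume : Measure ℝ)).setLIntegral_comp_preimage
          (measurableSet_Ioo (a := (0 : ℝ)) (b := Real.pi)) (hgm.const_mul (ENNReal.ofReal r))
        rw [← hmp]
        have : Neg.neg ⁻¹' Ioo 0 Real.pi = Ioo (-Real.pi) 0 := by
          ext θ; simp only [mem_preimage, mem_Ioo]; constructor <;> rintro ⟨h1, h2⟩ <;>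
            constructor <;> linarith
        rw [this]
        refine setLIntegral_congr_fun measurableSet_Ioo fun θ hθ => ?_
        rw [abs_of_neg hθ.2]
      rw [e1, e2, ← two_mul, ← lintegral_const_mul _ (hgm.const_mul _)]
      refine lintegral_congr fun θ => ?_
      rw [ENNReal.ofReal_mul (by norm_num), ← mul_assoc]
      simp [hg]
    · refine Set.disjoint_left.2 fun θ h1 h2 => ?_
      exact absurd h1.2 (not_lt.2 h2.1)
  · refine hf.comp (Measurable.prodMk (by fun_prop) (hang.prodMk (by fun_prop)))

end Plane

end D2D

/-! ### Mecke's formula applied to the pair of servers -/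

namespace D2D

open Device

/-- The pairs of devices that can be the servers of locations 1 and 2. -/
def admissible (v : ℝ) : Set (Device × Device) :=
  {z | z.1.2.1 = false ∧ z.2.2.1 = true ∧ dist z.1.1 (loc1 v) < dist z.2.1 (loc1 v)}

lemma measurableSet_admissible (v : ℝ) : MeasurableSet (admissible v) := by
  refine (measurable_fst measurableSet_isB).inter ((measurable_snd measurableSet_isA).inter ?_)
  refine measurableSet_lt (f := fun z : Device × Device => dist z.1.1 (loc1 v))
    (g := fun z : Device × Device => dist z.2.1 (loc1 v)) ?_ ?_ <;> fun_prop

/-- Absence of points becomes an exponential with infinite rate, which a Laplace functional can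
absorb. -/
lemma expNeg_top_mul (x : ℝ≥0∞) : expNeg (∞ * x) = if x = 0 then 1 else 0 := by
  split_ifs with h
  · simp [h]
  · rw [ENNReal.top_mul h, expNeg_top]

/-- For an admissible pair, x is in `near1 v x` but not in `near2 y` because it caches B, and y is
in `near2 y` but not in `near1 v x` because it is farther from location 1. Each added atom thus
fills exactly one of the two sets, and mass 1 leaves nothing for ξ. -/
lemma isServerPair_add_dirac {v : ℝ} {x y : Device} {ξ : Measure Device} :
    IsServerPair v x y (ξ + Measure.dirac x + Measure.dirac y) ↔
      (x, y) ∈ admissible v ∧ ξ (near1 v x ∪ near2 y) = 0 := by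
  have key : x.2.1 = false → y.2.1 = true → dist x.1 (loc1 v) < dist y.1 (loc1 v) →
      ((ξ + Measure.dirac x + Measure.dirac y) (near1 v x) = 1 ↔ ξ (near1 v x) = 0) ∧
      ((ξ + Measure.dirac x + Measure.dirac y) (near2 y) = 1 ↔ ξ (near2 y) = 0) := by
    intro h1 h2 h3
    have e1 : x ∈ near1 v x := le_refl (dist x.1 (loc1 v))
    have e2 : y ∉ near1 v x := not_le.2 h3
    have e3 : x ∉ near2 y := fun h => by
      have := h.1
      rw [h1] at this; simp at this
    have e4 : y ∈ near2 y := ⟨h2, le_rfl⟩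
    simp only [Measure.coe_add, Pi.add_apply, Measure.dirac_apply' _ (measurableSet_near1_right _ _),
      Measure.dirac_apply' _ (measurableSet_near2_right _), indicator_of_mem e1,
      indicator_of_notMem e2, indicator_of_notMem e3, indicator_of_mem e4, Pi.one_apply, add_zero]
    have e5 : ∀ a : ℝ≥0∞, a + 1 = 1 ↔ a = 0 := fun a => by
      conv_lhs => rw [← zero_add (1 : ℝ≥0∞), ← add_assoc, add_zero]
      exact ENNReal.add_left_inj ENNReal.one_ne_top
    exact ⟨e5 _, e5 _⟩
  rw [measure_union_null_iff]
  constructor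
  · rintro ⟨h1, h2, h3, h4, h5⟩
    exact ⟨⟨h1, h2, h3⟩, ((key h1 h2 h3).1).1 h4, ((key h1 h2 h3).2).1 h5⟩
  · rintro ⟨⟨h1, h2, h3⟩, h4, h5⟩
    exact ⟨h1, h2, h3, ((key h1 h2 h3).1).2 h4, ((key h1 h2 h3).2).2 h5⟩

/-- Neither added atom interferes here: x is not strictly farther than itself, and y caches A. -/
lemma lintegral_interfB_add_dirac {α v : ℝ} {x y : Device} (h : (x, y) ∈ admissible v)
    (ξ : Measure Device) :
    ∫⁻ w, interfB α v x w ∂(ξ + Measure.dirac x + Measure.dirac y) = ∫⁻ w, interfB α v x w ∂ξ := by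
  have hy : y.2.1 = true := h.2.1
  have hm := measurable_interfB_right α v x
  rw [lintegral_add_measure, lintegral_add_measure, lintegral_dirac' _ hm, lintegral_dirac' _ hm]
  simp [interfB, hy]

lemma lintegral_interfA_add_dirac {α v : ℝ} {x y : Device} (h : (x, y) ∈ admissible v)
    (ξ : Measure Device) :
    ∫⁻ w, interfA α v x y w ∂(ξ + Measure.dirac x + Measure.dirac y) =
      ∫⁻ w, interfA α v x y w ∂ξ := by
  have hx : x.2.1 = false := h.1
  have hm := measurable_interfA_right α v x y
  rw [lintegral_add_measure, lintegral_add_measure, lintegral_dirac' _ hm, lintegral_dirac' _ hm]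
  simp [interfA, hx]

namespace Network

variable {Ω : Type*} [MeasurableSpace Ω] {μ : Measure Ω} {lam : ℝ} {p q : unitInterval}
  (N : Network μ lam p q)

lemma measurable_config_apply {f : Ω → Device} (hf : Measurable f) {S : Set (Device × Device)}
    (hS : MeasurableSet S) : Measurable fun ω => N.config ω {w | (f ω, w) ∈ S} := by
  have : ∀ ω, N.config ω {w | (f ω, w) ∈ S} = ∑' n, S.indicator 1 (f ω, N.dev n ω) := fun ω => by
    have hm : MeasurableSet {w | (f ω, w) ∈ S} := measurable_prodMk_left hS
    rw [config, pointMeasure_apply _ _ hm]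
    rfl
  simp_rw [this]
  exact Measurable.tsum fun n => (measurable_one.indicator hS).comp (hf.prodMk (N.measurable_dev n))

lemma measurableSet_pairEvent (v : ℝ) : MeasurableSet (N.pairEvent v) := by
  have h1 : MeasurableSet {ω | (N.dev1 v ω, N.dev2 v ω) ∈ admissible v} :=
    ((N.measurable_dev1 v).prodMk (N.measurable_dev2 v)) (measurableSet_admissible v)
  have h2 : MeasurableSet {ω | N.config ω (near1 v (N.dev1 v ω)) = 1} :=
    N.measurable_config_apply (N.measurable_dev1 v) (measurableSet_near1 v)
      (measurableSet_singleton 1)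
  have h3 : MeasurableSet {ω | N.config ω (near2 (N.dev2 v ω)) = 1} :=
    N.measurable_config_apply (N.measurable_dev2 v) measurableSet_near2 (measurableSet_singleton 1)
  convert! h1.inter (h2.inter h3) using 1
  ext ω
  simp only [pairEvent, IsServerPair, admissible, mem_inter_iff, mem_ofPred_eq]
  tauto

variable [IsProbabilityMeasure μ]

/-- The law of the servers and the interference, from Mecke's formula. -/
theorem lintegral_pairEvent (α v : ℝ) {K : Device → Device → ℝ≥0∞ → ℝ≥0∞ → ℝ≥0∞}
    (hK : Measurable fun z : Device × Device × ℝ≥0∞ × ℝ≥0∞ => K z.1 z.2.1 z.2.2.1 z.2.2.2) :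
    ∫⁻ ω in N.pairEvent v, K (N.dev1 v ω) (N.dev2 v ω) (N.I2 α v ω) (N.I3 α v ω) ∂μ =
      ∫⁻ x, ∫⁻ y, (admissible v).indicator (fun z => ∫⁻ ω,
        expNeg (∞ * N.config ω (near1 v z.1 ∪ near2 z.2)) *
          K z.1 z.2 (∫⁻ w, interfB α v z.1 w ∂(N.config ω))
            (∫⁻ w, interfA α v z.1 z.2 w ∂(N.config ω)) ∂μ) (x, y)
        ∂(deviceIntensity lam p q) ∂(deviceIntensity lam p q) := by
  classical
  set L := deviceIntensity lam p q
  let F : Device → Device → Measure Device → ℝ≥0∞ := fun x y ξ =>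
    {z : Device × Device | IsServerPair v z.1 z.2 ξ}.indicator (fun z => K z.1 z.2
      (∫⁻ w, interfB α v z.1 w ∂ξ) (∫⁻ w, interfA α v z.1 z.2 w ∂ξ)) (x, y)
  -- Composing with `locFin` makes the functional jointly measurable, as Mecke's formula requires,
  -- and changes it only on a null set.
  let G : Device → Device → Measure Device → ℝ≥0∞ := fun x y ξ => F x y (locFin L ξ)
  have hG : Measurable fun z : Device × Device × Measure Device => G z.1 z.2.1 z.2.2 := by
    have hsnd : Measurable fun z : Device × Device × Measure Device => z.2.2 := measurable_snd.snd
    have e1 : Measurable fun z : Device × Device × Measure Device =>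
        ∫⁻ w, interfB α v z.1 w ∂(locFin L z.2.2) :=
      measurable_lintegral_locFin L
        (G := fun (z : Device × Device × Measure Device) w => interfB α v z.1 w)
        ((measurable_interfB α v).comp (measurable_fst.fst.prodMk measurable_snd)) hsnd
    have e2 : Measurable fun z : Device × Device × Measure Device =>
        ∫⁻ w, interfA α v z.1 z.2.1 w ∂(locFin L z.2.2) :=
      measurable_lintegral_locFin L
        (G := fun (z : Device × Device × Measure Device) w => interfA α v z.1 z.2.1 w)
        ((measurable_interfA α v).comp
        ((measurable_fst.fst.prodMk measurable_fst.snd.fst).prodMk measurable_snd)) hsnd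
    have m1 : Measurable fun u : (Device × Device × Measure Device) × Device => (u.1.1, u.2) := by
      fun_prop
    have m2 : Measurable fun u : (Device × Device × Measure Device) × Device => (u.1.2.1, u.2) := by
      fun_prop
    have e3 : Measurable fun z : Device × Device × Measure Device =>
        locFin L z.2.2 (near1 v z.1) :=
      measurable_locFin_apply L (m1 (measurableSet_near1 v)) hsnd
    have e4 : Measurable fun z : Device × Device × Measure Device =>
        locFin L z.2.2 (near2 z.2.1) :=
      measurable_locFin_apply L (m2 measurableSet_near2) hsnd
    have e5 : MeasurableSet {z : Device × Device × Measure Device |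
        IsServerPair v z.1 z.2.1 (locFin L z.2.2)} := by
      have h1 : MeasurableSet {z : Device × Device × Measure Device |
          (z.1, z.2.1) ∈ admissible v} :=
        (measurable_fst.prodMk measurable_snd.fst) (measurableSet_admissible v)
      convert! h1.inter ((e3 (measurableSet_singleton 1)).inter (e4 (measurableSet_singleton 1)))
        using 1
      ext z
      simp only [IsServerPair, admissible, mem_inter_iff, mem_ofPred_eq, mem_preimage,
        mem_singleton_iff]
      tauto
    exact (hK.comp (measurable_fst.prodMk (measurable_snd.fst.prodMk (e1.prodMk e2)))).indicator e5
  have hdiag : ∀ x ξ, G x x ξ = 0 := by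
    intro x ξ
    simp only [G, F]
    rw [indicator_of_notMem]
    rintro ⟨h1, h2, -⟩
    rw [h1] at h2
    simp at h2
  have hX := N.hasPoissonLaplace
  have hmk := hX.mecke_pair hG hdiag
  have hleft : ∫⁻ ω, ∑' n, ∑' m, G (N.dev n ω) (N.dev m ω) (pointMeasure N.dev ω) ∂μ =
      ∫⁻ ω in N.pairEvent v, K (N.dev1 v ω) (N.dev2 v ω) (N.I2 α v ω) (N.I3 α v ω) ∂μ := by
    rw [← lintegral_indicator (N.measurableSet_pairEvent v)]
    refine lintegral_congr_ae ?_
    filter_upwards [hX.ae_locallyFinite] with ω hω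
    simp only [G, F]
    rw [locFin_apply L hω]
    refine (N.tsum_tsum_isServerPair v ω (fun x y => K x y (∫⁻ w, interfB α v x w ∂(N.config ω))
      (∫⁻ w, interfA α v x y w ∂(N.config ω)))).trans ?_
    simp only [indicator_apply, I2_eq, I3_eq]
  rw [← hleft, hmk]
  refine lintegral_congr fun x => lintegral_congr fun y => ?_
  have hright : ∀ᵐ ω ∂μ, G x y (pointMeasure N.dev ω + Measure.dirac x + Measure.dirac y) =
      (admissible v).indicator (fun z => expNeg (∞ * N.config ω (near1 v z.1 ∪ near2 z.2)) *
          K z.1 z.2 (∫⁻ w, interfB α v z.1 w ∂(N.config ω))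
            (∫⁻ w, interfA α v z.1 z.2 w ∂(N.config ω))) (x, y) := by
    filter_upwards [hX.ae_locallyFinite] with ω hω
    simp only [G, F]
    rw [locFin_apply L]
    · simp only [indicator_apply, mem_ofPred_eq, isServerPair_add_dirac, expNeg_top_mul]
      by_cases hadm : (x, y) ∈ admissible v
      · rw [lintegral_interfA_add_dirac hadm, lintegral_interfB_add_dirac hadm]
        simp only [hadm, true_and, if_true]
        rw [ite_mul, one_mul, zero_mul]
        rfl
      · simp [hadm]
    · intro j
      rw [Measure.add_apply, Measure.add_apply]
      exact ENNReal.add_lt_top.2 ⟨ENNReal.add_lt_top.2 ⟨hω j, measure_lt_top _ _⟩,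
        measure_lt_top _ _⟩
  rw [lintegral_congr_ae hright]
  by_cases hadm : (x, y) ∈ admissible v
  · simp only [indicator_of_mem hadm]
  · simp only [indicator_of_notMem hadm, lintegral_zero]

end Network

end D2D

/-! ### The Laplace functional with two servers fixed -/

namespace D2D

open Device

/-- The law of fading and activity. -/
noncomputable def linkLaw (q : unitInterval) : Measure (ℝ × Bool) :=
  (expMeasure 1).prod (bernoulliMeasure true false q)

instance (q : unitInterval) : IsProbabilityMeasure (linkLaw q) := by
  unfold linkLaw; infer_instance

lemma lintegral_deviceIntensity' (lam : ℝ) (p q : unitInterval) {f : Device → ℝ≥0∞}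
    (hf : Measurable f) : ∫⁻ x, f x ∂(deviceIntensity lam p q) =
      ENNReal.ofReal lam * ∫⁻ x : Plane,
        (ENNReal.ofReal p * ∫⁻ m, f (x, true, m) ∂(linkLaw q)
        + ENNReal.ofReal (1 - p) * ∫⁻ m, f (x, false, m) ∂(linkLaw q)) :=
  lintegral_deviceIntensity lam p q hf

/-- Laplace transform of the interference of a single device at distance `d`. -/
noncomputable def linkLap (q α s d : ℝ) : ℝ := 1 - q + q / (1 + s * d ^ (-α))

lemma linkLap_nonneg (q : unitInterval) {α s d : ℝ} (hs : 0 ≤ s) (hd : 0 ≤ d) :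
    0 ≤ linkLap q α s d := by
  have := q.2.1
  have := sub_nonneg.2 q.2.2
  unfold linkLap
  have : 0 ≤ d ^ (-α) := Real.rpow_nonneg hd _
  positivity

/-- An inactive device contributes 1, and an active one the transform of an exponential variable at
s‖x‖^{-α}. -/
lemma lintegral_linkLaw_interf (q : unitInterval) {α s : ℝ} (hs : 0 ≤ s) (x : Plane) (c : Bool) :
    ∫⁻ m, expNeg (ENNReal.ofReal s * interf α (x, c, m)) ∂(linkLaw q) =
      ENNReal.ofReal (linkLap q α s ‖x‖) := by
  have hd : 0 ≤ ‖x‖ ^ (-α) := Real.rpow_nonneg (norm_nonneg _) _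
  have hm : Measurable fun m => expNeg (ENNReal.ofReal s * interf α (x, c, m)) :=
    measurable_expNeg.comp (((measurable_interf α).comp
      (measurable_prodMk_left.comp measurable_prodMk_left)).const_mul _)
  rw [linkLaw, lintegral_prod _ hm.aemeasurable]
  simp_rw [lintegral_bernoulliMeasure]
  have h1 : ∀ h : ℝ, ENNReal.ofReal s * interf α (x, c, h, true) =
      ENNReal.ofReal (h * (s * ‖x‖ ^ (-α))) := by
    intro h
    simp only [interf, if_true]
    rw [← ENNReal.ofReal_mul hs]
    congr 1; ring
  have h2 : ∀ h : ℝ, interf α (x, c, h, false) = 0 := fun h => by simp [interf]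
  simp_rw [h1, h2, mul_zero, expNeg_zero, mul_one]
  have hm2 : Measurable fun h : ℝ => expNeg (ENNReal.ofReal (h * (s * ‖x‖ ^ (-α)))) := by fun_prop
  rw [lintegral_add_right _ measurable_const, lintegral_const_mul _ hm2,
    lintegral_expNeg_expMeasure (by positivity), lintegral_const, measure_univ, mul_one,
    ← ENNReal.ofReal_mul q.2.1, ← ENNReal.ofReal_add (mul_nonneg q.2.1 (by positivity))
      (sub_nonneg.2 q.2.2)]
  congr 1
  unfold linkLap; ring

lemma lintegral_linkLaw_one_sub (q : unitInterval) {α s : ℝ} (hs : 0 ≤ s) (x : Plane) (c : Bool) :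
    ∫⁻ m, (1 - expNeg (ENNReal.ofReal s * interf α (x, c, m))) ∂(linkLaw q) =
      ENNReal.ofReal (1 - linkLap q α s ‖x‖) := by
  have hm : Measurable fun m => expNeg (ENNReal.ofReal s * interf α (x, c, m)) :=
    measurable_expNeg.comp (((measurable_interf α).comp
      (measurable_prodMk_left.comp measurable_prodMk_left)).const_mul _)
  rw [lintegral_sub hm, lintegral_linkLaw_interf q hs, lintegral_one, measure_univ,
    ENNReal.ofReal_sub _ (linkLap_nonneg q hs (norm_nonneg x)), ENNReal.ofReal_one]
  · rw [lintegral_linkLaw_interf q hs]; exact ENNReal.ofReal_ne_top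
  · exact ae_of_all _ fun m => expNeg_le_one _

/-- Laplace transform of the interference from file B, given the distance `r₁`. -/
noncomputable def extLap2 (lam p q α v s r₁ : ℝ) : ℝ≥0∞ :=
  expNeg (ENNReal.ofReal (lam * (1 - p)) * ∫⁻ r in Ioi (0 : ℝ),
    ENNReal.ofReal (1 - linkLap q α s r) * ENNReal.ofReal (arcLength v r₁ r))

/-- Laplace transform of the interference from file A, given the distances `r₁` and `r₂`. -/
noncomputable def extLap3 (lam p q α v s r₁ r₂ : ℝ) : ℝ≥0∞ :=
  expNeg (ENNReal.ofReal (lam * p) * ∫⁻ r in Ioi r₂,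
    ENNReal.ofReal (1 - linkLap q α s r) * ENNReal.ofReal (arcLength v r₁ r))

/-- The probability that there is no device of file A outside the disk of radius `r₁` around
location 1 but in the disk of radius `r₂` around location 2. -/
noncomputable def extVoid (lam p v r₁ r₂ : ℝ) : ℝ≥0∞ :=
  expNeg (ENNReal.ofReal (lam * p) * ∫⁻ r in Ioc 0 r₂, ENNReal.ofReal (arcLength v r₁ r))

/-- The integrand is 1 on the forbidden devices and 1 minus a link transform on the others. Inside
the disk around location 1 it is 1 for both files, which gives the mass λπr₁². Outside, file B gives
`extLap2`; file A gives `extVoid` up to distance r₂ from the origin and `extLap3` beyond. These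
contributions add up in the exponent. -/
lemma lintegral_one_sub_expNeg {lam : ℝ} (hlam : 0 ≤ lam) (p q : unitInterval) (α : ℝ)
    {v : ℝ} (hv : 0 ≤ v) (x y : Device) {b c : ℝ} (hb : 0 ≤ b) (hc : 0 ≤ c) :
    expNeg (∫⁻ w, (1 - expNeg (∞ * (near1 v x ∪ near2 y).indicator 1 w +
      ENNReal.ofReal b * interfB α v x w + ENNReal.ofReal c * interfA α v x y w))
        ∂(deviceIntensity lam p q)) =
      expNeg (ENNReal.ofReal (lam * Real.pi * dist x.1 (loc1 v) ^ 2)) *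
        extLap2 lam p q α v b (dist x.1 (loc1 v)) *
        extVoid lam p v (dist x.1 (loc1 v)) ‖y.1‖ *
        extLap3 lam p q α v c (dist x.1 (loc1 v)) ‖y.1‖ := by
  classical
  set r₁ := dist x.1 (loc1 v) with hr₁
  set r₂ := ‖y.1‖ with hr₂
  have hp1 : 0 ≤ 1 - (p : ℝ) := sub_nonneg.2 p.2.2
  have hmeas : Measurable fun w : Device => 1 - expNeg (∞ * (near1 v x ∪ near2 y).indicator 1 w +
      ENNReal.ofReal b * interfB α v x w + ENNReal.ofReal c * interfA α v x y w) := by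
    refine measurable_const.sub (measurable_expNeg.comp ((Measurable.add ?_ ?_).add ?_))
    · exact (measurable_one.indicator ((measurableSet_near1_right v x).union
        (measurableSet_near2_right y))).const_mul _
    · exact (measurable_interfB_right α v x).const_mul _
    · exact (measurable_interfA_right α v x y).const_mul _
  rw [lintegral_deviceIntensity' lam p q hmeas]
  -- H is the average over the marks of the integrand outside the disk around location 1; it depends
  -- only on the distance from the origin.
  let H : ℝ → ℝ≥0∞ := fun r =>
    ENNReal.ofReal p * (if r ≤ r₂ then 1 else ENNReal.ofReal (1 - linkLap q α c r)) +
      ENNReal.ofReal (1 - p) * ENNReal.ofReal (1 - linkLap q α b r)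
  have hHm : Measurable H := by
    refine Measurable.add (Measurable.const_mul (Measurable.ite measurableSet_Iic measurable_const
      ?_) _) (Measurable.const_mul ?_ _)
    all_goals unfold linkLap; fun_prop
  have hS : MeasurableSet {w : Plane | r₁ < dist w (loc1 v)} :=
    measurableSet_lt measurable_const (by fun_prop)
  have hin : ∀ w : Plane, ¬ r₁ < dist w (loc1 v) → ∀ k m, 1 - expNeg (∞ *
      (near1 v x ∪ near2 y).indicator 1 ((w, k, m) : Device) + ENNReal.ofReal b *
      interfB α v x (w, k, m) + ENNReal.ofReal c * interfA α v x y (w, k, m)) = 1 := by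
    intro w hw k m
    have : ((w, k, m) : Device) ∈ near1 v x ∪ near2 y := Or.inl (not_lt.1 hw)
    rw [indicator_of_mem this]
    simp
  have hout : ∀ w : Plane, r₁ < dist w (loc1 v) → ∀ m, 1 - expNeg (∞ *
      (near1 v x ∪ near2 y).indicator 1 ((w, false, m) : Device) + ENNReal.ofReal b *
      interfB α v x (w, false, m) + ENNReal.ofReal c * interfA α v x y (w, false, m)) =
      1 - expNeg (ENNReal.ofReal b * interf α (w, false, m)) := by
    intro w hw m
    have : ((w, false, m) : Device) ∉ near1 v x ∪ near2 y := by
      rintro (h | h)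
      · exact absurd hw (not_lt.2 h)
      · exact absurd h.1 (by simp)
    have h2 : dist x.1 (loc1 v) < dist w (loc1 v) := hw
    rw [indicator_of_notMem this]
    simp [interfB, interfA, h2]
  have houtA : ∀ w : Plane, r₁ < dist w (loc1 v) → ∀ m, 1 - expNeg (∞ *
      (near1 v x ∪ near2 y).indicator 1 ((w, true, m) : Device) + ENNReal.ofReal b *
      interfB α v x (w, true, m) + ENNReal.ofReal c * interfA α v x y (w, true, m)) =
      if ‖w‖ ≤ r₂ then 1 else 1 - expNeg (ENNReal.ofReal c * interf α (w, true, m)) := by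
    intro w hw m
    have h2 : dist x.1 (loc1 v) < dist w (loc1 v) := hw
    split_ifs with h
    · have : ((w, true, m) : Device) ∈ near1 v x ∪ near2 y := Or.inr ⟨rfl, h⟩
      rw [indicator_of_mem this]
      simp
    · have : ((w, true, m) : Device) ∉ near1 v x ∪ near2 y := by
        rintro (h' | h')
        · exact absurd hw (not_lt.2 h')
        · exact h h'.2
      have h3 : ‖y.1‖ < ‖w‖ := not_le.1 h
      rw [indicator_of_notMem this]
      simp [interfB, interfA, h2, h3]
  have hpq : ENNReal.ofReal p + ENNReal.ofReal (1 - p) = 1 := by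
    rw [← ENNReal.ofReal_add p.2.1 hp1]; simp
  have hplane : ∀ w : Plane, ENNReal.ofReal p * ∫⁻ m, (1 - expNeg (∞ *
      (near1 v x ∪ near2 y).indicator 1 ((w, true, m) : Device) + ENNReal.ofReal b *
      interfB α v x (w, true, m) + ENNReal.ofReal c * interfA α v x y (w, true, m))) ∂(linkLaw q)
      + ENNReal.ofReal (1 - p) * ∫⁻ m, (1 - expNeg (∞ *
      (near1 v x ∪ near2 y).indicator 1 ((w, false, m) : Device) + ENNReal.ofReal b *
      interfB α v x (w, false, m) + ENNReal.ofReal c * interfA α v x y (w, false, m))) ∂(linkLaw q)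
      = (Metric.closedBall (loc1 v) r₁).indicator 1 w +
        {w : Plane | r₁ < dist w (loc1 v)}.indicator (fun w => H ‖w‖) w := by
    intro w
    by_cases hw : r₁ < dist w (loc1 v)
    · have hw' : w ∉ Metric.closedBall (loc1 v) r₁ := not_le.2 hw
      simp only [hout w hw, houtA w hw]
      rw [indicator_of_notMem hw', indicator_of_mem (by exact hw), zero_add]
      simp only [H]
      split_ifs with h
      · simp [lintegral_linkLaw_one_sub q hb]
      · simp [lintegral_linkLaw_one_sub q hb, lintegral_linkLaw_one_sub q hc]
    · have hw' : w ∈ Metric.closedBall (loc1 v) r₁ := not_lt.1 hw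
      simp only [hin w hw]
      rw [indicator_of_mem hw', indicator_of_notMem (s := {w : Plane | r₁ < dist w (loc1 v)}) hw]
      simpa using hpq
  simp_rw [hplane]
  rw [lintegral_add_left (measurable_one.indicator measurableSet_closedBall),
    lintegral_indicator_one measurableSet_closedBall, lintegral_indicator hS,
    lintegral_compl_disk hv dist_nonneg hHm, EuclideanSpace.volume_closedBall_fin_two]
  have harcm : Measurable fun r => ENNReal.ofReal (arcLength v r₁ r) :=
    ((measurable_arcLength v).comp measurable_prodMk_left).ennreal_ofReal
  have hlm : ∀ s, Measurable fun r => ENNReal.ofReal (1 - linkLap q α s r) := fun s => by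
    unfold linkLap; fun_prop
  have hsplit : ∫⁻ r in Ioi (0 : ℝ), H r * ENNReal.ofReal (arcLength v r₁ r) =
      ENNReal.ofReal p * (∫⁻ r in Ioc 0 r₂, ENNReal.ofReal (arcLength v r₁ r)) +
      ENNReal.ofReal p * (∫⁻ r in Ioi r₂, ENNReal.ofReal (1 - linkLap q α c r) *
        ENNReal.ofReal (arcLength v r₁ r)) +
      ENNReal.ofReal (1 - p) * ∫⁻ r in Ioi (0 : ℝ), ENNReal.ofReal (1 - linkLap q α b r) *
        ENNReal.ofReal (arcLength v r₁ r) := by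
    simp only [H, add_mul, mul_assoc]
    have hite : Measurable fun r => (if r ≤ r₂ then 1 else ENNReal.ofReal (1 - linkLap q α c r)) *
        ENNReal.ofReal (arcLength v r₁ r) :=
      (Measurable.ite measurableSet_Iic measurable_const (hlm c)).mul harcm
    have hbm : Measurable fun r => ENNReal.ofReal (1 - linkLap q α b r) *
        ENNReal.ofReal (arcLength v r₁ r) := (hlm b).mul harcm
    rw [lintegral_add_left (hite.const_mul _), lintegral_const_mul _ hite,
      lintegral_const_mul _ hbm, ← Ioc_union_Ioi_eq_Ioi (norm_nonneg y.1),
      lintegral_union measurableSet_Ioi (Ioc_disjoint_Ioi le_rfl), mul_add]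
    congr 3
    · refine setLIntegral_congr_fun measurableSet_Ioc fun r hr => ?_
      rw [if_pos hr.2, one_mul]
    · refine setLIntegral_congr_fun measurableSet_Ioi fun r hr => ?_
      rw [if_neg (not_le.2 hr)]
  rw [hsplit, mul_add, mul_add, mul_add, expNeg_add, expNeg_add, expNeg_add]
  unfold extLap2 extLap3 extVoid
  simp only [← mul_assoc]
  rw [← ENNReal.ofReal_mul hlam, ← ENNReal.ofReal_mul hlam]
  have e1 : ENNReal.ofReal lam * ENNReal.ofReal r₁ ^ 2 * ENNReal.ofReal Real.pi =
      ENNReal.ofReal (lam * Real.pi * r₁ ^ 2) := by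
    rw [← ENNReal.ofReal_pow dist_nonneg, ← ENNReal.ofReal_mul hlam,
      ← ENNReal.ofReal_mul (by positivity)]
    congr 1; ring
  rw [e1]
  ring

end D2D

/-! ### Integration over the two servers -/

namespace D2D

open Device

/-- The angle at location 1 between the direction of `x` and the direction of location 2. -/
noncomputable def angle1 (v : ℝ) (x : Plane) : ℝ :=
  InnerProductGeometry.angle (x - loc1 v) (!₂[1, 0] : Plane)

lemma measurable_angle1 (v : ℝ) : Measurable (angle1 v) := by
  unfold angle1 InnerProductGeometry.angle
  exact Real.continuous_arccos.measurable.comp (by fun_prop)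

/-- The distance of the server of location 1 from the origin. -/
noncomputable def dist2 (v r₁ θ : ℝ) : ℝ := Real.sqrt (r₁ ^ 2 + v ^ 2 - 2 * r₁ * v * Real.cos θ)

lemma dist2_nonneg (v r₁ θ : ℝ) : 0 ≤ dist2 v r₁ θ := Real.sqrt_nonneg _

lemma measurable_dist2 (v : ℝ) : Measurable fun z : ℝ × ℝ => dist2 v z.1 z.2 := by
  unfold dist2
  exact Real.continuous_sqrt.measurable.comp (by fun_prop)

lemma measurable_linkLap (q α : ℝ) : Measurable fun z : ℝ × ℝ => linkLap q α z.1 z.2 := by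
  unfold linkLap; fun_prop

/-- The parameters `(R₁, R₂, Θ)` of a pair of locations. -/
noncomputable def params (v : ℝ) (x y : Device) : ℝ × ℝ × ℝ :=
  (dist x.1 (loc1 v), ‖y.1‖, angle1 v x.1)

lemma params_fst (v : ℝ) (x y : Device) : (params v x y).1 = dist x.1 (loc1 v) := rfl

lemma params_snd_fst (v : ℝ) (x y : Device) : (params v x y).2.1 = ‖y.1‖ := rfl

lemma measurable_params (v : ℝ) : Measurable fun z : Device × Device => params v z.1 z.2 := by
  unfold params
  exact Measurable.prodMk (by fun_prop) (Measurable.prodMk (by fun_prop)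
    ((measurable_angle1 v).comp measurable_fst.fst))

/-- The second server must cache A and lie outside the disk of x, and the integrand sees it only
through its distance from the origin; its direction integrates to `arcLength`. -/
lemma lintegral_admissible_inner (lam : ℝ) (p q : unitInterval) {v : ℝ} (hv : 0 ≤ v)
    {k : ℝ × ℝ × ℝ → ℝ≥0∞} (hk : Measurable k) {a : ℝ × ℝ × ℝ → ℝ} (ha : Measurable a) (α : ℝ)
    (x : Device) :
    ∫⁻ y, (admissible v).indicator (fun z => k (params v z.1 z.2) *
        expNeg (ENNReal.ofReal (a (params v z.1 z.2)) * interf α z.1)) (x, y)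
        ∂(deviceIntensity lam p q) =
      if x.2.1 = false then ENNReal.ofReal lam * (ENNReal.ofReal p * ∫⁻ r in Ioi (0 : ℝ),
        k (dist x.1 (loc1 v), r, angle1 v x.1) *
        expNeg (ENNReal.ofReal (a (dist x.1 (loc1 v), r, angle1 v x.1)) * interf α x) *
        ENNReal.ofReal (arcLength v (dist x.1 (loc1 v)) r)) else 0 := by
  classical
  have hm : Measurable fun z : Device × Device => (admissible v).indicator
      (fun z => k (params v z.1 z.2) *
        expNeg (ENNReal.ofReal (a (params v z.1 z.2)) * interf α z.1)) z := by
    refine Measurable.indicator ?_ (measurableSet_admissible v)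
    exact (hk.comp (measurable_params v)).mul (measurable_expNeg.comp
      ((ha.comp (measurable_params v)).ennreal_ofReal.mul
        ((measurable_interf α).comp measurable_fst)))
  have hmx : Measurable fun y => (admissible v).indicator (fun z => k (params v z.1 z.2) *
        expNeg (ENNReal.ofReal (a (params v z.1 z.2)) * interf α z.1)) (x, y) :=
    hm.comp measurable_prodMk_left
  split_ifs with hx
  · rw [lintegral_deviceIntensity' lam p q hmx]
    congr 1
    set r₁ := dist x.1 (loc1 v)
    set θ := angle1 v x.1
    let F : ℝ → ℝ≥0∞ := fun r => k (r₁, r, θ) * expNeg (ENNReal.ofReal (a (r₁, r, θ)) * interf α x)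
    have hFm : Measurable F := by
      have h1 : Measurable fun r : ℝ => (r₁, r, θ) := by fun_prop
      exact (hk.comp h1).mul (measurable_expNeg.comp ((ha.comp h1).ennreal_ofReal.mul_const _))
    have hS : MeasurableSet {w : Plane | r₁ < dist w (loc1 v)} :=
      measurableSet_lt measurable_const (by fun_prop)
    have h1 := lintegral_compl_disk hv (dist_nonneg (x := x.1) (y := loc1 v)) hFm
    simp only [F] at h1
    have hFn : Measurable fun w : Plane => F ‖w‖ := hFm.comp measurable_norm
    rw [← h1, ← lintegral_indicator hS, ← lintegral_const_mul _ (hFn.indicator hS)]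
    refine lintegral_congr fun w => ?_
    have e1 : ∀ m, (admissible v).indicator (fun z => k (params v z.1 z.2) *
        expNeg (ENNReal.ofReal (a (params v z.1 z.2)) * interf α z.1)) (x, w, false, m) = 0 := by
      intro m
      rw [indicator_of_notMem]
      exact fun h => absurd h.2.1 (by simp)
    have e2 : ∀ m, (admissible v).indicator (fun z => k (params v z.1 z.2) *
        expNeg (ENNReal.ofReal (a (params v z.1 z.2)) * interf α z.1)) (x, w, true, m) =
        {w : Plane | r₁ < dist w (loc1 v)}.indicator (fun w => F ‖w‖) w := by
      intro m
      by_cases hw : r₁ < dist w (loc1 v)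
      · have : (x, w, true, m) ∈ admissible v := ⟨hx, rfl, hw⟩
        rw [indicator_of_mem this, indicator_of_mem (by exact hw)]
        rfl
      · rw [indicator_of_notMem (fun h => hw h.2.2),
          indicator_of_notMem (s := {w : Plane | r₁ < dist w (loc1 v)}) hw]
    simp only [e1, e2]
    simp
  · have : ∀ y, (admissible v).indicator (fun z => k (params v z.1 z.2) *
        expNeg (ENNReal.ofReal (a (params v z.1 z.2)) * interf α z.1)) (x, y) = 0 := by
      intro y
      rw [indicator_of_notMem]
      exact fun h => hx h.1
    simp [this]

lemma lintegral_const_mul_swap {A : Type*} [MeasurableSpace A] (ν : Measure A) [SFinite ν]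
    (ρ : Measure ℝ) [SFinite ρ] (b c d : ℝ≥0∞) {F : A → ℝ → ℝ≥0∞}
    (hF : Measurable fun u : A × ℝ => F u.1 u.2) :
    d * ∫⁻ m, b * (c * ∫⁻ r, F m r ∂ρ) ∂ν = d * (b * (c * ∫⁻ r, ∫⁻ m, F m r ∂ν ∂ρ)) := by
  have h1 : Measurable fun m => ∫⁻ r, F m r ∂ρ := Measurable.lintegral_prod_right' hF
  rw [lintegral_const_mul _ (h1.const_mul _), lintegral_const_mul _ h1,
    lintegral_lintegral_swap hF.aemeasurable]

/-- Fading and activity of the first server occur only in its own interference, so averaging over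
them produces `linkLap`. -/
lemma lintegral_linkLaw_radial (q : unitInterval) (α : ℝ) (x : Plane) (b c d : ℝ≥0∞)
    {k w : ℝ → ℝ≥0∞} {a : ℝ → ℝ} (hk : Measurable k) (hw : Measurable w) (ha : Measurable a)
    (ha0 : ∀ r, 0 ≤ a r) :
    d * ∫⁻ m, b * (c * ∫⁻ r in Ioi (0 : ℝ),
        k r * expNeg (ENNReal.ofReal (a r) * interf α (x, false, m)) * w r) ∂(linkLaw q) =
      d * (b * (c * ∫⁻ r in Ioi (0 : ℝ),
        k r * ENNReal.ofReal (linkLap q α (a r) ‖x‖) * w r)) := by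
  have mi : Measurable fun m : ℝ × Bool => interf α ((x, false, m) : Device) := by
    have : Measurable fun m : ℝ × Bool => ((x, false, m) : Device) :=
      measurable_prodMk_left.comp measurable_prodMk_left
    exact (measurable_interf α).comp this
  have mu : Measurable fun u : (ℝ × Bool) × ℝ =>
      k u.2 * expNeg (ENNReal.ofReal (a u.2) * interf α (x, false, u.1)) * w u.2 := by
    have h1 : Measurable fun u : (ℝ × Bool) × ℝ => interf α ((x, false, u.1) : Device) :=
      mi.comp measurable_fst
    have h2 : Measurable fun u : (ℝ × Bool) × ℝ => ENNReal.ofReal (a u.2) :=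
      (ha.comp measurable_snd).ennreal_ofReal
    have h3 : Measurable fun u : (ℝ × Bool) × ℝ => k u.2 := hk.comp measurable_snd
    have h4 : Measurable fun u : (ℝ × Bool) × ℝ => w u.2 := hw.comp measurable_snd
    exact (h3.mul (measurable_expNeg.comp (h2.mul h1))).mul h4
  refine (lintegral_const_mul_swap (linkLaw q) (volume.restrict (Ioi (0 : ℝ))) b c d
    (F := fun m r => k r * expNeg (ENNReal.ofReal (a r) * interf α (x, false, m)) * w r)
    mu).trans ?_
  congr 3
  refine lintegral_congr fun r => ?_
  rw [← lintegral_linkLaw_interf q (ha0 _) x false]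
  have mm : Measurable fun m => expNeg (ENNReal.ofReal (a r) * interf α (x, false, m)) :=
    measurable_expNeg.comp (mi.const_mul _)
  rw [lintegral_mul_const _ (mm.const_mul _), lintegral_const_mul _ mm]

/-- The factor `k` sees the pair only through (r₁, r₂, θ). With x in polar coordinates around
location 1, folding the angle to (0, π) turns λ dx into 2λr₁ dr₁ dθ. -/
lemma lintegral_admissible {lam : ℝ} (hlam : 0 ≤ lam) (p q : unitInterval) {v : ℝ} (hv : 0 ≤ v)
    {k : ℝ × ℝ × ℝ → ℝ≥0∞} (hk : Measurable k) {a : ℝ × ℝ × ℝ → ℝ} (ha : Measurable a)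
    (ha0 : ∀ z, 0 ≤ a z) (α : ℝ) :
    ∫⁻ x, ∫⁻ y, (admissible v).indicator (fun z => k (params v z.1 z.2) *
        expNeg (ENNReal.ofReal (a (params v z.1 z.2)) * interf α z.1)) (x, y)
        ∂(deviceIntensity lam p q) ∂(deviceIntensity lam p q) =
      ENNReal.ofReal (1 - p) * ∫⁻ r₁ in Ioi (0 : ℝ), ∫⁻ r₂ in Ioi (0 : ℝ),
        ∫⁻ θ in Ioo 0 Real.pi, ENNReal.ofReal (2 * lam * r₁) * (k (r₁, r₂, θ) *
          ENNReal.ofReal (linkLap q α (a (r₁, r₂, θ)) (dist2 v r₁ θ)) *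
          ENNReal.ofReal (p * lam * arcLength v r₁ r₂)) := by
  classical
  simp_rw [lintegral_admissible_inner lam p q hv hk ha α]
  have harc2 : Measurable fun z : ℝ × ℝ => ENNReal.ofReal (arcLength v z.1 z.2) :=
    (measurable_arcLength v).ennreal_ofReal
  have mI : Measurable fun u : Device × ℝ => k (dist u.1.1 (loc1 v), u.2, angle1 v u.1.1) *
        expNeg (ENNReal.ofReal (a (dist u.1.1 (loc1 v), u.2, angle1 v u.1.1)) * interf α u.1) *
        ENNReal.ofReal (arcLength v (dist u.1.1 (loc1 v)) u.2) := by
    have h1 : Measurable fun u : Device × ℝ => (dist u.1.1 (loc1 v), u.2, angle1 v u.1.1) :=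
      Measurable.prodMk (by fun_prop) (measurable_snd.prodMk
        ((measurable_angle1 v).comp measurable_fst.fst))
    have h2 : Measurable fun u : Device × ℝ => (dist u.1.1 (loc1 v), u.2) := by fun_prop
    exact ((hk.comp h1).mul (measurable_expNeg.comp ((ha.comp h1).ennreal_ofReal.mul
        ((measurable_interf α).comp measurable_fst)))).mul (harc2.comp h2)
  have mJ : Measurable fun x : Device => if x.2.1 = false then ENNReal.ofReal lam *
      (ENNReal.ofReal p * ∫⁻ r in Ioi (0 : ℝ),
        k (dist x.1 (loc1 v), r, angle1 v x.1) *
        expNeg (ENNReal.ofReal (a (dist x.1 (loc1 v), r, angle1 v x.1)) * interf α x) *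
        ENNReal.ofReal (arcLength v (dist x.1 (loc1 v)) r)) else 0 := by
    refine Measurable.ite measurableSet_isB ?_ measurable_const
    exact (Measurable.lintegral_prod_right' mI).const_mul _ |>.const_mul _
  rw [lintegral_deviceIntensity' lam p q mJ]
  simp only [Bool.true_eq_false, if_false, if_true, lintegral_zero, mul_zero, zero_add]
  let f : ℝ → ℝ → ℝ → ℝ≥0∞ := fun r₁ θ d => ENNReal.ofReal (1 - p) *
    (ENNReal.ofReal lam * (ENNReal.ofReal p * ∫⁻ r in Ioi (0 : ℝ), k (r₁, r, θ) *
      ENNReal.ofReal (linkLap q α (a (r₁, r, θ)) d) * ENNReal.ofReal (arcLength v r₁ r)))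
  have mK : Measurable fun u : (ℝ × ℝ × ℝ) × ℝ => k (u.1.1, u.2, u.1.2.1) *
      ENNReal.ofReal (linkLap q α (a (u.1.1, u.2, u.1.2.1)) u.1.2.2) *
      ENNReal.ofReal (arcLength v u.1.1 u.2) := by
    have h1 : Measurable fun u : (ℝ × ℝ × ℝ) × ℝ => (u.1.1, u.2, u.1.2.1) := by fun_prop
    have h2 : Measurable fun u : (ℝ × ℝ × ℝ) × ℝ => (u.1.1, u.2) := by fun_prop
    exact ((hk.comp h1).mul ((measurable_linkLap q α).comp
      ((ha.comp h1).prodMk measurable_fst.snd.snd)).ennreal_ofReal).mul (harc2.comp h2)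
  have hf : Measurable fun z : ℝ × ℝ × ℝ => f z.1 z.2.1 z.2.2 :=
    (((Measurable.lintegral_prod_right' mK).const_mul _).const_mul _).const_mul _
  have h1 : ∀ x : Plane, ENNReal.ofReal (1 - p) * ∫⁻ m, ENNReal.ofReal lam *
      (ENNReal.ofReal p * ∫⁻ r in Ioi (0 : ℝ),
        k (dist x (loc1 v), r, angle1 v x) *
        expNeg (ENNReal.ofReal (a (dist x (loc1 v), r, angle1 v x)) * interf α (x, false, m)) *
        ENNReal.ofReal (arcLength v (dist x (loc1 v)) r)) ∂(linkLaw q) =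
      f (dist x (loc1 v)) (angle1 v x) ‖x‖ := by
    intro x
    have h1 : Measurable fun r : ℝ => (dist x (loc1 v), r, angle1 v x) := by fun_prop
    have h2 : Measurable fun r : ℝ => (dist x (loc1 v), r) := by fun_prop
    exact lintegral_linkLaw_radial q α x _ _ _ (hk.comp h1) (harc2.comp h2) (ha.comp h1)
      fun _ => ha0 _
  simp_rw [h1]
  have h2 := lintegral_plane_loc1 v hf
  unfold angle1
  rw [h2, ← lintegral_const_mul _]
  swap
  · have h3 : Measurable fun z : ℝ × ℝ => f z.1 z.2 (dist2 v z.1 z.2) :=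
      hf.comp (measurable_fst.prodMk (measurable_snd.prodMk (measurable_dist2 v)))
    have h4 : Measurable fun z : ℝ × ℝ => ENNReal.ofReal (2 * z.1) * f z.1 z.2 (dist2 v z.1 z.2) :=
      Measurable.mul (by fun_prop) h3
    exact Measurable.lintegral_prod_right' h4
  have mall : Measurable fun u : (ℝ × ℝ) × ℝ => ENNReal.ofReal (2 * lam * u.1.1) *
      (k (u.1.1, u.1.2, u.2) * ENNReal.ofReal (linkLap q α (a (u.1.1, u.1.2, u.2))
        (dist2 v u.1.1 u.2)) * ENNReal.ofReal (p * lam * arcLength v u.1.1 u.1.2)) := by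
    have h5 : Measurable fun u : (ℝ × ℝ) × ℝ => (u.1.1, u.1.2, u.2) := by fun_prop
    have h6 : Measurable fun u : (ℝ × ℝ) × ℝ => (u.1.1, u.2) := by fun_prop
    refine Measurable.mul (by fun_prop) (((hk.comp h5).mul ((measurable_linkLap q α).comp
      ((ha.comp h5).prodMk ((measurable_dist2 v).comp h6))).ennreal_ofReal).mul ?_)
    exact (((measurable_arcLength v).comp measurable_fst).const_mul _).ennreal_ofReal
  rw [← lintegral_const_mul _]
  swap
  · exact Measurable.lintegral_prod_right' (f := fun z : ℝ × ℝ => ∫⁻ θ in Ioo 0 Real.pi,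
      ENNReal.ofReal (2 * lam * z.1) *
      (k (z.1, z.2, θ) * ENNReal.ofReal (linkLap q α (a (z.1, z.2, θ))
        (dist2 v z.1 θ)) * ENNReal.ofReal (p * lam * arcLength v z.1 z.2)))
      (Measurable.lintegral_prod_right' mall)
  refine setLIntegral_congr_fun measurableSet_Ioi fun r₁ hr₁ => ?_
  have hr₁ : 0 < r₁ := hr₁
  have mswap : Measurable fun u : ℝ × ℝ => ENNReal.ofReal (2 * lam * r₁) *
      (k (r₁, u.1, u.2) * ENNReal.ofReal (linkLap q α (a (r₁, u.1, u.2))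
        (dist2 v r₁ u.2)) * ENNReal.ofReal (p * lam * arcLength v r₁ u.1)) := by
    have : Measurable fun u : ℝ × ℝ => ((r₁, u.1), u.2) := by fun_prop
    exact mall.comp this
  rw [lintegral_lintegral_swap mswap.aemeasurable]
  rw [← lintegral_const_mul' _ _ ENNReal.ofReal_ne_top, ← lintegral_const_mul' _ _ ENNReal.ofReal_ne_top]
  refine lintegral_congr fun θ => ?_
  simp only [f]
  change _ * (_ * (_ * (_ * (_ * ∫⁻ r in Ioi (0 : ℝ), k (r₁, r, θ) *
      ENNReal.ofReal (linkLap q α (a (r₁, r, θ)) (dist2 v r₁ θ)) *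
      ENNReal.ofReal (arcLength v r₁ r))))) = _
  rw [← lintegral_const_mul' _ _ ENNReal.ofReal_ne_top, ← lintegral_const_mul' _ _ ENNReal.ofReal_ne_top,
    ← lintegral_const_mul' _ _ ENNReal.ofReal_ne_top, ← lintegral_const_mul' _ _ ENNReal.ofReal_ne_top,
    ← lintegral_const_mul' _ _ ENNReal.ofReal_ne_top, ← lintegral_const_mul' _ _ ENNReal.ofReal_ne_top]
  refine setLIntegral_congr_fun measurableSet_Ioi fun r hr => ?_
  have hr : 0 < r := hr
  have e1 : ENNReal.ofReal (2 * lam * r₁) = ENNReal.ofReal lam * ENNReal.ofReal (2 * r₁) := by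
    rw [← ENNReal.ofReal_mul hlam]; congr 1; ring
  have e2 : ENNReal.ofReal (p * lam * arcLength v r₁ r) = ENNReal.ofReal p * ENNReal.ofReal lam *
      ENNReal.ofReal (arcLength v r₁ r) := by
    rw [← ENNReal.ofReal_mul p.2.1, ← ENNReal.ofReal_mul (mul_nonneg p.2.1 hlam)]
  rw [e1, e2]
  ring

namespace Network

variable {Ω : Type*} [MeasurableSpace Ω] {μ : Measure Ω} {lam : ℝ}
  {p q : unitInterval} (N : Network μ lam p q)

lemma params_dev (v : ℝ) (ω : Ω) :
    params v (N.dev1 v ω) (N.dev2 v ω) = (N.R1 v ω, N.R2 v ω, N.Theta v ω) := rfl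

end Network

/-- The joint density of `(R₁, R₂, Θ)` on the event that the servers are unique, up to `1 - p`. -/
noncomputable def extDensity (lam p v r₁ r₂ : ℝ) : ℝ≥0∞ :=
  ENNReal.ofReal (2 * lam * r₁) * expNeg (ENNReal.ofReal (lam * Real.pi * r₁ ^ 2)) *
    (ENNReal.ofReal (p * lam * arcLength v r₁ r₂) * extVoid lam p v r₁ r₂)

lemma measurable_extLap2 (lam p q α v : ℝ) :
    Measurable fun z : ℝ × ℝ => extLap2 lam p q α v z.1 z.2 := by
  unfold extLap2
  refine measurable_expNeg.comp (Measurable.const_mul ?_ _)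
  refine Measurable.lintegral_prod_right' (f := fun u : (ℝ × ℝ) × ℝ =>
    ENNReal.ofReal (1 - linkLap q α u.1.1 u.2) * ENNReal.ofReal (arcLength v u.1.2 u.2)) ?_
  have h1 : Measurable fun u : (ℝ × ℝ) × ℝ => (u.1.1, u.2) := by fun_prop
  have h2 : Measurable fun u : (ℝ × ℝ) × ℝ => (u.1.2, u.2) := by fun_prop
  exact (((measurable_linkLap q α).comp h1).const_sub 1).ennreal_ofReal.mul
    ((measurable_arcLength v).comp h2).ennreal_ofReal

lemma measurable_extLap3 (lam p q α v : ℝ) :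
    Measurable fun z : ℝ × ℝ × ℝ => extLap3 lam p q α v z.1 z.2.1 z.2.2 := by
  unfold extLap3
  refine measurable_expNeg.comp (Measurable.const_mul ?_ _)
  have hm : Measurable fun u : (ℝ × ℝ × ℝ) × ℝ => {u : (ℝ × ℝ × ℝ) × ℝ | u.1.2.2 < u.2}.indicator
      (fun u => ENNReal.ofReal (1 - linkLap q α u.1.1 u.2) *
        ENNReal.ofReal (arcLength v u.1.2.1 u.2)) u := by
    have h1 : Measurable fun u : (ℝ × ℝ × ℝ) × ℝ => (u.1.1, u.2) := by fun_prop
    have h2 : Measurable fun u : (ℝ × ℝ × ℝ) × ℝ => (u.1.2.1, u.2) := by fun_prop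
    refine Measurable.indicator ?_ (measurableSet_lt (by fun_prop) (by fun_prop))
    exact (((measurable_linkLap q α).comp h1).const_sub 1).ennreal_ofReal.mul
      ((measurable_arcLength v).comp h2).ennreal_ofReal
  have h := Measurable.lintegral_prod_right' (ν := (volume : Measure ℝ)) hm
  convert! h using 2 with z
  rw [← lintegral_indicator measurableSet_Ioi]
  rfl

lemma measurable_extVoid (lam p v : ℝ) :
    Measurable fun z : ℝ × ℝ => extVoid lam p v z.1 z.2 := by
  unfold extVoid
  refine measurable_expNeg.comp (Measurable.const_mul ?_ _)
  have hm : Measurable fun u : (ℝ × ℝ) × ℝ => {u : (ℝ × ℝ) × ℝ | 0 < u.2 ∧ u.2 ≤ u.1.2}.indicator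
      (fun u => ENNReal.ofReal (arcLength v u.1.1 u.2)) u := by
    have h2 : Measurable fun u : (ℝ × ℝ) × ℝ => (u.1.1, u.2) := by fun_prop
    have h3 : MeasurableSet {u : (ℝ × ℝ) × ℝ | 0 < u.2} := measurableSet_lt (by fun_prop) (by fun_prop)
    have h4 : MeasurableSet {u : (ℝ × ℝ) × ℝ | u.2 ≤ u.1.2} :=
      measurableSet_le (by fun_prop) (by fun_prop)
    refine Measurable.indicator ?_ (h3.inter h4)
    exact ((measurable_arcLength v).comp h2).ennreal_ofReal
  have h := Measurable.lintegral_prod_right' (ν := (volume : Measure ℝ)) hm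
  convert! h using 2 with z
  rw [← lintegral_indicator measurableSet_Ioc]
  rfl

end D2D

/-! ### Joint Laplace transform and coverage event -/

namespace D2D

open Device

attribute [local irreducible] Device.interf Device.interfA Device.interfB expNeg params extLap2
  extLap3 extVoid linkLap arcLength dist2

/-- After exchanging the integrals, V is a constant while the fading is averaged, and the
exponential tail at V / k appears. -/
lemma lintegral_fading_lt {Ω : Type*} [MeasurableSpace Ω] (μ : Measure Ω) [SFinite μ]
    (q : unitInterval) {k : ℝ} (hk : 0 < k) {U V : Ω → ℝ≥0∞} (hU : Measurable U)
    (hV : Measurable V) :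
    ∫⁻ m, ∫⁻ ω, U ω * (if V ω < ENNReal.ofReal (m.1 * k) then 1 else 0) ∂μ ∂(linkLaw q) =
      ∫⁻ ω, U ω * expNeg (ENNReal.ofReal k⁻¹ * V ω) ∂μ := by
  have hm : Measurable fun u : (ℝ × Bool) × Ω =>
      U u.2 * (if V u.2 < ENNReal.ofReal (u.1.1 * k) then 1 else 0) := by
    refine (hU.comp measurable_snd).mul (Measurable.ite ?_ measurable_const measurable_const)
    exact measurableSet_lt (hV.comp measurable_snd) (by fun_prop)
  rw [lintegral_lintegral_swap hm.aemeasurable]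
  refine lintegral_congr fun ω => ?_
  have hS : MeasurableSet {x : ℝ | V ω < ENNReal.ofReal (x * k)} :=
    measurableSet_lt measurable_const (by fun_prop)
  have h1 : Measurable fun m : ℝ × Bool =>
      (if V ω < ENNReal.ofReal (m.1 * k) then 1 else 0 : ℝ≥0∞) := by
    refine Measurable.ite ?_ measurable_const measurable_const
    exact measurableSet_lt measurable_const (by fun_prop)
  rw [lintegral_const_mul _ h1]
  congr 1
  unfold linkLaw
  rw [lintegral_prod _ h1.aemeasurable]
  rw [← expMeasure_lt_ofReal_mul hk, ← lintegral_indicator_one hS]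
  refine lintegral_congr fun x => ?_
  have : ∀ c : ℝ≥0∞, ∫⁻ _ : Bool, c ∂(bernoulliMeasure true false q) = c := fun c => by simp
  refine (this (if V ω < ENNReal.ofReal (x * k) then 1 else 0)).trans ?_
  simp [indicator_apply]

namespace Network

variable {Ω : Type*} [MeasurableSpace Ω] {μ : Measure Ω} {lam : ℝ}
  {p q : unitInterval} (N : Network μ lam p q)

lemma measurable_config_near (v : ℝ) : Measurable fun u : (Device × Device) × Ω =>
    N.config u.2 (near1 v u.1.1 ∪ near2 u.1.2) := by
  classical
  have h : ∀ u : (Device × Device) × Ω, N.config u.2 (near1 v u.1.1 ∪ near2 u.1.2) =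
      -- The indicator of a union is the supremum of the indicators, which shows measurability in
      -- all variables at once.
      ∑' n, ({u : Device × Device | u.2 ∈ near1 v u.1} ∪ ∅).indicator 1 (u.1.1, N.dev n u.2) ⊔
        ({u : Device × Device | u.2 ∈ near2 u.1} ∪ ∅).indicator 1 (u.1.2, N.dev n u.2) := by
    intro u
    have hm := (measurableSet_near1_right v u.1.1).union (measurableSet_near2_right u.1.2)
    rw [config, pointMeasure_apply _ _ hm]
    refine tsum_congr fun n => ?_
    rw [indicator_apply, indicator_apply, indicator_apply]
    simp only [mem_union, mem_ofPred_eq, Pi.one_apply, mem_empty_iff_false, or_false]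
    by_cases h1 : N.dev n u.2 ∈ near1 v u.1.1 <;> by_cases h2 : N.dev n u.2 ∈ near2 u.1.2 <;>
      simp [h1, h2]
  simp_rw [h]
  refine Measurable.tsum fun n => ?_
  have m1 : Measurable fun u : (Device × Device) × Ω => (u.1.1, N.dev n u.2) :=
    measurable_fst.fst.prodMk ((N.measurable_dev n).comp measurable_snd)
  have m2 : Measurable fun u : (Device × Device) × Ω => (u.1.2, N.dev n u.2) :=
    measurable_fst.snd.prodMk ((N.measurable_dev n).comp measurable_snd)
  refine Measurable.sup ((measurable_one.indicator ?_).comp m1)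
    ((measurable_one.indicator ?_).comp m2)
  · rw [union_empty]; exact measurableSet_near1 v
  · rw [union_empty]; exact measurableSet_near2

lemma measurable_lintegral_config {A : Type*} [MeasurableSpace A] {f : A → Device → ℝ≥0∞}
    (hf : Measurable fun u : A × Device => f u.1 u.2) :
    Measurable fun u : A × Ω => ∫⁻ w, f u.1 w ∂(N.config u.2) := by
  have h : ∀ u : A × Ω, ∫⁻ w, f u.1 w ∂(N.config u.2) = ∑' n, f u.1 (N.dev n u.2) := fun u =>
    lintegral_pointMeasure _ _ (hf.comp measurable_prodMk_left)
  simp_rw [h]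
  refine Measurable.tsum fun n => ?_
  have m1 : Measurable fun u : A × Ω => (u.1, N.dev n u.2) :=
    measurable_fst.prodMk ((N.measurable_dev n).comp measurable_snd)
  exact hf.comp m1

lemma measurable_lintegral_interfB (α v : ℝ) : Measurable fun u : (Device × Device) × Ω =>
    ∫⁻ w, interfB α v u.1.1 w ∂(N.config u.2) := by
  have : Measurable fun u : (Device × Device) × Device => (u.1.1, u.2) := by fun_prop
  exact N.measurable_lintegral_config (f := fun (z : Device × Device) w => interfB α v z.1 w)
    ((measurable_interfB α v).comp this)

lemma measurable_lintegral_interfA (α v : ℝ) : Measurable fun u : (Device × Device) × Ω =>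
    ∫⁻ w, interfA α v u.1.1 u.1.2 w ∂(N.config u.2) :=
  N.measurable_lintegral_config (f := fun (z : Device × Device) w => interfA α v z.1 z.2 w) (measurable_interfA α v)

variable [IsProbabilityMeasure μ]

/-- The void indicator and the two Laplace factors are exponentials of sums over the same devices,
so one use of the Laplace functional evaluates their joint expectation. -/
lemma lintegral_expNeg_config (hlam : 0 ≤ lam) {v : ℝ} (hv : 0 ≤ v) (α : ℝ) (x y : Device)
    {b c : ℝ} (hb : 0 ≤ b) (hc : 0 ≤ c) :
    ∫⁻ ω, expNeg (∞ * N.config ω (near1 v x ∪ near2 y)) *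
        expNeg (ENNReal.ofReal b * (∫⁻ w, interfB α v x w ∂(N.config ω)) +
          ENNReal.ofReal c * ∫⁻ w, interfA α v x y w ∂(N.config ω)) ∂μ =
      expNeg (ENNReal.ofReal (lam * Real.pi * dist x.1 (loc1 v) ^ 2)) *
        extLap2 lam p q α v b (dist x.1 (loc1 v)) *
        extVoid lam p v (dist x.1 (loc1 v)) ‖y.1‖ *
        extLap3 lam p q α v c (dist x.1 (loc1 v)) ‖y.1‖ := by
  have hB := measurable_interfB_right α v x
  have hA := measurable_interfA_right α v x y
  have hS := (measurableSet_near1_right v x).union (measurableSet_near2_right y)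
  have h1 : Measurable fun w => ∞ * (near1 v x ∪ near2 y).indicator (1 : Device → ℝ≥0∞) w :=
    (measurable_one.indicator hS).const_mul _
  have h2 : Measurable fun w => ∞ * (near1 v x ∪ near2 y).indicator (1 : Device → ℝ≥0∞) w +
      ENNReal.ofReal b * interfB α v x w := h1.add (hB.const_mul _)
  have h3 : Measurable fun w => ∞ * (near1 v x ∪ near2 y).indicator (1 : Device → ℝ≥0∞) w +
      ENNReal.ofReal b * interfB α v x w + ENNReal.ofReal c * interfA α v x y w :=
    h2.add (hA.const_mul _)
  rw [← lintegral_one_sub_expNeg hlam p q α hv x y hb hc, ← N.hasPoissonLaplace.laplace _ h3]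
  refine lintegral_congr fun ω => ?_
  rw [← lintegral_pointMeasure N.dev ω h3, lintegral_add_left h2, lintegral_add_left h1,
    lintegral_const_mul _ (measurable_one.indicator hS), lintegral_const_mul _ hB,
    lintegral_const_mul _ hA, lintegral_indicator_one hS, ← expNeg_add, ← add_assoc]
  rfl

attribute [local irreducible] near1 near2 config

/-- The joint Laplace transform of the interference terms. -/
theorem lintegral_pairEvent_expNeg (hlam : 0 ≤ lam) {v : ℝ} (hv : 0 ≤ v) (α : ℝ)
    {g : ℝ × ℝ × ℝ → ℝ≥0∞} (hg : Measurable g) {a b c : ℝ × ℝ × ℝ → ℝ} (ha : Measurable a)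
    (hb : Measurable b) (hc : Measurable c) (ha0 : ∀ z, 0 ≤ a z) (hb0 : ∀ z, 0 ≤ b z)
    (hc0 : ∀ z, 0 ≤ c z) :
    ∫⁻ ω in N.pairEvent v, g (N.R1 v ω, N.R2 v ω, N.Theta v ω) *
        expNeg (ENNReal.ofReal (a (N.R1 v ω, N.R2 v ω, N.Theta v ω)) * N.I1 α v ω +
          (ENNReal.ofReal (b (N.R1 v ω, N.R2 v ω, N.Theta v ω)) * N.I2 α v ω +
          ENNReal.ofReal (c (N.R1 v ω, N.R2 v ω, N.Theta v ω)) * N.I3 α v ω)) ∂μ =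
      ENNReal.ofReal (1 - p) * ∫⁻ r₁ in Ioi (0 : ℝ), ∫⁻ r₂ in Ioi (0 : ℝ),
        ∫⁻ θ in Ioo 0 Real.pi, g (r₁, r₂, θ) *
          (ENNReal.ofReal (linkLap q α (a (r₁, r₂, θ)) (dist2 v r₁ θ)) *
          extLap2 lam p q α v (b (r₁, r₂, θ)) r₁ * extLap3 lam p q α v (c (r₁, r₂, θ)) r₁ r₂) *
          extDensity lam p v r₁ r₂ := by
  have hP := measurable_params v
  have hK : Measurable fun z : Device × Device × ℝ≥0∞ × ℝ≥0∞ => g (params v z.1 z.2.1) *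
      expNeg (ENNReal.ofReal (a (params v z.1 z.2.1)) * Device.interf α z.1 +
      (ENNReal.ofReal (b (params v z.1 z.2.1)) * z.2.2.1 +
        ENNReal.ofReal (c (params v z.1 z.2.1)) * z.2.2.2)) := by
    have m1 : Measurable fun z : Device × Device × ℝ≥0∞ × ℝ≥0∞ => params v z.1 z.2.1 :=
      hP.comp (measurable_fst.prodMk measurable_snd.fst :
        Measurable fun z : Device × Device × ℝ≥0∞ × ℝ≥0∞ => (z.1, z.2.1))
    have m2 : Measurable fun z : Device × Device × ℝ≥0∞ × ℝ≥0∞ => Device.interf α z.1 :=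
      (measurable_interf α).comp measurable_fst
    have m3 : Measurable fun z : Device × Device × ℝ≥0∞ × ℝ≥0∞ => z.2.2.1 := measurable_snd.snd.fst
    have m4 : Measurable fun z : Device × Device × ℝ≥0∞ × ℝ≥0∞ => z.2.2.2 := measurable_snd.snd.snd
    have n1 := (ha.comp m1).ennreal_ofReal.mul m2
    have n2 := (hb.comp m1).ennreal_ofReal.mul m3
    have n3 := (hc.comp m1).ennreal_ofReal.mul m4
    exact (hg.comp m1).mul (measurable_expNeg.comp (n1.add (n2.add n3)))
  have hmain := N.lintegral_pairEvent α v (K := fun x y i2 i3 => g (params v x y) *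
    expNeg (ENNReal.ofReal (a (params v x y)) * Device.interf α x +
      (ENNReal.ofReal (b (params v x y)) * i2 + ENNReal.ofReal (c (params v x y)) * i3))) hK
  simp only [← N.params_dev, N.I1_eq]
  refine hmain.trans ?_
  -- `k` gathers g and the expectation over the configuration. Only the interference of x is kept
  -- apart, since it depends on a mark of x.
  let k : ℝ × ℝ × ℝ → ℝ≥0∞ := fun z => g z * (expNeg (ENNReal.ofReal (lam * Real.pi * z.1 ^ 2)) *
    extLap2 lam p q α v (b z) z.1 * extVoid lam p v z.1 z.2.1 *
    extLap3 lam p q α v (c z) z.1 z.2.1)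
  have hk : Measurable k := by
    have s1 : Measurable fun z : ℝ × ℝ × ℝ => (z.1, z.2.1) := by fun_prop
    have s2 : Measurable fun z : ℝ × ℝ × ℝ => (c z, z.1, z.2.1) := by fun_prop
    have s3 : Measurable fun z : ℝ × ℝ × ℝ => (b z, z.1) := by fun_prop
    have e1 : Measurable fun z : ℝ × ℝ × ℝ =>
        expNeg (ENNReal.ofReal (lam * Real.pi * z.1 ^ 2)) := measurable_expNeg.comp (by fun_prop)
    have e2 : Measurable fun z : ℝ × ℝ × ℝ => extLap2 lam p q α v (b z) z.1 :=
      (measurable_extLap2 lam p q α v).comp s3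
    have e3 : Measurable fun z : ℝ × ℝ × ℝ => extVoid lam p v z.1 z.2.1 :=
      (measurable_extVoid lam p v).comp s1
    have e4 : Measurable fun z : ℝ × ℝ × ℝ => extLap3 lam p q α v (c z) z.1 z.2.1 :=
      (measurable_extLap3 lam p q α v).comp s2
    exact hg.mul (((e1.mul e2).mul e3).mul e4)
  have hstep : ∀ x y, (admissible v).indicator (fun z => ∫⁻ ω,
        expNeg (∞ * N.config ω (near1 v z.1 ∪ near2 z.2)) * (g (params v z.1 z.2) *
    expNeg (ENNReal.ofReal (a (params v z.1 z.2)) * Device.interf α z.1 +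
      (ENNReal.ofReal (b (params v z.1 z.2)) * (∫⁻ w, interfB α v z.1 w ∂(N.config ω)) +
        ENNReal.ofReal (c (params v z.1 z.2)) * ∫⁻ w, interfA α v z.1 z.2 w ∂(N.config ω)))) ∂μ)
      (x, y) = (admissible v).indicator (fun z => k (params v z.1 z.2) *
        expNeg (ENNReal.ofReal (a (params v z.1 z.2)) * Device.interf α z.1)) (x, y) := by
    intro x y
    by_cases hadm : (x, y) ∈ admissible v
    · rw [indicator_of_mem hadm, indicator_of_mem hadm]
      simp only [k, params_fst, params_snd_fst]
      rw [← N.lintegral_expNeg_config hlam hv α x y (hb0 (params v x y)) (hc0 (params v x y))]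
      have hmm : Measurable fun ω => expNeg (∞ * N.config ω (near1 v x ∪ near2 y)) *
        expNeg (ENNReal.ofReal (b (params v x y)) * (∫⁻ w, interfB α v x w ∂(N.config ω)) +
          ENNReal.ofReal (c (params v x y)) * ∫⁻ w, interfA α v x y w ∂(N.config ω)) := by
        have s : Measurable fun ω : Ω => ((x, y), ω) := measurable_prodMk_left
        have f1 : Measurable fun ω => N.config ω (near1 v x ∪ near2 y) :=
          (N.measurable_config_near v).comp s
        have f2 : Measurable fun ω => ∫⁻ w, interfB α v x w ∂(N.config ω) :=
          (N.measurable_lintegral_interfB α v).comp s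
        have f3 : Measurable fun ω => ∫⁻ w, interfA α v x y w ∂(N.config ω) :=
          (N.measurable_lintegral_interfA α v).comp s
        exact (measurable_expNeg.comp (f1.const_mul _)).mul
          (measurable_expNeg.comp ((f2.const_mul _).add (f3.const_mul _)))
      rw [← lintegral_const_mul _ hmm, ← lintegral_mul_const _ (hmm.const_mul _)]
      refine lintegral_congr fun ω => ?_
      rw [expNeg_add (ENNReal.ofReal (a (params v x y)) * Device.interf α x)]
      ring
    · rw [indicator_of_notMem hadm, indicator_of_notMem hadm]
  simp_rw [hstep]
  rw [lintegral_admissible hlam p q hv hk ha ha0 α]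
  congr 1
  refine lintegral_congr fun r₁ => lintegral_congr fun r₂ => lintegral_congr fun θ => ?_
  simp only [k, extDensity]
  ring

lemma measurable_lintegral_config_near (α v : ℝ)
    {K : Device → Device → ℝ≥0∞ → ℝ≥0∞ → ℝ≥0∞}
    (hK : Measurable fun z : Device × Device × ℝ≥0∞ × ℝ≥0∞ => K z.1 z.2.1 z.2.2.1 z.2.2.2) :
    Measurable fun z : Device × Device => ∫⁻ ω,
      expNeg (∞ * N.config ω (near1 v z.1 ∪ near2 z.2)) *
        K z.1 z.2 (∫⁻ w, interfB α v z.1 w ∂(N.config ω))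
          (∫⁻ w, interfA α v z.1 z.2 w ∂(N.config ω)) ∂μ := by
  have h1 := N.measurable_config_near v
  have h2 := N.measurable_lintegral_interfB α v
  have h3 := N.measurable_lintegral_interfA α v
  have h4 : Measurable fun u : (Device × Device) × Ω => (u.1.1, u.1.2,
      (∫⁻ w, interfB α v u.1.1 w ∂(N.config u.2)),
      ∫⁻ w, interfA α v u.1.1 u.1.2 w ∂(N.config u.2)) :=
    measurable_fst.fst.prodMk (measurable_fst.snd.prodMk (h2.prodMk h3))
  exact Measurable.lintegral_prod_right' (f := fun u : (Device × Device) × Ω =>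
      expNeg (∞ * N.config u.2 (near1 v u.1.1 ∪ near2 u.1.2)) *
        K u.1.1 u.1.2 (∫⁻ w, interfB α v u.1.1 w ∂(N.config u.2))
          (∫⁻ w, interfA α v u.1.1 u.1.2 w ∂(N.config u.2)))
    ((measurable_expNeg.comp (h1.const_mul _)).mul (hK.comp h4))

lemma near2_congr {w : Plane} {b : Bool} {m m' : ℝ × Bool} :
    near2 (w, b, m) = near2 (w, b, m') := by
  unfold near2; rfl

lemma interfA_congr (α v : ℝ) (x u : Device) {w : Plane} {b : Bool} {m m' : ℝ × Bool} :
    interfA α v x (w, b, m) u = interfA α v x (w, b, m') u := by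
  unfold interfA; rfl

lemma admissible_congr {v : ℝ} {x : Device} {w : Plane} {b : Bool} {m m' : ℝ × Bool} :
    (x, w, b, m) ∈ admissible v ↔ (x, w, b, m') ∈ admissible v := Iff.rfl

/-- The fading of the second server enters only the final comparison: admissibility, the void event
and the interference ignore it. It can therefore be averaged first. The condition `w ≠ 0` makes
‖w‖^{-α} positive, with inverse ‖w‖^α. -/
lemma lintegral_coverage_inner (α v T : ℝ) (x : Device) {w : Plane}
    (hw : w ≠ 0) (b : Bool) :
    ∫⁻ m, (admissible v).indicator (fun z => ∫⁻ ω,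
      expNeg (∞ * N.config ω (near1 v z.1 ∪ near2 z.2)) *
        (if ENNReal.ofReal T * (Device.interf α z.1 + (∫⁻ u, interfB α v z.1 u ∂(N.config ω)) +
          ∫⁻ u, interfA α v z.1 z.2 u ∂(N.config ω)) <
            ENNReal.ofReal (z.2.2.2.1 * ‖z.2.1‖ ^ (-α)) then 1 else 0) ∂μ) (x, w, b, m)
        ∂(linkLaw q) =
    ∫⁻ m, (admissible v).indicator (fun z => ∫⁻ ω,
      expNeg (∞ * N.config ω (near1 v z.1 ∪ near2 z.2)) *
        expNeg (ENNReal.ofReal (T * ‖z.2.1‖ ^ α) * Device.interf α z.1 +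
          (ENNReal.ofReal (T * ‖z.2.1‖ ^ α) * (∫⁻ u, interfB α v z.1 u ∂(N.config ω)) +
          ENNReal.ofReal (T * ‖z.2.1‖ ^ α) * ∫⁻ u, interfA α v z.1 z.2 u ∂(N.config ω)))
        ∂μ) (x, w, b, m) ∂(linkLaw q) := by
  classical
  -- The mark `(0, true)` is an arbitrary representative; admissibility does not depend on it.
  by_cases hadm : (x, w, b, (0, true)) ∈ admissible v
  · have hadm' : ∀ m : ℝ × Bool, (x, w, b, m) ∈ admissible v := fun m => admissible_congr.1 hadm
    simp only [indicator_of_mem (hadm' _)]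
    let y : Device := (w, b, (0, true))
    have s : Measurable fun ω : Ω => ((x, y), ω) := measurable_prodMk_left
    have f1 : Measurable fun ω => N.config ω (near1 v x ∪ near2 y) :=
      (N.measurable_config_near v).comp s
    have f2 : Measurable fun ω => ∫⁻ w, interfB α v x w ∂(N.config ω) :=
      (N.measurable_lintegral_interfB α v).comp s
    have f3 : Measurable fun ω => ∫⁻ w, interfA α v x y w ∂(N.config ω) :=
      (N.measurable_lintegral_interfA α v).comp s
    have hk : 0 < ‖w‖ ^ (-α) := Real.rpow_pos_of_pos (norm_pos_iff.2 hw) _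
    have key := lintegral_fading_lt μ q hk (measurable_expNeg.comp (f1.const_mul ∞))
      (((f2.const_add (Device.interf α x)).add f3).const_mul (ENNReal.ofReal T))
    have e1 : ∀ m : ℝ × Bool, near2 (w, b, m) = near2 y := fun m => near2_congr
    have e2 : ∀ (m : ℝ × Bool) u, interfA α v x (w, b, m) u = interfA α v x y u :=
      fun m u => interfA_congr α v x u
    simp only [e1, e2]
    refine key.trans ?_
    rw [lintegral_const, measure_univ, mul_one]
    refine lintegral_congr fun ω => ?_
    simp only [Function.comp_apply, Pi.add_apply]
    congr 2
    have e3 : ENNReal.ofReal (T * ‖w‖ ^ α) = ENNReal.ofReal (‖w‖ ^ (-α))⁻¹ * ENNReal.ofReal T := by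
      rw [Real.rpow_neg (norm_nonneg _), inv_inv, mul_comm,
        ENNReal.ofReal_mul (Real.rpow_nonneg (norm_nonneg _) _)]
    rw [e3]
    ring
  · have hadm' : ∀ m : ℝ × Bool, (x, w, b, m) ∉ admissible v := fun m h =>
      hadm (admissible_congr.1 h)
    simp only [indicator_of_notMem (hadm' _)]

/-- The coverage event has the probability of survival of an exponential clock, given the
interference. -/
theorem measure_coverage (hlam : 0 ≤ lam) {v : ℝ} (hv : 0 ≤ v) (α : ℝ) {T : ℝ} (hT : 0 < T) :
    μ (N.pairEvent v ∩ {ω | ENNReal.ofReal T < N.SIR α v ω}) =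
      ENNReal.ofReal (1 - p) * ∫⁻ r₁ in Ioi (0 : ℝ), ∫⁻ r₂ in Ioi (0 : ℝ),
        ∫⁻ θ in Ioo 0 Real.pi,
          (ENNReal.ofReal (linkLap q α (T * |r₂| ^ α) (dist2 v r₁ θ)) *
          extLap2 lam p q α v (T * |r₂| ^ α) r₁ * extLap3 lam p q α v (T * |r₂| ^ α) r₁ r₂) *
          extDensity lam p v r₁ r₂ := by
  classical
  have mI : Measurable fun z : Device × Device × ℝ≥0∞ × ℝ≥0∞ => Device.interf α z.1 :=
    (measurable_interf α).comp measurable_fst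
  have hK2 : Measurable fun z : Device × Device × ℝ≥0∞ × ℝ≥0∞ =>
      (if ENNReal.ofReal T * (Device.interf α z.1 + z.2.2.1 + z.2.2.2) <
        ENNReal.ofReal (z.2.1.2.2.1 * ‖z.2.1.1‖ ^ (-α)) then 1 else 0 : ℝ≥0∞) := by
    refine Measurable.ite (measurableSet_lt ?_ ?_) measurable_const measurable_const
    · have m3 : Measurable fun z : Device × Device × ℝ≥0∞ × ℝ≥0∞ => z.2.2.1 :=
        measurable_snd.snd.fst
      have m4 : Measurable fun z : Device × Device × ℝ≥0∞ × ℝ≥0∞ => z.2.2.2 :=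
        measurable_snd.snd.snd
      exact ((mI.add m3).add m4).const_mul _
    · fun_prop
  have hK1 : Measurable fun z : Device × Device × ℝ≥0∞ × ℝ≥0∞ =>
      expNeg (ENNReal.ofReal (T * ‖z.2.1.1‖ ^ α) * Device.interf α z.1 +
          (ENNReal.ofReal (T * ‖z.2.1.1‖ ^ α) * z.2.2.1 +
          ENNReal.ofReal (T * ‖z.2.1.1‖ ^ α) * z.2.2.2)) := by
    have m2 : Measurable fun z : Device × Device × ℝ≥0∞ × ℝ≥0∞ =>
        ENNReal.ofReal (T * ‖z.2.1.1‖ ^ α) := by fun_prop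
    have m3 : Measurable fun z : Device × Device × ℝ≥0∞ × ℝ≥0∞ => z.2.2.1 :=
      measurable_snd.snd.fst
    have m4 : Measurable fun z : Device × Device × ℝ≥0∞ × ℝ≥0∞ => z.2.2.2 :=
      measurable_snd.snd.snd
    exact measurable_expNeg.comp ((m2.mul mI).add ((m2.mul m3).add (m2.mul m4)))
  have hSIR : μ (N.pairEvent v ∩ {ω | ENNReal.ofReal T < N.SIR α v ω}) =
      ∫⁻ ω in N.pairEvent v, (if ENNReal.ofReal T * (Device.interf α (N.dev1 v ω) + N.I2 α v ω +
        N.I3 α v ω) < ENNReal.ofReal ((N.dev2 v ω).2.2.1 * ‖(N.dev2 v ω).1‖ ^ (-α))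
        then 1 else 0) ∂μ := by
    have hS : MeasurableSet {ω | ENNReal.ofReal T * (N.I1 α v ω + N.I2 α v ω +
        N.I3 α v ω) < ENNReal.ofReal ((N.dev2 v ω).2.2.1 * ‖(N.dev2 v ω).1‖ ^ (-α))} := by
      refine measurableSet_lt (((N.measurable_I1 α v).add (N.measurable_I2 α v)).add
        (N.measurable_I3 α v) |>.const_mul _) ?_
      have : Measurable fun y : Device => ENNReal.ofReal (y.2.2.1 * ‖y.1‖ ^ (-α)) := by fun_prop
      exact this.comp (N.measurable_dev2 v)
    have e : N.pairEvent v ∩ {ω | ENNReal.ofReal T < N.SIR α v ω} = {ω | ENNReal.ofReal T *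
        (N.I1 α v ω + N.I2 α v ω + N.I3 α v ω) < ENNReal.ofReal ((N.dev2 v ω).2.2.1 *
          ‖(N.dev2 v ω).1‖ ^ (-α))} ∩ N.pairEvent v := by
      ext ω
      constructor
      · rintro ⟨h1, h2⟩; exact ⟨(N.lt_SIR_iff hT h1).1 h2, h1⟩
      · rintro ⟨h1, h2⟩; exact ⟨h2, (N.lt_SIR_iff hT h2).2 h1⟩
    rw [e, ← Measure.restrict_apply hS, ← lintegral_indicator_one hS]
    refine lintegral_congr fun ω => ?_
    simp [indicator_apply, I1_eq]
  -- All three parameters equal T r₂^α. The absolute value only ensures nonnegativity for every real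
  -- argument.
  have hfin := N.lintegral_pairEvent_expNeg hlam hv α (g := fun _ => 1)
    (a := fun z => T * |z.2.1| ^ α) (b := fun z => T * |z.2.1| ^ α) (c := fun z => T * |z.2.1| ^ α)
    measurable_const (by fun_prop) (by fun_prop) (by fun_prop)
    (fun z => by positivity) (fun z => by positivity) (fun z => by positivity)
  simp only [one_mul] at hfin
  rw [← hfin, hSIR]
  have hR2 : ∀ ω, |N.R2 v ω| = ‖(N.dev2 v ω).1‖ := fun ω => abs_norm _
  simp only [hR2, I1_eq]
  refine (N.lintegral_pairEvent α v (K := fun x y i2 i3 => if ENNReal.ofReal T *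
    (Device.interf α x + i2 + i3) < ENNReal.ofReal (y.2.2.1 * ‖y.1‖ ^ (-α)) then 1 else 0)
    hK2).trans (Eq.trans ?_ (N.lintegral_pairEvent α v (K := fun x y i2 i3 =>
      expNeg (ENNReal.ofReal (T * ‖y.1‖ ^ α) * Device.interf α x +
          (ENNReal.ofReal (T * ‖y.1‖ ^ α) * i2 +
          ENNReal.ofReal (T * ‖y.1‖ ^ α) * i3))) hK1).symm)
  refine lintegral_congr fun x => ?_
  have M2 := (N.measurable_lintegral_config_near (μ := μ) α v (K := fun x y i2 i3 => if ENNReal.ofReal T *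
    (Device.interf α x + i2 + i3) < ENNReal.ofReal (y.2.2.1 * ‖y.1‖ ^ (-α)) then 1 else 0)
    hK2).indicator (measurableSet_admissible v) |>.comp (measurable_prodMk_left (x := x))
  have M1 := (N.measurable_lintegral_config_near (μ := μ) α v (K := fun x y i2 i3 =>
      expNeg (ENNReal.ofReal (T * ‖y.1‖ ^ α) * Device.interf α x +
          (ENNReal.ofReal (T * ‖y.1‖ ^ α) * i2 +
          ENNReal.ofReal (T * ‖y.1‖ ^ α) * i3))) hK1).indicator (measurableSet_admissible v)
          |>.comp (measurable_prodMk_left (x := x))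
  refine (lintegral_deviceIntensity' lam p q M2).trans (Eq.trans ?_
    (lintegral_deviceIntensity' lam p q M1).symm)
  congr 1
  -- The origin has measure zero, so the second server may be assumed to be elsewhere.
  have hne : ∀ᵐ w : Plane, w ≠ 0 := by simp [ae_iff]
  refine lintegral_congr_ae ?_
  filter_upwards [hne] with w hw
  have h1 := fun b => N.lintegral_coverage_inner α v T x hw b
  exact congrArg₂ (· + ·) (congrArg _ (h1 true)) (congrArg _ (h1 false))

end Network

end D2D

/-! ### The probability of subcase 𝒴 -/

namespace D2D

open Device

lemma lintegral_Ioi_of_hasDerivAt {g g' : ℝ → ℝ} {a l : ℝ} (hcont : ContinuousWithinAt g (Ici a) a)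
    (hderiv : ∀ x ∈ Ioi a, HasDerivAt g (g' x) x) (hpos : ∀ x ∈ Ioi a, 0 ≤ g' x)
    (hg : Tendsto g atTop (𝓝 l)) : ∫⁻ x in Ioi a, ENNReal.ofReal (g' x) = ENNReal.ofReal (l - g a) := by
  rw [← ofReal_integral_eq_lintegral_ofReal (integrableOn_Ioi_deriv_of_nonneg hcont hderiv hpos hg)
    ((ae_restrict_iff' measurableSet_Ioi).2 (ae_of_all _ hpos)),
    integral_Ioi_of_hasDerivAt_of_nonneg hcont hderiv hpos hg]

lemma fR1_nonneg {lam : ℝ} (hlam : 0 ≤ lam) {r : ℝ} (hr : 0 ≤ r) : 0 ≤ fR1 lam r := by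
  unfold fR1; positivity

lemma lintegral_fR1 {lam : ℝ} (hlam : 0 < lam) :
    ∫⁻ r in Ioi (0 : ℝ), ENNReal.ofReal (fR1 lam r) = 1 := by
  have hd : ∀ x ∈ Ici (0 : ℝ), HasDerivAt (fun r => -Real.exp (-(lam * Real.pi * r ^ 2)))
      (fR1 lam x) x := by
    intro x _
    have h := ((((hasDerivAt_id x).pow 2).const_mul (lam * Real.pi)).neg.exp).neg
    convert! h using 1
    simp only [fR1, id, Nat.cast_ofNat, Nat.add_one_sub_one, pow_one, mul_one, Pi.pow_apply,
      Pi.neg_apply]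
    ring
  have hl : Tendsto (fun r => -Real.exp (-(lam * Real.pi * r ^ 2))) atTop (𝓝 0) := by
    have h1 : Tendsto (fun r : ℝ => lam * Real.pi * r ^ 2) atTop atTop :=
      (tendsto_pow_atTop two_ne_zero).const_mul_atTop (by positivity)
    simpa using (Real.tendsto_exp_neg_atTop_nhds_zero.comp h1).neg
  rw [lintegral_Ioi_of_hasDerivAt (hd 0 self_mem_Ici).continuousAt.continuousWithinAt
    (fun x hx => hd x (Ioi_subset_Ici_self hx)) (fun x hx => fR1_nonneg hlam.le (le_of_lt hx)) hl]
  simp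

/-- The integrand is the probability that no device is as close to location 1 as x. Total mass 1
expresses that a unique closest device exists almost surely. -/
lemma lintegral_expNeg_dist {lam : ℝ} (hlam : 0 < lam) (v : ℝ) :
    ENNReal.ofReal lam * ∫⁻ x : Plane,
      expNeg (ENNReal.ofReal (lam * Real.pi * dist x (loc1 v) ^ 2)) = 1 := by
  have hm : Measurable fun z : ℝ × ℝ × ℝ => expNeg (ENNReal.ofReal (lam * Real.pi * z.1 ^ 2)) :=
    measurable_expNeg.comp (by fun_prop)
  rw [lintegral_plane_loc1 v (f := fun r _ _ => expNeg (ENNReal.ofReal (lam * Real.pi * r ^ 2))) hm,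
    ← lintegral_const_mul' _ _ ENNReal.ofReal_ne_top, ← lintegral_fR1 hlam]
  refine setLIntegral_congr_fun measurableSet_Ioi fun r hr => ?_
  have hr : 0 < r := hr
  have hpi := Real.pi_pos
  simp only [lintegral_const, Measure.restrict_apply MeasurableSet.univ, univ_inter,
    Real.volume_Ioo, sub_zero]
  rw [expNeg_ofReal (by positivity), ← ENNReal.ofReal_mul (by positivity),
    ← ENNReal.ofReal_mul (by positivity), ← ENNReal.ofReal_mul hlam.le]
  congr 1
  unfold fR1
  ring

lemma deviceIntensity_near1 {lam : ℝ} (hlam : 0 ≤ lam) (p q : unitInterval) (v : ℝ) (x : Device) :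
    deviceIntensity lam p q (near1 v x) =
      ENNReal.ofReal (lam * Real.pi * dist x.1 (loc1 v) ^ 2) := by
  have h : near1 v x = (Metric.closedBall (loc1 v) (dist x.1 (loc1 v))) ×ˢ univ := by
    ext w
    simp [near1, Metric.mem_closedBall]
  rw [h, deviceIntensity, Measure.prod_prod, measure_univ, mul_one, planeIntensity,
    Measure.smul_apply, EuclideanSpace.volume_closedBall_fin_two, smul_eq_mul,
    ← ENNReal.ofReal_pow dist_nonneg, ← ENNReal.ofReal_mul (by positivity),
    ← ENNReal.ofReal_mul hlam]
  congr 1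
  ring

namespace Network

variable {Ω : Type*} [MeasurableSpace Ω] {μ : Measure Ω} {lam : ℝ}
  {p q : unitInterval} (N : Network μ lam p q)

lemma server1_tsum (v : ℝ) (ω : Ω) (F : Device → ℝ≥0∞) :
    ∑' n, {x : Device | N.config ω (near1 v x) = 1}.indicator F (N.dev n ω) =
      {x : Device | N.config ω (near1 v x) = 1}.indicator F (N.dev1 v ω) := by
  rw [tsum_eq_single (N.server1 v ω)]
  · rfl
  · intro n hn
    rw [indicator_of_notMem]
    exact fun h => hn (server1_eq_of_unique h).symm

lemma measurableSet_unique1 (v : ℝ) :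
    MeasurableSet {ω | N.config ω (near1 v (N.dev1 v ω)) = 1} :=
  N.measurable_config_apply (N.measurable_dev1 v) (measurableSet_near1 v)
    (measurableSet_singleton 1)

variable [IsProbabilityMeasure μ]

lemma lintegral_expNeg_config_near1 (hlam : 0 ≤ lam) (v : ℝ) (x : Device) :
    ∫⁻ ω, expNeg (∞ * N.config ω (near1 v x)) ∂μ =
      expNeg (ENNReal.ofReal (lam * Real.pi * dist x.1 (loc1 v) ^ 2)) := by
  have hS := measurableSet_near1_right v x
  have hm : Measurable fun w => ∞ * (near1 v x).indicator (1 : Device → ℝ≥0∞) w :=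
    (measurable_one.indicator hS).const_mul _
  have h := N.hasPoissonLaplace.laplace _ hm
  have e1 : ∀ ω, ∑' n, ∞ * (near1 v x).indicator (1 : Device → ℝ≥0∞) (N.dev n ω) =
      ∞ * N.config ω (near1 v x) := by
    intro ω
    rw [← lintegral_pointMeasure N.dev ω hm, lintegral_const_mul _ (measurable_one.indicator hS),
      lintegral_indicator_one hS]
    rfl
  have e2 : ∀ w, 1 - expNeg (∞ * (near1 v x).indicator (1 : Device → ℝ≥0∞) w) =
      (near1 v x).indicator (1 : Device → ℝ≥0∞) w := by
    intro w
    by_cases hw : w ∈ near1 v x <;> simp [hw]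
  simp_rw [e1, e2] at h
  rw [h, lintegral_indicator_one hS, deviceIntensity_near1 hlam]

/-- The file cached by the server of location 1, from Mecke's formula. -/
lemma lintegral_unique1 (hlam : 0 < lam) (v : ℝ) {F : Bool → ℝ≥0∞} :
    ∫⁻ ω in {ω | N.config ω (near1 v (N.dev1 v ω)) = 1}, F (N.dev1 v ω).2.1 ∂μ =
      ENNReal.ofReal p * F true + ENNReal.ofReal (1 - p) * F false := by
  classical
  set L := deviceIntensity lam p q
  let G : Device × Measure Device → ℝ≥0∞ := fun z =>
    {z : Device × Measure Device | locFin L z.2 (near1 v z.1) = 1}.indicator (fun z => F z.1.2.1) z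
  have hG : Measurable G := by
    have m1 : Measurable fun u : (Device × Measure Device) × Device => (u.1.1, u.2) := by fun_prop
    have e3 : Measurable fun z : Device × Measure Device => locFin L z.2 (near1 v z.1) :=
      measurable_locFin_apply L (m1 (measurableSet_near1 v)) measurable_snd
    have e4 : Measurable fun z : Device × Measure Device => F z.1.2.1 :=
      (measurable_of_countable F).comp measurable_fst.snd.fst
    exact e4.indicator (e3 (measurableSet_singleton 1))
  have hX := N.hasPoissonLaplace
  have hmk := hX.mecke hG
  have hleft : ∫⁻ ω, ∑' n, G (N.dev n ω, pointMeasure N.dev ω) ∂μ =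
      ∫⁻ ω in {ω | N.config ω (near1 v (N.dev1 v ω)) = 1}, F (N.dev1 v ω).2.1 ∂μ := by
    rw [← lintegral_indicator (N.measurableSet_unique1 v)]
    refine lintegral_congr_ae ?_
    filter_upwards [hX.ae_locallyFinite] with ω hω
    simp only [G, indicator_apply, mem_ofPred_eq]
    rw [locFin_apply L hω]
    have h := N.server1_tsum v ω (fun x => F x.2.1)
    simp only [indicator_apply, mem_ofPred_eq] at h
    exact h
  have hright : ∀ x, ∫⁻ ω, G (x, pointMeasure N.dev ω + Measure.dirac x) ∂μ =
      expNeg (ENNReal.ofReal (lam * Real.pi * dist x.1 (loc1 v) ^ 2)) * F x.2.1 := by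
    intro x
    have e1 : ∀ᵐ ω ∂μ, G (x, pointMeasure N.dev ω + Measure.dirac x) =
        expNeg (∞ * N.config ω (near1 v x)) * F x.2.1 := by
      filter_upwards [hX.ae_locallyFinite] with ω hω
      simp only [G, indicator_apply, mem_ofPred_eq]
      rw [locFin_apply L]
      · have hx : x ∈ near1 v x := le_refl (dist x.1 (loc1 v))
        have e5 : ∀ a : ℝ≥0∞, a + 1 = 1 ↔ a = 0 := fun a => by
          conv_lhs => rw [← zero_add (1 : ℝ≥0∞), ← add_assoc, add_zero]
          exact ENNReal.add_left_inj ENNReal.one_ne_top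
        rw [Measure.add_apply, Measure.dirac_apply' _ (measurableSet_near1_right _ _),
          indicator_of_mem hx, Pi.one_apply, expNeg_top_mul]
        simp only [e5]
        change (if N.config ω (near1 v x) = 0 then _ else _) = _
        split_ifs <;> simp
      · intro j
        rw [Measure.add_apply]
        exact ENNReal.add_lt_top.2 ⟨hω j, measure_lt_top _ _⟩
    have mc : Measurable fun ω => N.config ω (near1 v x) :=
      (Measure.measurable_coe (measurableSet_near1_right v x)).comp N.measurable_config
    have mc2 : Measurable fun ω => expNeg (∞ * N.config ω (near1 v x)) :=
      measurable_expNeg.comp (mc.const_mul _)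
    rw [lintegral_congr_ae e1, lintegral_mul_const _ mc2, N.lintegral_expNeg_config_near1 hlam.le]
  have mE : Measurable fun x : Plane =>
      expNeg (ENNReal.ofReal (lam * Real.pi * dist x (loc1 v) ^ 2)) :=
    measurable_expNeg.comp (by fun_prop)
  rw [← hleft, hmk]
  simp_rw [hright]
  have mF : Measurable fun x : Device =>
      expNeg (ENNReal.ofReal (lam * Real.pi * dist x.1 (loc1 v) ^ 2)) * F x.2.1 :=
    (mE.comp measurable_fst).mul ((measurable_of_countable F).comp measurable_snd.fst)
  rw [lintegral_deviceIntensity' lam p q mF]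
  have hq : ∀ c : ℝ≥0∞, ∫⁻ _ : ℝ × Bool, c ∂(linkLaw q) = c := fun c => by
    rw [lintegral_const]; unfold linkLaw; simp
  simp_rw [hq]
  have e6 : ∀ x : Plane, ENNReal.ofReal p * (expNeg (ENNReal.ofReal (lam * Real.pi *
      dist x (loc1 v) ^ 2)) * F true) + ENNReal.ofReal (1 - p) * (expNeg (ENNReal.ofReal (lam *
      Real.pi * dist x (loc1 v) ^ 2)) * F false) = expNeg (ENNReal.ofReal (lam * Real.pi *
      dist x (loc1 v) ^ 2)) * (ENNReal.ofReal p * F true + ENNReal.ofReal (1 - p) * F false) :=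
    fun x => by ring
  simp_rw [e6]
  rw [lintegral_mul_const _ mE, ← mul_assoc, lintegral_expNeg_dist hlam, one_mul]

/-- Mecke's formula on the event of a unique closest device bounds the probability of 𝒴 below by 1 -
p and that of its complement by p. The bounds sum to 1, so both are equalities and ties have
probability zero. -/
theorem measure_subcaseY (hlam : 0 < lam) (v : ℝ) :
    μ (N.subcaseY v) = ENNReal.ofReal (1 - p) := by
  classical
  have hY := N.measurableSet_subcaseY v
  set E := {ω | N.config ω (near1 v (N.dev1 v ω)) = 1}
  have hb : ∀ b : Bool, μ ({ω | N.cachesA (N.server1 v ω) ω = b} ∩ E) =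
      ENNReal.ofReal p * (if true = b then 1 else 0) +
        ENNReal.ofReal (1 - p) * (if false = b then 1 else 0) := by
    intro b
    have h := N.lintegral_unique1 hlam v (F := fun c => if c = b then 1 else 0)
    have hm : MeasurableSet {ω | N.cachesA (N.server1 v ω) ω = b} := by
      have : Measurable fun ω => (N.dev1 v ω).2.1 := (N.measurable_dev1 v).snd.fst
      exact this (measurableSet_singleton b)
    rw [← h, ← Measure.restrict_apply hm, ← lintegral_indicator_one hm]
    refine lintegral_congr fun ω => ?_
    simp only [indicator_apply, mem_ofPred_eq, Pi.one_apply]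
    rfl
  have h1 : ENNReal.ofReal (1 - p) ≤ μ (N.subcaseY v) := by
    have := hb false
    simp at this
    rw [← this]
    exact measure_mono inter_subset_left
  have h2 : ENNReal.ofReal p ≤ μ (N.subcaseY v)ᶜ := by
    have := hb true
    simp at this
    rw [← this]
    refine measure_mono fun ω hω => ?_
    have h3 : N.cachesA (N.server1 v ω) ω = true := hω.1
    simp [subcaseY, h3]
  refine le_antisymm ?_ h1
  have h3 := prob_add_prob_compl (μ := μ) hY
  have h4 : ENNReal.ofReal (1 - p) + ENNReal.ofReal p = 1 := by
    rw [← ENNReal.ofReal_add (sub_nonneg.2 p.2.2) p.2.1]; simp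
  have h5 : μ (N.subcaseY v) + ENNReal.ofReal p ≤ ENNReal.ofReal (1 - p) + ENNReal.ofReal p := by
    rw [h4, ← h3]; gcongr
  exact (ENNReal.add_le_add_iff_right ENNReal.ofReal_ne_top).1 h5

end Network

end D2D

/-! ### Arc lengths and the area of 𝒞₂ \ 𝒞₁ -/

namespace D2D

section HalfWidth

variable {v r₁ r : ℝ}

lemma halfWidth_of_pos (hv : 0 < v) : halfWidth v r₁ r = halfAngle v r₁ r := by
  simp [halfWidth, hv.ne']

lemma halfWidth_eq_zero_of_lt (hv : 0 ≤ v) (hr₁ : 0 ≤ r₁) (hr : v + r₁ < r) :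
    halfWidth v r₁ r = 0 := by
  rcases hv.eq_or_lt with rfl | hv
  · have : ¬ r ≤ r₁ := by linarith
    simp [halfWidth, this]
  · rw [halfWidth_of_pos hv]
    have h0 : 0 < r := by linarith
    refine Real.arccos_of_one_le ((one_le_div (by positivity)).2 ?_)
    nlinarith

lemma halfWidth_eq_zero_of_le (hr₁ : 0 < r₁) (h0 : 0 < r) (hr : r ≤ v - r₁) :
    halfWidth v r₁ r = 0 := by
  have hv : 0 < v := by linarith
  rw [halfWidth_of_pos hv]
  refine Real.arccos_of_one_le ((one_le_div (by positivity)).2 ?_)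
  nlinarith

lemma halfWidth_eq_pi (hv : 0 ≤ v) (h0 : 0 < r) (hr : r ≤ r₁ - v) :
    halfWidth v r₁ r = Real.pi := by
  rcases hv.eq_or_lt with rfl | hv
  · have : r ≤ r₁ := by linarith
    simp [halfWidth, this]
  · rw [halfWidth_of_pos hv]
    refine Real.arccos_of_le_neg_one ((div_le_iff₀ (by positivity)).2 ?_)
    nlinarith

lemma arcLength_of_halfWidth_eq_zero (h : halfWidth v r₁ r = 0) :
    arcLength v r₁ r = 2 * Real.pi * r := by
  rw [arcLength, h]; ring

lemma arcLength_eq_zero (hv : 0 ≤ v) (h0 : 0 < r) (hr : r ≤ z1 v r₁) : arcLength v r₁ r = 0 := by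
  have : r ≤ r₁ - v := by
    rcases le_max_iff.1 hr with h | h
    · linarith
    · exact h
  rw [arcLength, halfWidth_eq_pi hv h0 this]; ring

lemma z1_nonneg : 0 ≤ z1 v r₁ := le_max_left _ _

/-- Strictness matters: for v = 0 the arc length jumps at r = r₁, which is then `z1`. -/
lemma continuousAt_arcLength (hv : 0 ≤ v) (hr : z1 v r₁ < r) :
    ContinuousAt (arcLength v r₁) r := by
  have h0 : 0 < r := z1_nonneg.trans_lt hr
  rcases hv.eq_or_lt with rfl | hv
  · have h1 : r₁ < r := by
      have := (le_max_right 0 (r₁ - 0)).trans_lt hr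
      linarith
    have : arcLength 0 r₁ =ᶠ[𝓝 r] fun r => 2 * Real.pi * r := by
      filter_upwards [lt_mem_nhds h1] with x hx
      refine arcLength_of_halfWidth_eq_zero ?_
      simp [halfWidth, not_le.2 hx]
    exact ContinuousAt.congr (by fun_prop) this.symm
  · have : arcLength v r₁ = fun r => 2 * r * (Real.pi - Real.arccos ((r ^ 2 + v ^ 2 - r₁ ^ 2) /
        (2 * r * v))) := by
      funext x
      rw [arcLength, halfWidth_of_pos hv, halfAngle]
    rw [this]
    have h2 : ContinuousAt (fun r => (r ^ 2 + v ^ 2 - r₁ ^ 2) / (2 * r * v)) r :=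
      ContinuousAt.div (by fun_prop) (by fun_prop) (by positivity)
    exact ContinuousAt.mul (by fun_prop)
      (continuousAt_const.sub (Real.continuous_arccos.continuousAt.comp h2))

lemma abs_arcLength_le (v r₁ r : ℝ) : |arcLength v r₁ r| ≤ 2 * Real.pi * |r| := by
  have h1 := halfWidth_nonneg v r₁ r
  have h2 := halfWidth_le_pi v r₁ r
  rw [arcLength, abs_mul, abs_mul, abs_of_nonneg (sub_nonneg.2 h2), abs_two]
  nlinarith [abs_nonneg r]

lemma measurable_arcLength_right (v r₁ : ℝ) : Measurable (arcLength v r₁) :=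
  (measurable_arcLength v).comp measurable_prodMk_left

lemma intervalIntegrable_arcLength (v r₁ a b : ℝ) :
    IntervalIntegrable (arcLength v r₁) volume a b := by
  have h : IntervalIntegrable (fun r : ℝ => 2 * Real.pi * |r|) volume a b :=
    Continuous.intervalIntegrable (by fun_prop) _ _
  refine h.mono_fun (measurable_arcLength_right v r₁).aestronglyMeasurable
    (ae_of_all _ fun r => ?_)
  exact (abs_arcLength_le v r₁ r).trans (le_abs_self _)

end HalfWidth

/-- The area of the part of the disk of radius `r` around the origin that is outside the disk of
radius `r₁` around location 1. -/
noncomputable def outerArea (v r₁ r : ℝ) : ℝ := ∫ s in (0 : ℝ)..r, arcLength v r₁ s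

section Area

variable {v r₁ r : ℝ}

lemma outerArea_nonneg (hr : 0 ≤ r) : 0 ≤ outerArea v r₁ r :=
  intervalIntegral.integral_nonneg hr fun _ hs => arcLength_nonneg v r₁ hs.1

lemma continuous_outerArea (v r₁ : ℝ) : Continuous (outerArea v r₁) :=
  intervalIntegral.continuous_primitive (intervalIntegrable_arcLength v r₁) 0

lemma hasDerivAt_outerArea (hv : 0 ≤ v) (hr : z1 v r₁ < r) :
    HasDerivAt (outerArea v r₁) (arcLength v r₁ r) r :=
  intervalIntegral.integral_hasDerivAt_right (intervalIntegrable_arcLength v r₁ 0 r)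
    (measurable_arcLength_right v r₁).stronglyMeasurable.stronglyMeasurableAtFilter
    (continuousAt_arcLength hv hr)

lemma integral_arcLength_full {a b : ℝ} (hab : a ≤ b)
    (h : ∀ s ∈ Ioo a b, halfWidth v r₁ s = 0) :
    ∫ s in a..b, arcLength v r₁ s = Real.pi * b ^ 2 - Real.pi * a ^ 2 := by
  refine intervalIntegral.integral_eq_sub_of_hasDerivAt_of_le hab
    (f := fun s => Real.pi * s ^ 2) (by fun_prop)
    (fun x hx => ?_) (intervalIntegrable_arcLength v r₁ a b)
  rw [arcLength_of_halfWidth_eq_zero (h x hx)]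
  convert! (hasDerivAt_pow 2 x).const_mul Real.pi using 1
  simp; ring

lemma outerArea_z1 (hv : 0 ≤ v) : outerArea v r₁ (z1 v r₁) = 0 := by
  have := intervalIntegral.integral_eq_sub_of_hasDerivAt_of_le (z1_nonneg (v := v) (r₁ := r₁))
    (f := fun _ => (0 : ℝ)) (by fun_prop) (f' := arcLength v r₁)
    (fun x hx => by
      rw [arcLength_eq_zero hv hx.1 hx.2.le]
      exact hasDerivAt_const x (0 : ℝ))
    (intervalIntegrable_arcLength v r₁ _ _)
  simpa [outerArea] using this

/-- With u and w the two arguments of `arccos` and D the radicand, 1 - u² = D/(2vr₁)² and 1 - w² =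
D/(2vr)². All terms with √D in the derivative therefore share a denominator and cancel, leaving 2πr
- 2r arccos w. -/
lemma hasDerivAt_luneArea (hv : 0 < v) (hr₁ : 0 < r₁) (hl : |v - r₁| < r) (hu : r < v + r₁) :
    HasDerivAt (luneArea v r₁) (arcLength v r₁ r) r := by
  have h0 : 0 < r := (abs_nonneg _).trans_lt hl
  obtain ⟨hl1, hl2⟩ := abs_lt.1 hl
  set D := ((r₁ + v) ^ 2 - r ^ 2) * (r ^ 2 - (r₁ - v) ^ 2) with hD
  have hDpos : 0 < D := mul_pos (by nlinarith) (by nlinarith)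
  have hS : 0 < Real.sqrt D := Real.sqrt_pos.2 hDpos
  set u := (r₁ ^ 2 + v ^ 2 - r ^ 2) / (2 * v * r₁) with hu'
  set w := (r ^ 2 + v ^ 2 - r₁ ^ 2) / (2 * v * r) with hw'
  have hu1 : Real.sqrt (1 - u ^ 2) = Real.sqrt D / (2 * v * r₁) := by
    rw [← Real.sqrt_sq (by positivity : 0 ≤ 2 * v * r₁), ← Real.sqrt_div' _ (by positivity)]
    congr 1
    rw [hu', hD]; field_simp; ring
  have hw1 : Real.sqrt (1 - w ^ 2) = Real.sqrt D / (2 * v * r) := by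
    rw [← Real.sqrt_sq (by positivity : 0 ≤ 2 * v * r), ← Real.sqrt_div' _ (by positivity)]
    congr 1
    rw [hw', hD]; field_simp; ring
  -- Positivity of D keeps u and w away from ±1, where `arccos` is not differentiable.
  have hne : ∀ x : ℝ, 0 < Real.sqrt (1 - x ^ 2) → x ≠ -1 ∧ x ≠ 1 := by
    intro x hx
    have := Real.sqrt_pos.1 hx
    constructor <;> rintro rfl <;> norm_num at this
  obtain ⟨hu2, hu3⟩ := hne u (by rw [hu1]; positivity)
  obtain ⟨hw2, hw3⟩ := hne w (by rw [hw1]; positivity)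
  have dsq : HasDerivAt (fun x : ℝ => x ^ 2) (2 * r) r := by
    simpa using hasDerivAt_pow 2 r
  have dD : HasDerivAt (fun x : ℝ => ((r₁ + v) ^ 2 - x ^ 2) * (x ^ 2 - (r₁ - v) ^ 2))
      (4 * r * (r₁ ^ 2 + v ^ 2 - r ^ 2)) r := by
    convert! (dsq.const_sub ((r₁ + v) ^ 2)).mul (dsq.sub_const ((r₁ - v) ^ 2)) using 1
    ring
  have dS := dD.sqrt hDpos.ne'
  have du : HasDerivAt (fun x : ℝ => (r₁ ^ 2 + v ^ 2 - x ^ 2) / (2 * v * r₁))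
      (-(2 * r) / (2 * v * r₁)) r := (dsq.const_sub _).div_const _
  have dw : HasDerivAt (fun x : ℝ => (x ^ 2 + v ^ 2 - r₁ ^ 2) / (2 * v * x))
      ((r ^ 2 - v ^ 2 + r₁ ^ 2) / (2 * v * r ^ 2)) r := by
    convert! ((dsq.add_const (v ^ 2)).sub_const (r₁ ^ 2)).div
      ((hasDerivAt_id r).const_mul (2 * v)) (by simp; constructor <;> positivity) using 1
    simp only [id]
    field_simp
    ring
  have dau := (Real.hasDerivAt_arccos hu2 hu3).comp r du
  have daw := (Real.hasDerivAt_arccos hw2 hw3).comp r dw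
  rw [hu1] at dau
  rw [hw1] at daw
  have := (((dsq.const_mul Real.pi).add (dS.const_mul (1 / 2))).sub (dau.const_mul (r₁ ^ 2))).sub
    (dsq.mul daw)
  convert! this using 1
  rw [arcLength, halfWidth_of_pos hv, halfAngle]
  have e : (r ^ 2 + v ^ 2 - r₁ ^ 2) / (2 * r * v) = w := by rw [hw']; congr 1; ring
  rw [e]
  simp only [Function.comp_apply, ← hw', ← hD]
  field_simp
  ring

/-- The quotient is singular only at 0, where r² times the bounded `arccos` tends to 0. The point 0
is needed: it is the left endpoint |v - r₁| when v = r₁. -/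
lemma continuous_luneArea (v r₁ : ℝ) (hv : 0 < v) : Continuous (luneArea v r₁) := by
  unfold luneArea
  refine Continuous.sub (Continuous.sub (by fun_prop) ?_) ?_
  · exact continuous_const.mul (Real.continuous_arccos.comp (by fun_prop))
  · rw [continuous_iff_continuousAt]
    intro x
    rcases eq_or_ne x 0 with rfl | hx
    · have h : Tendsto (fun r : ℝ => r ^ 2 * Real.arccos ((r ^ 2 + v ^ 2 - r₁ ^ 2) / (2 * v * r)))
          (𝓝 0) (𝓝 0) := by
        refine squeeze_zero_norm (a := fun r : ℝ => r ^ 2 * Real.pi) (fun r => ?_) ?_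
        · rw [norm_mul, Real.norm_of_nonneg (sq_nonneg r), Real.norm_of_nonneg (Real.arccos_nonneg _)]
          exact mul_le_mul_of_nonneg_left (Real.arccos_le_pi _) (sq_nonneg r)
        · have : Continuous fun r : ℝ => r ^ 2 * Real.pi := by fun_prop
          simpa using this.tendsto 0
      simpa [ContinuousAt] using h
    · refine ContinuousAt.mul (by fun_prop) (Real.continuous_arccos.continuousAt.comp ?_)
      exact ContinuousAt.div (by fun_prop) (by fun_prop) (by positivity)

/-- At r = |v - r₁| the circles touch from outside or from inside, the radicand vanishes and the
arccosines are 0 or π. The case v = r₁ is apart because one quotient has denominator zero. -/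
lemma luneArea_left (hv : 0 < v) (hr₁ : 0 < r₁) :
    luneArea v r₁ |v - r₁| = outerArea v r₁ |v - r₁| := by
  have e1 : ((r₁ + v) ^ 2 - |v - r₁| ^ 2) * (|v - r₁| ^ 2 - (r₁ - v) ^ 2) = 0 := by
    rw [sq_abs]; ring
  have e2 : (r₁ ^ 2 + v ^ 2 - |v - r₁| ^ 2) / (2 * v * r₁) = 1 := by
    rw [sq_abs]; field_simp; ring
  rw [luneArea, e1, e2]
  rcases le_total r₁ v with h | h
  · rw [abs_of_nonneg (sub_nonneg.2 h), outerArea, integral_arcLength_full (sub_nonneg.2 h)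
      fun s hs => halfWidth_eq_zero_of_le hr₁ hs.1 hs.2.le]
    rcases h.eq_or_lt with rfl | h
    · simp
    · have h' : 0 < v - r₁ := sub_pos.2 h
      have e3 : ((v - r₁) ^ 2 + v ^ 2 - r₁ ^ 2) / (2 * v * (v - r₁)) = 1 := by
        rw [div_eq_one_iff_eq (by positivity)]; ring
      rw [e3]; simp
  · have e : |v - r₁| = r₁ - v := by rw [abs_of_nonpos (sub_nonpos.2 h)]; ring
    have ez : z1 v r₁ = r₁ - v := max_eq_right (sub_nonneg.2 h)
    rw [e, ← ez, outerArea_z1 hv.le, ez]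
    rcases h.eq_or_lt with rfl | h
    · simp
    · have h' : 0 < r₁ - v := sub_pos.2 h
      have e3 : ((r₁ - v) ^ 2 + v ^ 2 - r₁ ^ 2) / (2 * v * (r₁ - v)) = -1 := by
        rw [div_eq_iff (by positivity)]; ring
      rw [e3]; simp; ring

lemma luneArea_right (hv : 0 < v) (hr₁ : 0 < r₁) :
    luneArea v r₁ (v + r₁) = Real.pi * ((v + r₁) ^ 2 - r₁ ^ 2) := by
  have e1 : ((r₁ + v) ^ 2 - (v + r₁) ^ 2) * ((v + r₁) ^ 2 - (r₁ - v) ^ 2) = 0 := by ring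
  have e2 : (r₁ ^ 2 + v ^ 2 - (v + r₁) ^ 2) / (2 * v * r₁) = -1 := by
    rw [div_eq_iff (by positivity)]; ring
  have e3 : ((v + r₁) ^ 2 + v ^ 2 - r₁ ^ 2) / (2 * v * (v + r₁)) = 1 := by
    rw [div_eq_one_iff_eq (by positivity)]; ring
  rw [luneArea, e1, e2, e3]
  simp; ring

/-- Both sides have derivative `arcLength` inside the interval and the same value at its left end.
-/
lemma outerArea_eq_luneArea (hv : 0 < v) (hr₁ : 0 < r₁) (hl : |v - r₁| ≤ r) (hu : r ≤ v + r₁) :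
    outerArea v r₁ r = luneArea v r₁ r := by
  have h := intervalIntegral.integral_eq_sub_of_hasDerivAt_of_le hl
    (f := luneArea v r₁) (f' := arcLength v r₁) (continuous_luneArea v r₁ hv).continuousOn
    (fun x hx => hasDerivAt_luneArea hv hr₁ hx.1 (hx.2.trans_le hu))
    (intervalIntegrable_arcLength v r₁ _ _)
  have h2 := intervalIntegral.integral_add_adjacent_intervals
    (intervalIntegrable_arcLength v r₁ 0 |v - r₁|) (intervalIntegrable_arcLength v r₁ |v - r₁| r)
  have h3 := luneArea_left hv hr₁
  unfold outerArea at *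
  linarith

/-- The area of `𝒞₂ \ 𝒞₁` is the integral of the lengths of arcs. -/
lemma exclArea_eq (hv : 0 ≤ v) (hr₁ : 0 < r₁) (hr : z1 v r₁ < r) :
    exclArea v r₁ r = outerArea v r₁ r := by
  have h0 : 0 < r := z1_nonneg.trans_lt hr
  have hr' : r₁ - v < r := (le_max_right _ _).trans_lt hr
  have hsplit : ∀ c, outerArea v r₁ r = outerArea v r₁ c + ∫ s in c..r, arcLength v r₁ s := fun c =>
    (intervalIntegral.integral_add_adjacent_intervals (intervalIntegrable_arcLength v r₁ 0 c)
      (intervalIntegrable_arcLength v r₁ c r)).symm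
  unfold exclArea
  split_ifs with h1 h2
  · have h3 : r ≤ v - r₁ := by
      rcases le_abs.1 h1 with h | h <;> linarith
    rw [outerArea, integral_arcLength_full h0.le fun s hs =>
      halfWidth_eq_zero_of_le hr₁ hs.1 (hs.2.le.trans h3)]
    ring
  · have hv' : 0 < v := by
      rcases hv.eq_or_lt with rfl | h
      · linarith
      · exact h
    exact (outerArea_eq_luneArea hv' hr₁ (not_le.1 h1).le h2.le).symm
  · have h2 := not_lt.1 h2
    rw [hsplit (v + r₁), integral_arcLength_full h2
      fun s hs => halfWidth_eq_zero_of_lt hv hr₁.le hs.1]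
    rcases hv.eq_or_lt with rfl | hv'
    · have : z1 0 r₁ = 0 + r₁ := by simp [z1, hr₁.le]
      rw [← this, outerArea_z1 le_rfl, this]; ring
    · rw [outerArea_eq_luneArea hv' hr₁ (by rw [abs_le]; constructor <;> linarith) le_rfl,
        luneArea_right hv' hr₁]
      ring

/-- Replacing the piecewise area by the primitive `outerArea` near r gives the derivative everywhere
above `z1`, also at the points where the case distinction switches. -/
lemma fR2_eq {lam p : ℝ} (hv : 0 ≤ v) (hr₁ : 0 < r₁) (hr : z1 v r₁ < r) :
    fR2 lam p v r₁ r = p * lam * arcLength v r₁ r * Real.exp (-(p * lam * outerArea v r₁ r)) := by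
  have h1 : (fun x => 1 - Real.exp (-(p * lam * exclArea v r₁ x))) =ᶠ[𝓝 r]
      fun x => 1 - Real.exp (-(p * lam * outerArea v r₁ x)) := by
    filter_upwards [lt_mem_nhds hr] with x hx
    rw [exclArea_eq hv hr₁ hx]
  rw [fR2, h1.deriv_eq]
  have h2 := ((((hasDerivAt_outerArea hv hr).const_mul (p * lam)).neg).exp).const_sub 1
  refine h2.deriv.trans ?_
  simp only [Pi.neg_apply]
  ring

lemma fR2_nonneg {lam p : ℝ} (hlam : 0 ≤ lam) (hp : 0 ≤ p) (hv : 0 ≤ v) (hr₁ : 0 < r₁)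
    (hr : z1 v r₁ < r) : 0 ≤ fR2 lam p v r₁ r := by
  rw [fR2_eq hv hr₁ hr]
  have := arcLength_nonneg v r₁ (z1_nonneg.trans_lt hr).le
  positivity

/-- The density has an explicit primitive, and the excluded area grows from 0 at `z1` to ∞. -/
lemma lintegral_fR2 {lam p : ℝ} (hlam : 0 < lam) (hp : 0 < p) (hv : 0 ≤ v) (hr₁ : 0 < r₁) :
    ∫⁻ r in Ioi (z1 v r₁), ENNReal.ofReal (fR2 lam p v r₁ r) = 1 := by
  have hlim : Tendsto (fun r => -Real.exp (-(p * lam * outerArea v r₁ r))) atTop (𝓝 0) := by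
    have h1 : Tendsto (fun r : ℝ => p * lam * (Real.pi * (r ^ 2 - r₁ ^ 2))) atTop atTop := by
      have : Tendsto (fun r : ℝ => r ^ 2 - r₁ ^ 2) atTop atTop :=
        tendsto_atTop_add_const_right _ _ (tendsto_pow_atTop two_ne_zero)
      exact (this.const_mul_atTop Real.pi_pos).const_mul_atTop (by positivity)
    have h2 : (fun r : ℝ => p * lam * (Real.pi * (r ^ 2 - r₁ ^ 2))) =ᶠ[atTop]
        fun r => p * lam * outerArea v r₁ r := by
      filter_upwards [eventually_gt_atTop (v + r₁)] with r hr
      have hz : z1 v r₁ < r := max_lt (by linarith) (by linarith)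
      have ha : |v - r₁| < r := abs_lt.2 ⟨by linarith, by linarith⟩
      rw [← exclArea_eq hv hr₁ hz, exclArea, if_neg (not_le.2 ha), if_neg (not_lt.2 hr.le)]
    simpa using (Real.tendsto_exp_neg_atTop_nhds_zero.comp (h1.congr' h2)).neg
  rw [lintegral_Ioi_of_hasDerivAt (g := fun r => -Real.exp (-(p * lam * outerArea v r₁ r)))
    ?_ ?_ (fun r hr => fR2_nonneg hlam.le hp.le hv hr₁ hr) hlim]
  · simp [outerArea_z1 hv]
  · have := continuous_outerArea v r₁
    exact Continuous.continuousWithinAt (by fun_prop)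
  · intro r hr
    rw [fR2_eq hv hr₁ hr]
    have h2 := ((((hasDerivAt_outerArea hv hr).const_mul (p * lam)).neg).exp).neg
    convert! h2 using 1
    simp only [Pi.neg_apply]
    ring

end Area

end D2D

/-! ### Closed forms of the Laplace transforms and of the density -/

namespace D2D

section Laplace

variable {v r₁ r α s : ℝ}

lemma one_add_rpow_div_pos (hs : 0 < s) (hr : 0 ≤ r) : 0 < 1 + r ^ α / s := by
  have := Real.rpow_nonneg hr α
  positivity

lemma one_sub_linkLap {q : ℝ} (hs : 0 < s) (hr : 0 < r) :
    1 - linkLap q α s r = q / (1 + r ^ α / s) := by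
  have h := Real.rpow_pos_of_pos hr α
  rw [linkLap, Real.rpow_neg hr.le]
  field_simp
  ring

lemma lap1_eq_linkLap (q α s θ : ℝ) (hv : 0 ≤ v) (hr₁ : 0 ≤ r₁) :
    lap1 q α v s r₁ θ = linkLap q α s (dist2 v r₁ θ) := by
  have h : 0 ≤ r₁ ^ 2 + v ^ 2 - 2 * r₁ * v * Real.cos θ := by
    nlinarith [Real.cos_le_one θ, mul_nonneg hr₁ hv, sq_nonneg (r₁ - v)]
  rw [lap1, linkLap, dist2, Real.sqrt_eq_rpow, ← Real.rpow_mul h]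
  congr 5
  ring

lemma measurable_kernel (α s : ℝ) : Measurable fun r : ℝ => r / (1 + r ^ α / s) := by fun_prop

/-- The kernel is at most 1 on (0, 1] and at most s r^{1-α} beyond; the latter is integrable because
α > 2. -/
lemma integrableOn_kernel (hα : 2 < α) (hs : 0 < s) :
    IntegrableOn (fun r => r / (1 + r ^ α / s)) (Ioi 0) := by
  rw [← Ioc_union_Ioi_eq_Ioi (zero_le_one (α := ℝ))]
  have hpos : ∀ r : ℝ, 0 < r → 0 ≤ r / (1 + r ^ α / s) := fun r hr =>
    div_nonneg hr.le (one_add_rpow_div_pos hs hr.le).le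
  refine IntegrableOn.union ?_ ?_
  · refine Measure.integrableOn_of_bounded (M := 1) (by simp)
      (measurable_kernel α s).aestronglyMeasurable ?_
    refine (ae_restrict_iff' measurableSet_Ioc).2 (ae_of_all _ fun r hr => ?_)
    rw [Real.norm_of_nonneg (hpos r hr.1), div_le_one (one_add_rpow_div_pos hs hr.1.le)]
    have := div_nonneg (Real.rpow_nonneg hr.1.le α) hs.le
    linarith [hr.2]
  · have h := (integrableOn_Ioi_rpow_of_lt (a := 1 - α) (by linarith) one_pos).const_mul s
    refine h.mono' (measurable_kernel α s).aestronglyMeasurable ?_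
    refine (ae_restrict_iff' measurableSet_Ioi).2 (ae_of_all _ fun r hr => ?_)
    have hr0 : (0 : ℝ) < r := one_pos.trans hr
    have hp := Real.rpow_pos_of_pos hr0 α
    rw [Real.norm_of_nonneg (hpos r hr0), Real.rpow_sub hr0, Real.rpow_one,
      div_le_iff₀ (one_add_rpow_div_pos hs hr0.le)]
    have : s * (r / r ^ α) * (1 + r ^ α / s) = r + s * (r / r ^ α) := by
      field_simp
      ring
    rw [this]
    have : 0 ≤ s * (r / r ^ α) := by positivity
    linarith

lemma integrableOn_kernel_halfWidth (hα : 2 < α) (hs : 0 < s) (v r₁ : ℝ) :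
    IntegrableOn (fun r => r / (1 + r ^ α / s) * halfWidth v r₁ r) (Ioi 0) := by
  refine (integrableOn_kernel hα hs).mul_bdd (c := Real.pi)
    ((measurable_halfWidth v).comp measurable_prodMk_left).aestronglyMeasurable ?_
  refine ae_of_all _ fun r => ?_
  rw [Real.norm_of_nonneg (halfWidth_nonneg v r₁ r)]
  exact halfWidth_le_pi v r₁ r

lemma integrableOn_pi_kernel {a : ℝ} (hα : 2 < α) (hs : 0 < s) (ha : 0 ≤ a) :
    IntegrableOn (fun r => Real.pi * r / (1 + r ^ α / s)) (Ioi a) := by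
  simp_rw [mul_div_assoc]
  exact ((integrableOn_kernel hα hs).mono_set (Ioi_subset_Ioi ha)).const_mul _

lemma kernel_sub_nonneg (hs : 0 < s) (hr : 0 ≤ r) :
    0 ≤ Real.pi * r / (1 + r ^ α / s) - r / (1 + r ^ α / s) * halfWidth v r₁ r := by
  have := one_add_rpow_div_pos (α := α) hs hr
  have h2 := sub_nonneg.2 (halfWidth_le_pi v r₁ r)
  have e : Real.pi * r / (1 + r ^ α / s) - r / (1 + r ^ α / s) * halfWidth v r₁ r =
      r / (1 + r ^ α / s) * (Real.pi - halfWidth v r₁ r) := by ring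
  rw [e]
  positivity

lemma integral_kernel_sub_nonneg {a : ℝ} (hα : 2 < α) (hs : 0 < s) (ha : 0 ≤ a) :
    0 ≤ (∫ r in Ioi a, Real.pi * r / (1 + r ^ α / s)) -
      ∫ r in Ioi a, r / (1 + r ^ α / s) * halfWidth v r₁ r := by
  rw [← integral_sub (integrableOn_pi_kernel hα hs ha)
    ((integrableOn_kernel_halfWidth hα hs v r₁).mono_set (Ioi_subset_Ioi ha))]
  exact setIntegral_nonneg measurableSet_Ioi fun r hr => kernel_sub_nonneg hs (ha.trans (le_of_lt hr))

/-- The arc is the full circle minus the part inside the disk. Both parts are integrable on their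
own, so the nonnegative integral becomes a difference of real ones. -/
lemma lintegral_linkLap_arcLength {q a : ℝ} (hq : 0 ≤ q) (hα : 2 < α) (hs : 0 < s) (ha : 0 ≤ a) :
    ∫⁻ r in Ioi a, ENNReal.ofReal (1 - linkLap q α s r) * ENNReal.ofReal (arcLength v r₁ r) =
      ENNReal.ofReal (2 * q * ((∫ r in Ioi a, Real.pi * r / (1 + r ^ α / s)) -
        ∫ r in Ioi a, r / (1 + r ^ α / s) * halfWidth v r₁ r)) := by
  have hsub : Ioi a ⊆ Ioi 0 := Ioi_subset_Ioi ha
  have i1 := integrableOn_pi_kernel hα hs ha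
  have i2 := (integrableOn_kernel_halfWidth hα hs v r₁).mono_set hsub
  have i3 : IntegrableOn (fun r => 2 * q * (Real.pi * r / (1 + r ^ α / s) -
      r / (1 + r ^ α / s) * halfWidth v r₁ r)) (Ioi a) := (i1.sub i2).const_mul (2 * q)
  rw [← integral_sub i1 i2, ← integral_const_mul, ofReal_integral_eq_lintegral_ofReal i3]
  · refine setLIntegral_congr_fun measurableSet_Ioi fun r hr => ?_
    have hr0 : 0 < r := hsub hr
    have := one_add_rpow_div_pos (α := α) hs hr0.le
    rw [one_sub_linkLap hs hr0, ← ENNReal.ofReal_mul (by positivity)]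
    congr 1
    simp only [arcLength]
    ring
  · refine (ae_restrict_iff' measurableSet_Ioi).2 (ae_of_all _ fun r hr => ?_)
    exact mul_nonneg (by positivity) (kernel_sub_nonneg hs (le_of_lt (hsub hr)))

/-- The half-width vanishes beyond v + r₁, where the circle has left the disk, and on (a, b] by
assumption; only [b, v + r₁] remains. -/
lemma setIntegral_kernel_halfWidth {a b : ℝ} (hv : 0 ≤ v) (hr₁ : 0 < r₁)
    (hab : a ≤ b) (hb : b ≤ v + r₁) (hz : ∀ r, a < r → r ≤ b → halfWidth v r₁ r = 0) :
    ∫ r in Ioi a, r / (1 + r ^ α / s) * halfWidth v r₁ r =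
      ∫ r in b..(v + r₁), r / (1 + r ^ α / s) * halfWidth v r₁ r := by
  rw [intervalIntegral.integral_of_le hb]
  refine (setIntegral_eq_of_subset_of_forall_sdiff_eq_zero measurableSet_Ioi
    (fun x hx => hab.trans_lt hx.1) fun x hx => ?_)
  have h0 : halfWidth v r₁ x = 0 := by
    rcases le_or_gt x b with h | h
    · exact hz x hx.1 h
    · refine halfWidth_eq_zero_of_lt hv hr₁.le ?_
      by_contra h'
      exact hx.2 ⟨h, not_lt.1 h'⟩
  rw [h0, mul_zero]

lemma integral_kernel_halfWidth_eq_halfAngle {b c k : ℝ} (hv : 0 < v) :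
    k * (∫ r in b..c, r / (1 + r ^ α / s) * halfWidth v r₁ r) =
      ∫ r in b..c, k * halfAngle v r₁ r * r / (1 + r ^ α / s) := by
  rw [← intervalIntegral.integral_const_mul]
  congr 1
  funext r
  rw [halfWidth_of_pos hv]
  ring

theorem extLap2_eq {lam : ℝ} (p q : unitInterval) (hlam : 0 ≤ lam) (hα : 2 < α) (hs : 0 < s)
    (hv : 0 ≤ v) (hr₁ : 0 < r₁) :
    extLap2 lam p q α v s r₁ = ENNReal.ofReal (lap2 lam p q α v s r₁) := by
  have hp1 : (0 : ℝ) ≤ 1 - p := sub_nonneg.2 p.2.2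
  have hz0 := z1_nonneg (v := v) (r₁ := r₁)
  have h1 : ∫⁻ r in Ioi (0 : ℝ), ENNReal.ofReal (1 - linkLap q α s r) *
      ENNReal.ofReal (arcLength v r₁ r) = ∫⁻ r in Ioi (z1 v r₁),
      ENNReal.ofReal (1 - linkLap q α s r) * ENNReal.ofReal (arcLength v r₁ r) := by
    rw [← Ioc_union_Ioi_eq_Ioi hz0, lintegral_union measurableSet_Ioi (Ioc_disjoint_Ioi le_rfl),
      setLIntegral_congr_fun (g := fun _ => 0) measurableSet_Ioc, lintegral_zero, zero_add]
    intro r hr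
    simp [arcLength_eq_zero hv hr.1 hr.2]
  have h2 : ∫ r in Ioi (z1 v r₁), r / (1 + r ^ α / s) * halfWidth v r₁ r =
      ∫ r in |v - r₁|..(v + r₁), halfAngle v r₁ r * r / (1 + r ^ α / s) := by
    have hb : |v - r₁| ≤ v + r₁ := abs_le.2 ⟨by linarith, by linarith⟩
    have hab : z1 v r₁ ≤ |v - r₁| := max_le (abs_nonneg _) (by
      rw [abs_sub_comm]; exact le_abs_self _)
    rw [setIntegral_kernel_halfWidth hv hr₁ hab hb]
    -- For v = 0 the interval from |v - r₁| to v + r₁ is a point, so the meaningless value of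
    -- `halfAngle` does no harm.
    · rcases hv.eq_or_lt with rfl | hv'
      · have : |0 - r₁| = 0 + r₁ := by simp [abs_of_pos hr₁]
        rw [this]; simp
      · have := integral_kernel_halfWidth_eq_halfAngle (r₁ := r₁) (α := α) (s := s) (k := 1)
          (b := |v - r₁|) (c := v + r₁) hv'
        simpa using this
    · intro r hr hr'
      have h3 : r₁ - v < r := (le_max_right _ _).trans_lt hr
      refine halfWidth_eq_zero_of_le hr₁ (hz0.trans_lt hr) ?_
      rcases le_abs.1 hr' with h | h <;> linarith
  unfold extLap2
  rw [h1, lintegral_linkLap_arcLength q.2.1 hα hs hz0, h2, ← ENNReal.ofReal_mul (by positivity)]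
  have hle : 0 ≤ lam * (1 - p) * (2 * q * ((∫ r in Ioi (z1 v r₁), Real.pi * r / (1 + r ^ α / s)) -
      ∫ r in |v - r₁|..(v + r₁), halfAngle v r₁ r * r / (1 + r ^ α / s))) := by
    rw [← h2]
    exact mul_nonneg (mul_nonneg hlam hp1) (mul_nonneg (mul_nonneg zero_le_two q.2.1)
      (integral_kernel_sub_nonneg hα hs hz0))
  rw [expNeg_ofReal hle, lap2]
  congr 2
  ring

/-- The three cases say where circles of radius beyond r meet the disk: from v - r₁ on, immediately,
or never. The case v = 0 falls under the last one, since then r > r₁. -/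
lemma Bint_eq (hv : 0 ≤ v) (hr₁ : 0 < r₁) (hr : z1 v r₁ < r) :
    2 * (∫ t in Ioi r, t / (1 + t ^ α / s) * halfWidth v r₁ t) = Bint α v s r₁ r := by
  have h0 : 0 < r := z1_nonneg.trans_lt hr
  have hr' : r₁ - v < r := (le_max_right _ _).trans_lt hr
  unfold Bint
  split_ifs with h1 h2
  · have hv' : 0 < v := by linarith
    rw [setIntegral_kernel_halfWidth (b := v - r₁) hv hr₁ (by linarith) (by linarith)
      (fun t ht ht' => halfWidth_eq_zero_of_le hr₁ (h0.trans ht) ht'),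
      integral_kernel_halfWidth_eq_halfAngle hv']
  · have hv' : 0 < v := by
      rcases hv.eq_or_lt with rfl | h
      · linarith
      · exact h
    rw [setIntegral_kernel_halfWidth (b := r) hv hr₁ le_rfl (by linarith)
      (fun t ht ht' => absurd ht (not_lt.2 ht')), integral_kernel_halfWidth_eq_halfAngle hv']
  · rw [setIntegral_eq_zero_of_forall_eq_zero, mul_zero]
    intro t ht
    have ht : r < t := ht
    rw [halfWidth_eq_zero_of_lt hv hr₁.le (by linarith), mul_zero]

theorem extLap3_eq {lam : ℝ} (p q : unitInterval) (hlam : 0 ≤ lam) (hα : 2 < α) (hs : 0 < s)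
    (hv : 0 ≤ v) (hr₁ : 0 < r₁) (hr : z1 v r₁ < r) :
    extLap3 lam p q α v s r₁ r = ENNReal.ofReal (lap3 lam p q α v s r₁ r) := by
  have h0 : 0 < r := z1_nonneg.trans_lt hr
  have hp0 : (0 : ℝ) ≤ p := p.2.1
  unfold extLap3
  rw [lintegral_linkLap_arcLength q.2.1 hα hs h0.le, ← ENNReal.ofReal_mul (by positivity),
    expNeg_ofReal, lap3, ← Real.exp_add, ← Bint_eq hv hr₁ hr]
  · congr 2
    have e : ∫ t in Ioi r, 2 * Real.pi * t / (1 + t ^ α / s) =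
        2 * ∫ t in Ioi r, Real.pi * t / (1 + t ^ α / s) := by
      rw [← integral_const_mul]; congr 1; funext t; ring
    rw [e]
    ring
  · exact mul_nonneg (mul_nonneg hlam hp0) (mul_nonneg (mul_nonneg zero_le_two q.2.1)
      (integral_kernel_sub_nonneg hα hs h0.le))

/-- The integral of arc lengths in the void probability is the excluded area, and 2λr₁ is 2πλr₁
times the uniform density 1/π. -/
theorem extDensity_eq {lam : ℝ} (p : unitInterval) (hlam : 0 ≤ lam) (hv : 0 ≤ v) (hr₁ : 0 < r₁)
    (hr : z1 v r₁ < r) (θ : ℝ) :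
    extDensity lam p v r₁ r = ENNReal.ofReal (fR2 lam p v r₁ r * fR1 lam r₁ * fTheta θ) := by
  have h0 : 0 < r := z1_nonneg.trans_lt hr
  have hp0 : (0 : ℝ) ≤ p := p.2.1
  have ha := arcLength_nonneg v r₁ h0.le
  have hvoid : extVoid lam p v r₁ r =
      ENNReal.ofReal (Real.exp (-(p * lam * outerArea v r₁ r))) := by
    have h1 : ∫⁻ t in Ioc 0 r, ENNReal.ofReal (arcLength v r₁ t) =
        ENNReal.ofReal (outerArea v r₁ r) := by
      rw [outerArea, intervalIntegral.integral_of_le h0.le, ofReal_integral_eq_lintegral_ofReal]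
      · exact (intervalIntegrable_iff_integrableOn_Ioc_of_le h0.le).1
          (intervalIntegrable_arcLength v r₁ 0 r)
      · exact (ae_restrict_iff' measurableSet_Ioc).2
          (ae_of_all _ fun t ht => arcLength_nonneg v r₁ ht.1.le)
    have h2 := outerArea_nonneg (v := v) (r₁ := r₁) h0.le
    rw [extVoid, h1, ← ENNReal.ofReal_mul (by positivity), expNeg_ofReal (by positivity)]
    congr 3
    ring
  have hpi := Real.pi_pos
  rw [extDensity, hvoid, expNeg_ofReal (by positivity), ← ENNReal.ofReal_mul (by positivity),
    ← ENNReal.ofReal_mul (by positivity), ← ENNReal.ofReal_mul (by positivity), fR2_eq hv hr₁ hr,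
    fR1, fTheta]
  congr 1
  field_simp

lemma extDensity_eq_zero {lam p : ℝ} (hv : 0 ≤ v) (h0 : 0 < r) (hr : r ≤ z1 v r₁) :
    extDensity lam p v r₁ r = 0 := by
  simp [extDensity, arcLength_eq_zero hv h0 hr]

end Laplace

end D2D

/-! ### Finiteness of the interference -/

namespace D2D

open Device

lemma lintegral_ofReal_expMeasure_lt_top :
    ∫⁻ x, ENNReal.ofReal x ∂(expMeasure 1) < ∞ := by
  rw [lintegral_expMeasure (by fun_prop)]
  have h := Real.GammaIntegral_convergent (s := 2) two_pos
  have h2 := h.2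
  rw [hasFiniteIntegral_iff_enorm] at h2
  refine lt_of_eq_of_lt (setLIntegral_congr_fun measurableSet_Ioi fun x hx => ?_) h2
  have hx : 0 < x := hx
  rw [← ENNReal.ofReal_mul (Real.exp_nonneg _), Real.enorm_eq_ofReal (by positivity)]
  congr 1
  norm_num

lemma lintegral_linkLaw_interf_le (q : unitInterval) (α : ℝ) (w : Plane) (b : Bool) :
    ∫⁻ m, interf α (w, b, m) ∂(linkLaw q) ≤
      ENNReal.ofReal (‖w‖ ^ (-α)) * ∫⁻ x, ENNReal.ofReal x ∂(expMeasure 1) := by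
  have hk := Real.rpow_nonneg (norm_nonneg w) (-α)
  have hm : Measurable fun m : ℝ × Bool => ENNReal.ofReal (‖w‖ ^ (-α)) * ENNReal.ofReal m.1 := by
    fun_prop
  calc ∫⁻ m, interf α (w, b, m) ∂(linkLaw q)
      ≤ ∫⁻ m, ENNReal.ofReal (‖w‖ ^ (-α)) * ENNReal.ofReal m.1 ∂(linkLaw q) := by
        refine lintegral_mono fun m => ?_
        simp only [interf]
        split_ifs
        · rw [← ENNReal.ofReal_mul hk, mul_comm]
        · exact zero_le
    _ = _ := by
        unfold linkLaw
        rw [lintegral_prod _ hm.aemeasurable, ← lintegral_const_mul _ (by fun_prop)]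
        refine lintegral_congr fun x => ?_
        simp only [lintegral_const, measure_univ, mul_one]

lemma lintegral_norm_rpow_lt_top {α : ℝ} (hα : 2 < α) :
    ∫⁻ w in {w : Plane | 1 < ‖w‖}, ENNReal.ofReal (‖w‖ ^ (-α)) < ∞ := by
  have h : Integrable (fun w : Plane => (1 + ‖w‖) ^ (-α)) :=
    integrable_one_add_norm (by simpa using hα)
  have h2 : ∫⁻ w : Plane, ENNReal.ofReal (2 ^ α * (1 + ‖w‖) ^ (-α)) < ∞ :=
    (h.const_mul (2 ^ α)).lintegral_lt_top
  refine lt_of_le_of_lt ?_ h2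
  refine (setLIntegral_mono' (measurableSet_lt measurable_const measurable_norm) fun w hw => ?_).trans
    (setLIntegral_le_lintegral _ _)
  have hw : 1 < ‖w‖ := hw
  refine ENNReal.ofReal_le_ofReal ?_
  have h0 : 0 < ‖w‖ := by linarith
  rw [Real.rpow_neg h0.le, Real.rpow_neg (by positivity), ← div_eq_mul_inv,
    le_div_iff₀ (by positivity), inv_mul_le_iff₀ (by positivity), ← Real.mul_rpow h0.le zero_le_two]
  exact Real.rpow_le_rpow (by positivity) (by linarith) (by linarith)

namespace Network

variable {Ω : Type*} [MeasurableSpace Ω] {μ : Measure Ω} [IsProbabilityMeasure μ] {lam : ℝ}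
  {p q : unitInterval} (N : Network μ lam p q)

/-- Mecke's formula for a function of the point alone gives the mean, which is finite because α > 2.
Devices within distance 1 are treated separately: near the origin ‖w‖^{-α} is not integrable. -/
lemma ae_tsum_far_lt_top {α : ℝ} (hα : 2 < α) :
    ∀ᵐ ω ∂μ, ∑' n, {w : Device | 1 < ‖w.1‖}.indicator (Device.interf α) (N.dev n ω) < ∞ := by
  classical
  have hS : MeasurableSet {w : Device | 1 < ‖w.1‖} :=
    measurableSet_lt measurable_const (by fun_prop)
  have hf := (measurable_interf α).indicator hS
  have h := N.hasPoissonLaplace.mecke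
    (G := fun z => {w : Device | 1 < ‖w.1‖}.indicator (Device.interf α) z.1)
    (hf.comp measurable_fst)
  simp only [lintegral_const, measure_univ, mul_one] at h
  have hm : Measurable fun ω => ∑' n, {w : Device | 1 < ‖w.1‖}.indicator (Device.interf α)
      (N.dev n ω) := Measurable.tsum fun n => hf.comp (N.measurable_dev n)
  refine ae_lt_top hm ?_
  rw [h, lintegral_deviceIntensity' lam p q hf]
  refine ENNReal.mul_ne_top ENNReal.ofReal_ne_top (ne_top_of_le_ne_top (b :=
    (∫⁻ w in {w : Plane | 1 < ‖w‖}, ENNReal.ofReal (‖w‖ ^ (-α))) *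
      ∫⁻ x, ENNReal.ofReal x ∂(expMeasure 1)) ?_ ?_)
  · exact ENNReal.mul_ne_top (lintegral_norm_rpow_lt_top hα).ne
      lintegral_ofReal_expMeasure_lt_top.ne
  · have hP : MeasurableSet {w : Plane | 1 < ‖w‖} := measurableSet_lt measurable_const measurable_norm
    rw [← lintegral_mul_const _ (by fun_prop), ← lintegral_indicator hP]
    refine lintegral_mono fun w => ?_
    by_cases hw : 1 < ‖w‖
    · have e : ∀ b m, {w : Device | 1 < ‖w.1‖}.indicator (Device.interf α) (w, b, m) =
          Device.interf α (w, b, m) := by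
        intro b m
        have h : ((w, b, m) : Device) ∈ {w : Device | 1 < ‖w.1‖} := hw
        rw [indicator_of_mem h]
      rw [indicator_of_mem (by exact hw)]
      simp only [e]
      refine (add_le_add (mul_le_mul_right (lintegral_linkLaw_interf_le q α w true) _)
        (mul_le_mul_right (lintegral_linkLaw_interf_le q α w false) _)).trans_eq ?_
      rw [← add_mul, ← ENNReal.ofReal_add p.2.1 (sub_nonneg.2 p.2.2)]
      simp
    · have e : ∀ b m, {w : Device | 1 < ‖w.1‖}.indicator (Device.interf α) (w, b, m) = 0 :=
        by
        intro b m
        have h : ((w, b, m) : Device) ∉ {w : Device | 1 < ‖w.1‖} := hw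
        rw [indicator_of_notMem h]
      simp [e]

/-- The total interference is almost surely finite. -/
theorem ae_tsum_interf_lt_top {α : ℝ} (hα : 2 < α) :
    ∀ᵐ ω ∂μ, ∑' n, N.interf α ω n < ∞ := by
  classical
  have hS : MeasurableSet {w : Device | ‖w.1‖ ≤ 1} :=
    measurableSet_le (by fun_prop) measurable_const
  have hL : deviceIntensity lam p q {w : Device | ‖w.1‖ ≤ 1} ≠ ∞ := by
    have h : {w : Device | ‖w.1‖ ≤ 1} = Metric.closedBall (0 : Plane) 1 ×ˢ univ := by
      ext w; simp
    rw [h, deviceIntensity, Measure.prod_prod, measure_univ, mul_one, planeIntensity,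
      Measure.smul_apply, smul_eq_mul]
    exact ENNReal.mul_ne_top ENNReal.ofReal_ne_top measure_closedBall_lt_top.ne
  have hcount : ∀ᵐ ω ∂μ, N.config ω {w : Device | ‖w.1‖ ≤ 1} < ∞ := by
    refine ae_lt_top ((Measure.measurable_coe hS).comp N.measurable_config) ?_
    have := N.hasPoissonLaplace.intensity hS hL
    exact this.trans_ne hL
  filter_upwards [hcount, N.ae_tsum_far_lt_top hα] with ω h1 h2
  -- Only finitely many devices lie in the unit disk, and each has finite power.
  have hfin : {n | N.dev n ω ∈ {w : Device | ‖w.1‖ ≤ 1}}.Finite := by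
    rw [config, pointMeasure_apply _ _ hS] at h1
    refine Set.Finite.subset (ENNReal.finite_const_le_of_tsum_ne_top h1.ne one_ne_zero)
      fun n hn => ?_
    have hn : N.dev n ω ∈ {w : Device | ‖w.1‖ ≤ 1} := hn
    simp only [mem_ofPred_eq]
    rw [indicator_of_mem hn]
    rfl
  have hle : ∀ n, N.interf α ω n ≤ (hfin.toFinset : Set ℕ).indicator (N.interf α ω) n +
      {w : Device | 1 < ‖w.1‖}.indicator (Device.interf α) (N.dev n ω) := by
    intro n
    by_cases hn : ‖(N.dev n ω).1‖ ≤ 1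
    · have : n ∈ (hfin.toFinset : Set ℕ) := by simpa using hn
      rw [indicator_of_mem this]
      exact le_self_add
    · have : N.dev n ω ∈ {w : Device | 1 < ‖w.1‖} := not_le.1 hn
      rw [indicator_of_mem this]
      exact le_add_self
  refine (ENNReal.tsum_le_tsum hle).trans_lt ?_
  rw [ENNReal.tsum_add, ← tsum_subtype, Finset.tsum_subtype']
  refine ENNReal.add_lt_top.2 ⟨ENNReal.sum_lt_top.2 fun n _ => ?_, h2⟩
  rw [interf]
  split_ifs
  · exact ENNReal.ofReal_lt_top
  · exact ENNReal.zero_lt_top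

theorem ae_interference_lt_top {α : ℝ} (hα : 2 < α) (v : ℝ) :
    ∀ᵐ ω ∂μ, N.I1 α v ω < ∞ ∧ N.I2 α v ω < ∞ ∧ N.I3 α v ω < ∞ := by
  filter_upwards [N.ae_tsum_interf_lt_top hα] with ω h
  refine ⟨(ENNReal.le_tsum (N.server1 v ω)).trans_lt h, (ENNReal.tsum_le_tsum fun n => ?_).trans_lt h,
    (ENNReal.tsum_le_tsum fun n => ?_).trans_lt h⟩ <;>
  exact indicator_le_self _ _ n

end Network

end D2D

/-! ### Conditional laws given 𝒴 -/

namespace D2D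

lemma measurable_z1 (v : ℝ) : Measurable (z1 v) := by
  unfold z1; fun_prop

lemma measurableSet_region (v : ℝ) : MeasurableSet (region v) := by
  have h1 : MeasurableSet {x : ℝ × ℝ × ℝ | 0 < x.1} := measurableSet_lt measurable_const measurable_fst
  have h2 : MeasurableSet {x : ℝ × ℝ × ℝ | z1 v x.1 < x.2.1} :=
    measurableSet_lt ((measurable_z1 v).comp measurable_fst) measurable_snd.fst
  have h3 : MeasurableSet {x : ℝ × ℝ × ℝ | x.2.2 ∈ Ioo 0 Real.pi} :=
    measurable_snd.snd measurableSet_Ioo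
  exact h1.inter (h2.inter h3)

lemma lintegral_region (v : ℝ) {F : ℝ × ℝ × ℝ → ℝ≥0∞} (hF : Measurable F) :
    ∫⁻ z in region v, F z = ∫⁻ r₁ in Ioi (0 : ℝ), ∫⁻ r₂ in Ioi (z1 v r₁),
      ∫⁻ θ in Ioo 0 Real.pi, F (r₁, r₂, θ) := by
  classical
  have hG := hF.indicator (measurableSet_region v)
  rw [← lintegral_indicator (measurableSet_region v), Measure.volume_eq_prod,
    lintegral_prod _ hG.aemeasurable, ← lintegral_indicator measurableSet_Ioi]
  refine lintegral_congr fun r₁ => ?_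
  have hG1 : Measurable fun x : ℝ × ℝ => (region v).indicator F (r₁, x) :=
    hG.comp measurable_prodMk_left
  rw [Measure.volume_eq_prod, lintegral_prod _ hG1.aemeasurable]
  by_cases h1 : 0 < r₁
  · rw [indicator_of_mem (by exact h1), ← lintegral_indicator measurableSet_Ioi]
    refine lintegral_congr fun r₂ => ?_
    by_cases h2 : z1 v r₁ < r₂
    · rw [indicator_of_mem (by exact h2), ← lintegral_indicator measurableSet_Ioo]
      refine lintegral_congr fun θ => ?_
      simp only [indicator_apply, region, mem_ofPred_eq, h1, h2, true_and]
    · rw [indicator_of_notMem (by exact h2)]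
      simp [region, h2]
  · rw [indicator_of_notMem (by exact h1)]
    simp [region, h1]

lemma measurable_extDensity (lam p v : ℝ) :
    Measurable fun z : ℝ × ℝ × ℝ => extDensity lam p v z.1 z.2.1 := by
  unfold extDensity
  have s : Measurable fun z : ℝ × ℝ × ℝ => (z.1, z.2.1) := by fun_prop
  have e1 : Measurable fun z : ℝ × ℝ × ℝ => expNeg (ENNReal.ofReal (lam * Real.pi * z.1 ^ 2)) :=
    measurable_expNeg.comp (by fun_prop)
  have e2 : Measurable fun z : ℝ × ℝ × ℝ => ENNReal.ofReal (2 * lam * z.1) := by fun_prop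
  have e3 : Measurable fun z : ℝ × ℝ × ℝ => ENNReal.ofReal (p * lam * arcLength v z.1 z.2.1) :=
    (((measurable_arcLength v).comp s).const_mul _).ennreal_ofReal
  exact (e2.mul e1).mul (e3.mul ((measurable_extVoid lam p v).comp s))

/-- The region carries the joint density. -/
lemma lintegral_extDensity_eq_region {lam p v : ℝ} (hv : 0 ≤ v) {F : ℝ × ℝ × ℝ → ℝ≥0∞}
    (hF : Measurable F) :
    ∫⁻ r₁ in Ioi (0 : ℝ), ∫⁻ r₂ in Ioi (0 : ℝ), ∫⁻ θ in Ioo 0 Real.pi,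
      F (r₁, r₂, θ) * extDensity lam p v r₁ r₂ =
    ∫⁻ z in region v, F z * extDensity lam p v z.1 z.2.1 := by
  have hm : Measurable fun z : ℝ × ℝ × ℝ => F z * extDensity lam p v z.1 z.2.1 :=
    hF.mul (measurable_extDensity lam p v)
  rw [lintegral_region v hm]
  refine setLIntegral_congr_fun measurableSet_Ioi fun r₁ hr₁ => ?_
  rw [← Ioc_union_Ioi_eq_Ioi (z1_nonneg (v := v) (r₁ := r₁)),
    lintegral_union measurableSet_Ioi (Ioc_disjoint_Ioi le_rfl),
    setLIntegral_congr_fun (g := fun _ => 0) measurableSet_Ioc, lintegral_zero, zero_add]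
  intro r hr
  simp [extDensity_eq_zero hv hr.1 hr.2]

/-- Integrating out r₂ gives 1 for every r₁, and what remains is a product. The laws of R₁ and Θ and
the total mass follow from it. -/
lemma lintegral_region_mul {lam v : ℝ} {p : unitInterval} (hlam : 0 < lam) (hp : 0 < p)
    (hv : 0 ≤ v) {g₁ g₃ : ℝ → ℝ≥0∞} (h₁ : Measurable g₁) (h₃ : Measurable g₃) :
    ∫⁻ z in region v, g₁ z.1 * g₃ z.2.2 * extDensity lam p v z.1 z.2.1 =
      (∫⁻ r in Ioi (0 : ℝ), g₁ r * ENNReal.ofReal (fR1 lam r)) *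
        ∫⁻ θ in Ioo 0 Real.pi, g₃ θ * ENNReal.ofReal (fTheta θ) := by
  have hp' : (0 : ℝ) < p := hp
  have hm : Measurable fun z : ℝ × ℝ × ℝ => g₁ z.1 * g₃ z.2.2 :=
    (h₁.comp measurable_fst).mul (h₃.comp measurable_snd.snd)
  have hf1 : Measurable fun r => ENNReal.ofReal (fR1 lam r) := by unfold fR1; fun_prop
  have hf3 : Measurable fun θ => g₃ θ * ENNReal.ofReal (fTheta θ) := by unfold fTheta; fun_prop
  have hm' : Measurable fun z : ℝ × ℝ × ℝ => g₁ z.1 * g₃ z.2.2 * extDensity lam p v z.1 z.2.1 :=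
    hm.mul (measurable_extDensity lam p v)
  have hmr : Measurable fun r => g₁ r * ENNReal.ofReal (fR1 lam r) := h₁.mul hf1
  rw [lintegral_region v hm', ← lintegral_mul_const _ hmr]
  refine setLIntegral_congr_fun measurableSet_Ioi fun r₁ hr₁ => ?_
  have hr₁ : 0 < r₁ := hr₁
  have e : ∀ r₂ ∈ Ioi (z1 v r₁), ∫⁻ θ in Ioo 0 Real.pi, g₁ r₁ * g₃ θ * extDensity lam p v r₁ r₂ =
      ENNReal.ofReal (fR2 lam p v r₁ r₂) * (g₁ r₁ * ENNReal.ofReal (fR1 lam r₁) *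
        ∫⁻ θ in Ioo 0 Real.pi, g₃ θ * ENNReal.ofReal (fTheta θ)) := by
    intro r₂ hr₂
    have h2 := fR2_nonneg hlam.le hp'.le hv hr₁ hr₂
    have h1 := fR1_nonneg hlam.le hr₁.le
    rw [← mul_assoc, ← lintegral_const_mul _ hf3]
    refine lintegral_congr fun θ => ?_
    rw [extDensity_eq p hlam.le hv hr₁ hr₂ θ, ENNReal.ofReal_mul (by positivity),
      ENNReal.ofReal_mul h2]
    ring
  have hmf : AEMeasurable (fun r₂ => ENNReal.ofReal (fR2 lam p v r₁ r₂))
      (volume.restrict (Ioi (z1 v r₁))) := by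
    unfold fR2
    exact (measurable_deriv _).ennreal_ofReal.aemeasurable
  rw [setLIntegral_congr_fun measurableSet_Ioi e, lintegral_mul_const'' _ hmf,
    lintegral_fR2 hlam hp' hv hr₁, one_mul]

lemma lintegral_fTheta : ∫⁻ θ in Ioo 0 Real.pi, ENNReal.ofReal (fTheta θ) = 1 := by
  have hpi := Real.pi_pos
  simp only [fTheta, lintegral_const, Measure.restrict_apply MeasurableSet.univ, univ_inter,
    Real.volume_Ioo, sub_zero]
  rw [← ENNReal.ofReal_mul (by positivity), one_div_mul_cancel hpi.ne', ENNReal.ofReal_one]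

lemma lintegral_region_extDensity {lam v : ℝ} {p : unitInterval} (hlam : 0 < lam) (hp : 0 < p)
    (hv : 0 ≤ v) : ∫⁻ z in region v, extDensity lam p v z.1 z.2.1 = 1 := by
  have h := lintegral_region_mul hlam hp hv (g₁ := fun _ => 1) (g₃ := fun _ => 1)
    measurable_const measurable_const
  simpa [lintegral_fR1 hlam, lintegral_fTheta] using h

lemma linkLap_zero (q α d : ℝ) : linkLap q α 0 d = 1 := by simp [linkLap]

lemma extLap2_zero (lam p q α v r₁ : ℝ) : extLap2 lam p q α v 0 r₁ = 1 := by
  simp [extLap2, linkLap_zero]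

lemma extLap3_zero (lam p q α v r₁ r₂ : ℝ) : extLap3 lam p q α v 0 r₁ r₂ = 1 := by
  simp [extLap3, linkLap_zero]

/-- The joint Laplace transform of `I₁`, `I₂`, `I₃` at `a`, `b`, `c` given `(R₁, R₂, Θ)`. -/
noncomputable def jointLap (lam p q α v a b c : ℝ) (z : ℝ × ℝ × ℝ) : ℝ≥0∞ :=
  ENNReal.ofReal (linkLap q α a (dist2 v z.1 z.2.2)) * extLap2 lam p q α v b z.1 *
    extLap3 lam p q α v c z.1 z.2.1

lemma jointLap_zero (lam p q α v : ℝ) (z : ℝ × ℝ × ℝ) : jointLap lam p q α v 0 0 0 z = 1 := by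
  simp [jointLap, linkLap_zero, extLap2_zero, extLap3_zero]

lemma measurable_jointLap (lam p q α v : ℝ) {a b c : ℝ × ℝ × ℝ → ℝ} (ha : Measurable a)
    (hb : Measurable b) (hc : Measurable c) :
    Measurable fun z => jointLap lam p q α v (a z) (b z) (c z) z := by
  unfold jointLap
  have s1 : Measurable fun z : ℝ × ℝ × ℝ => (z.1, z.2.2) := by fun_prop
  have s2 : Measurable fun z : ℝ × ℝ × ℝ => (a z, dist2 v z.1 z.2.2) :=
    ha.prodMk ((measurable_dist2 v).comp s1)
  have s3 : Measurable fun z : ℝ × ℝ × ℝ => (b z, z.1) := by fun_prop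
  have s4 : Measurable fun z : ℝ × ℝ × ℝ => (c z, z.1, z.2.1) := by fun_prop
  have e1 := ((measurable_linkLap q α).comp s2).ennreal_ofReal
  have e2 := (measurable_extLap2 lam p q α v).comp s3
  have e3 := (measurable_extLap3 lam p q α v).comp s4
  exact (e1.mul e2).mul e3

namespace Network

variable {Ω : Type*} [MeasurableSpace Ω] {μ : Measure Ω} {lam : ℝ}
  {p q : unitInterval} (N : Network μ lam p q)

/-- The parameters `(R₁, R₂, Θ)`. -/
noncomputable def triple (v : ℝ) (ω : Ω) : ℝ × ℝ × ℝ := (N.R1 v ω, N.R2 v ω, N.Theta v ω)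

lemma triple_eq (v : ℝ) : N.triple v = fun ω => params v (N.dev1 v ω) (N.dev2 v ω) := rfl

section

attribute [local irreducible] params

lemma measurable_triple (v : ℝ) : Measurable (N.triple v) := by
  rw [triple_eq]
  have s : Measurable fun ω => (N.dev1 v ω, N.dev2 v ω) :=
    (N.measurable_dev1 v).prodMk (N.measurable_dev2 v)
  exact (measurable_params v).comp s

end

variable [IsProbabilityMeasure μ]

lemma lintegral_pairEvent_region (hlam : 0 < lam) {v : ℝ} (hv : 0 ≤ v) (α : ℝ)
    {g : ℝ × ℝ × ℝ → ℝ≥0∞} (hg : Measurable g) {a b c : ℝ} (ha : 0 ≤ a) (hb : 0 ≤ b)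
    (hc : 0 ≤ c) :
    ∫⁻ ω in N.pairEvent v, g (N.triple v ω) * expNeg (ENNReal.ofReal a * N.I1 α v ω +
          (ENNReal.ofReal b * N.I2 α v ω + ENNReal.ofReal c * N.I3 α v ω)) ∂μ =
      ENNReal.ofReal (1 - p) * ∫⁻ z in region v, g z * jointLap lam p q α v a b c z *
        extDensity lam p v z.1 z.2.1 := by
  have hm : Measurable fun z => g z * jointLap lam p q α v a b c z :=
    hg.mul (measurable_jointLap lam p q α v measurable_const measurable_const measurable_const)
  rw [← lintegral_extDensity_eq_region hv hm]
  exact N.lintegral_pairEvent_expNeg hlam.le hv α hg (a := fun _ => a) (b := fun _ => b)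
    (c := fun _ => c) measurable_const measurable_const measurable_const (fun _ => ha)
    (fun _ => hb) (fun _ => hc)

/-- Given that file 1 is file B, the servers are almost surely unique. -/
lemma pairEvent_ae_eq (hlam : 0 < lam) (hp : 0 < p) {v : ℝ} (hv : 0 ≤ v) :
    N.pairEvent v =ᵐ[μ] N.subcaseY v := by
  -- With all parameters zero the formula says that the pair event has probability 1 - p, the same
  -- as 𝒴, which contains it. The exponent `0` for α plays no role.
  have h := N.lintegral_pairEvent_region hlam hv 0 (g := fun _ => 1) measurable_const le_rfl le_rfl
    le_rfl
  simp only [jointLap_zero, one_mul, lintegral_region_extDensity hlam hp hv, mul_one,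
    ENNReal.ofReal_zero, zero_mul, add_zero, expNeg_zero, lintegral_one,
    Measure.restrict_apply MeasurableSet.univ, univ_inter] at h
  exact ae_eq_of_subset_of_measure_ge (N.pairEvent_subset v)
    (by rw [h, N.measure_subcaseY hlam v]) (N.measurableSet_pairEvent v).nullMeasurableSet
    (measure_ne_top _ _)

lemma lintegral_cond_eq (hlam : 0 < lam) (hp : 0 < p) (hp1 : p < 1) {v : ℝ} (hv : 0 ≤ v)
    {f : Ω → ℝ≥0∞} {C : ℝ≥0∞} (h : ∫⁻ ω in N.pairEvent v, f ω ∂μ = ENNReal.ofReal (1 - p) * C) :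
    ∫⁻ ω, f ω ∂(cond μ (N.subcaseY v)) = C := by
  have hp1' : (p : ℝ) < 1 := hp1
  have h0 : ENNReal.ofReal (1 - p) ≠ 0 := by simpa using hp1'
  rw [ProbabilityTheory.cond, lintegral_smul_measure, ← setLIntegral_congr (N.pairEvent_ae_eq hlam hp hv), h,
    N.measure_subcaseY hlam v, smul_eq_mul, ← mul_assoc,
    ENNReal.inv_mul_cancel h0 ENNReal.ofReal_ne_top, one_mul]

lemma isProbabilityMeasure_cond_subcaseY (hlam : 0 < lam) (hp1 : p < 1) (v : ℝ) :
    IsProbabilityMeasure (cond μ (N.subcaseY v)) := by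
  refine cond_isProbabilityMeasure ?_
  have hp1' : (p : ℝ) < 1 := hp1
  rw [N.measure_subcaseY hlam v]
  simpa using hp1'

lemma lintegral_cond_expNeg (hlam : 0 < lam) (hp : 0 < p) (hp1 : p < 1) {v : ℝ} (hv : 0 ≤ v)
    (α : ℝ) {g : ℝ × ℝ × ℝ → ℝ≥0∞} (hg : Measurable g) {a b c : ℝ} (ha : 0 ≤ a) (hb : 0 ≤ b)
    (hc : 0 ≤ c) :
    ∫⁻ ω, g (N.triple v ω) * expNeg (ENNReal.ofReal a * N.I1 α v ω +
          (ENNReal.ofReal b * N.I2 α v ω + ENNReal.ofReal c * N.I3 α v ω))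
        ∂(cond μ (N.subcaseY v)) =
      ∫⁻ z in region v, g z * jointLap lam p q α v a b c z * extDensity lam p v z.1 z.2.1 :=
  N.lintegral_cond_eq hlam hp hp1 hv (N.lintegral_pairEvent_region hlam hv α hg ha hb hc)

lemma lintegral_cond_triple (hlam : 0 < lam) (hp : 0 < p) (hp1 : p < 1) {v : ℝ} (hv : 0 ≤ v)
    {g : ℝ × ℝ × ℝ → ℝ≥0∞} (hg : Measurable g) :
    ∫⁻ ω, g (N.triple v ω) ∂(cond μ (N.subcaseY v)) =
      ∫⁻ z in region v, g z * extDensity lam p v z.1 z.2.1 := by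
  have h := N.lintegral_cond_expNeg hlam hp hp1 hv 0 hg le_rfl le_rfl le_rfl
  simpa [jointLap_zero] using h

theorem map_triple (hlam : 0 < lam) (hp : 0 < p) (hp1 : p < 1) {v : ℝ} (hv : 0 ≤ v) :
    (cond μ (N.subcaseY v)).map (N.triple v) =
      (volume.restrict (region v)).withDensity (fun x => ENNReal.ofReal
        (fR2 lam p v x.1 x.2.1 * fR1 lam x.1 * fTheta x.2.2)) := by
  ext S hS
  have h := N.lintegral_cond_triple hlam hp hp1 hv (g := S.indicator 1) (measurable_one.indicator hS)
  rw [Measure.map_apply (N.measurable_triple v) hS, withDensity_apply _ hS,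
    ← lintegral_indicator_one ((N.measurable_triple v) hS), ← lintegral_indicator hS]
  refine h.trans (setLIntegral_congr_fun (measurableSet_region v) fun z hz => ?_)
  by_cases hzS : z ∈ S
  · rw [indicator_of_mem hzS, indicator_of_mem hzS, Pi.one_apply, one_mul,
      extDensity_eq p hlam.le hv hz.1 hz.2.1 z.2.2]
  · rw [indicator_of_notMem hzS, indicator_of_notMem hzS, zero_mul]

theorem map_R1 (hlam : 0 < lam) (hp : 0 < p) (hp1 : p < 1) {v : ℝ} (hv : 0 ≤ v) :
    (cond μ (N.subcaseY v)).map (N.R1 v) =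
      (volume.restrict (Ioi 0)).withDensity (fun r => ENNReal.ofReal (fR1 lam r)) := by
  ext S hS
  have hm : Measurable (N.R1 v) := (N.measurable_triple v).fst
  have h := N.lintegral_cond_triple hlam hp hp1 hv (g := fun z => S.indicator 1 z.1 * 1)
    (((measurable_one.indicator hS).comp measurable_fst).mul_const 1)
  rw [lintegral_region_mul hlam hp hv (g₁ := S.indicator 1) (g₃ := fun _ => 1)
    (measurable_one.indicator hS) measurable_const] at h
  simp only [one_mul, lintegral_fTheta, mul_one] at h
  rw [Measure.map_apply hm hS, withDensity_apply _ hS,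
    ← lintegral_indicator_one (hm hS), ← lintegral_indicator hS]
  refine h.trans (lintegral_congr fun z => ?_)
  by_cases hzS : z ∈ S <;> simp [hzS]

theorem map_Theta (hlam : 0 < lam) (hp : 0 < p) (hp1 : p < 1) {v : ℝ} (hv : 0 ≤ v) :
    (cond μ (N.subcaseY v)).map (N.Theta v) =
      (volume.restrict (Ioo 0 Real.pi)).withDensity (fun θ => ENNReal.ofReal (fTheta θ)) := by
  ext S hS
  have hm : Measurable (N.Theta v) := (N.measurable_triple v).snd.snd
  have h := N.lintegral_cond_triple hlam hp hp1 hv (g := fun z => 1 * S.indicator 1 z.2.2)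
    (((measurable_one.indicator hS).comp measurable_snd.snd).const_mul 1)
  rw [lintegral_region_mul hlam hp hv (g₁ := fun _ => 1) (g₃ := S.indicator 1)
    measurable_const (measurable_one.indicator hS)] at h
  simp only [one_mul, lintegral_fR1 hlam] at h
  rw [Measure.map_apply hm hS, withDensity_apply _ hS,
    ← lintegral_indicator_one (hm hS), ← lintegral_indicator hS]
  refine h.trans (lintegral_congr fun z => ?_)
  by_cases hzS : z ∈ S <;> simp [hzS]

/-- The closed forms of the transforms and of the density hold on the region only; this makes them
available almost surely. -/
lemma ae_triple_mem_region (hlam : 0 < lam) (hp : 0 < p) (hp1 : p < 1) {v : ℝ} (hv : 0 ≤ v) :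
    ∀ᵐ ω ∂(cond μ (N.subcaseY v)), N.triple v ω ∈ region v := by
  have h : ∀ᵐ z ∂((cond μ (N.subcaseY v)).map (N.triple v)), z ∈ region v := by
    rw [N.map_triple hlam hp hp1 hv]
    exact (withDensity_absolutelyContinuous _ _).ae_le (ae_restrict_mem (measurableSet_region v))
  exact ae_of_ae_map (N.measurable_triple v).aemeasurable h

end Network

end D2D

/-! ### Conditional expectations and the triple integral -/

namespace D2D

lemma toReal_expNeg {x : ℝ≥0∞} (hx : x ≠ ∞) : (expNeg x).toReal = Real.exp (-x.toReal) := by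
  conv_lhs => rw [← ENNReal.ofReal_toReal hx]
  rw [expNeg_ofReal ENNReal.toReal_nonneg, ENNReal.toReal_ofReal (Real.exp_nonneg _)]

lemma lintegral_indicator_one_mul {Ω β : Type*} [MeasurableSpace Ω] [MeasurableSpace β]
    (ν : Measure Ω) {X : Ω → β} (hX : Measurable X) {S : Set β} (hS : MeasurableSet S)
    (F : Ω → ℝ≥0∞) : ∫⁻ ω, S.indicator 1 (X ω) * F ω ∂ν = ∫⁻ ω in X ⁻¹' S, F ω ∂ν := by
  rw [← lintegral_indicator (hX hS)]
  refine lintegral_congr fun ω => ?_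
  by_cases h : X ω ∈ S
  · have h' : ω ∈ X ⁻¹' S := h
    simp [h, h']
  · have h' : ω ∉ X ⁻¹' S := h
    simp [h, h']

/-- The hypothesis tests the candidate on the sets X⁻¹(S), which characterizes the conditional
expectation. Finiteness of V is needed because `toReal` sends ∞ to 0, where the two exponentials
would be 1 and 0. -/
lemma condExp_exp_neg {Ω β : Type*} [MeasurableSpace Ω] [mβ : MeasurableSpace β] (ν : Measure Ω)
    [IsProbabilityMeasure ν] {X : Ω → β} (hX : Measurable X) {V : Ω → ℝ≥0∞} (hV : Measurable V)
    (hfin : ∀ᵐ ω ∂ν, V ω < ∞) {ψ : β → ℝ≥0∞} (hψ : Measurable ψ)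
    (h : ∀ S, MeasurableSet S → ∫⁻ ω, S.indicator 1 (X ω) * expNeg (V ω) ∂ν =
      ∫⁻ ω, S.indicator 1 (X ω) * ψ (X ω) ∂ν) :
    ν[fun ω => Real.exp (-(V ω).toReal) | MeasurableSpace.comap X mβ] =ᵐ[ν]
      fun ω => (ψ (X ω)).toReal := by
  have hle : MeasurableSpace.comap X mβ ≤ _ := hX.comap_le
  have hE : Measurable fun ω => expNeg (V ω) := measurable_expNeg.comp hV
  have hE1 : ∫⁻ ω, expNeg (V ω) ∂ν ≤ 1 :=
    (lintegral_mono fun ω => expNeg_le_one (V ω)).trans (by simp)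
  have hψX : Measurable fun ω => ψ (X ω) := hψ.comp hX
  have hψ1 : ∫⁻ ω, ψ (X ω) ∂ν ≤ 1 := by
    have := h univ MeasurableSet.univ
    simp only [indicator_univ, Pi.one_apply, one_mul] at this
    rwa [← this]
  have hψfin : ∀ᵐ ω ∂ν, ψ (X ω) < ∞ :=
    ae_lt_top hψX (hψ1.trans_lt ENNReal.one_lt_top).ne
  have hf : (fun ω => Real.exp (-(V ω).toReal)) =ᵐ[ν] fun ω => (expNeg (V ω)).toReal := by
    filter_upwards [hfin] with ω hω
    rw [toReal_expNeg hω.ne]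
  refine (condExp_congr_ae hf).trans (ae_eq_condExp_of_forall_setIntegral_eq hle
    (integrable_toReal_of_lintegral_ne_top hE.aemeasurable (hE1.trans_lt ENNReal.one_lt_top).ne)
    (fun S _ _ => (integrable_toReal_of_lintegral_ne_top hψX.aemeasurable
      (hψ1.trans_lt ENNReal.one_lt_top).ne).integrableOn) ?_ ?_).symm
  · rintro _ ⟨S, hS, rfl⟩ _
    rw [integral_toReal hψX.aemeasurable (ae_restrict_of_ae hψfin),
      integral_toReal hE.aemeasurable (ae_of_all _ fun ω => (expNeg_le_one _).trans_lt
        ENNReal.one_lt_top), ← lintegral_indicator_one_mul ν hX hS,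
      ← lintegral_indicator_one_mul ν hX hS, h S hS]
  · exact (hψ.ennreal_toReal.comp (comap_measurable X)).stronglyMeasurable.aestronglyMeasurable

lemma integral_region (v : ℝ) {f : ℝ × ℝ × ℝ → ℝ} (hf : IntegrableOn f (region v)) :
    ∫ z in region v, f z = ∫ r₁ in Ioi (0 : ℝ), ∫ r₂ in Ioi (z1 v r₁),
      ∫ θ in (0 : ℝ)..Real.pi, f (r₁, r₂, θ) := by
  classical
  have hG : Integrable ((region v).indicator f) :=
    (integrable_indicator_iff (measurableSet_region v)).2 hf
  rw [← integral_indicator (measurableSet_region v)]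
  rw [Measure.volume_eq_prod] at hG ⊢
  rw [integral_prod _ hG, ← integral_indicator measurableSet_Ioi]
  refine integral_congr_ae ?_
  filter_upwards [hG.prod_right_ae] with r₁ hr
  rw [Measure.volume_eq_prod] at hr ⊢
  rw [integral_prod _ hr]
  by_cases h1 : 0 < r₁
  · rw [indicator_of_mem (by exact h1), ← integral_indicator measurableSet_Ioi]
    congr 1
    funext r₂
    by_cases h2 : z1 v r₁ < r₂
    · rw [indicator_of_mem (by exact h2), intervalIntegral.integral_of_le Real.pi_pos.le,
        integral_Ioc_eq_integral_Ioo, ← integral_indicator measurableSet_Ioo]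
      congr 1
      funext θ
      simp only [indicator_apply, region, mem_ofPred_eq, h1, h2, true_and]
    · rw [indicator_of_notMem (by exact h2)]
      simp [region, h2]
  · rw [indicator_of_notMem (by exact h1)]
    simp [region, h1]

lemma lap2_nonneg (lam p q α v s r₁ : ℝ) : 0 ≤ lap2 lam p q α v s r₁ := Real.exp_nonneg _

lemma lap3_nonneg (lam p q α v s r₁ r₂ : ℝ) : 0 ≤ lap3 lam p q α v s r₁ r₂ :=
  mul_nonneg (Real.exp_nonneg _) (Real.exp_nonneg _)

/-- On the region r₂ > 0, so |r₂| = r₂ and all the closed forms apply. -/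
lemma ofReal_integrand {lam α v T : ℝ} (p q : unitInterval) (hlam : 0 ≤ lam) (hα : 2 < α)
    (hv : 0 ≤ v) (hT : 0 < T) {z : ℝ × ℝ × ℝ} (hz : z ∈ region v) :
    ENNReal.ofReal (integrand lam p q α v T z.1 z.2.1 z.2.2) =
      jointLap lam p q α v (T * |z.2.1| ^ α) (T * |z.2.1| ^ α) (T * |z.2.1| ^ α) z *
        extDensity lam p v z.1 z.2.1 := by
  obtain ⟨r₁, r₂, θ⟩ := z
  obtain ⟨h1, h2, -⟩ := hz
  have h1 : 0 < r₁ := h1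
  have h2 : z1 v r₁ < r₂ := h2
  have h0 : 0 < r₂ := z1_nonneg.trans_lt h2
  have hs : 0 < T * r₂ ^ α := mul_pos hT (Real.rpow_pos_of_pos h0 α)
  have l1 : 0 ≤ linkLap q α (T * r₂ ^ α) (dist2 v r₁ θ) :=
    linkLap_nonneg q hs.le (dist2_nonneg v r₁ θ)
  have l2 := lap2_nonneg lam p q α v (T * r₂ ^ α) r₁
  have l3 := lap3_nonneg lam p q α v (T * r₂ ^ α) r₁ r₂
  simp only [jointLap, integrand, abs_of_pos h0]
  rw [extLap2_eq p q hlam hα hs hv h1, extLap3_eq p q hlam hα hs hv h1 h2,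
    extDensity_eq p hlam hv h1 h2 θ, lap1_eq_linkLap _ _ _ _ hv h1.le,
    ← ENNReal.ofReal_mul l1, ← ENNReal.ofReal_mul (mul_nonneg l1 l2),
    ← ENNReal.ofReal_mul (mul_nonneg (mul_nonneg l1 l2) l3)]
  congr 1
  ring

namespace Network

attribute [local irreducible] extLap2 extLap3

variable {Ω : Type*} [MeasurableSpace Ω] {μ : Measure Ω} [IsProbabilityMeasure μ] {lam : ℝ}
  {p q : unitInterval} (N : Network μ lam p q)

/-- If the joint transform depends on (R₁, R₂, Θ) only through π, it is also the conditional
transform given π alone. With two of the parameters zero, π may be (R₁, Θ), R₁ or (R₁, R₂). -/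
theorem condExp_jointLap (hlam : 0 < lam) (hp : 0 < p) (hp1 : p < 1) {v : ℝ} (hv : 0 ≤ v)
    {α : ℝ} (hα : 2 < α) {β : Type*} [mβ : MeasurableSpace β] {π : ℝ × ℝ × ℝ → β}
    (hπ : Measurable π) {ψ : β → ℝ≥0∞} (hψ : Measurable ψ) {a b c : ℝ} (ha : 0 ≤ a) (hb : 0 ≤ b)
    (hc : 0 ≤ c) (h : ∀ z, jointLap lam p q α v a b c z = ψ (π z)) :
    (cond μ (N.subcaseY v))[fun ω => Real.exp (-(ENNReal.ofReal a * N.I1 α v ω +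
        (ENNReal.ofReal b * N.I2 α v ω + ENNReal.ofReal c * N.I3 α v ω)).toReal) |
        MeasurableSpace.comap (fun ω => π (N.triple v ω)) mβ] =ᵐ[cond μ (N.subcaseY v)]
      fun ω => (ψ (π (N.triple v ω))).toReal := by
  have hprob := N.isProbabilityMeasure_cond_subcaseY hlam hp1 v
  have hX : Measurable fun ω => π (N.triple v ω) := hπ.comp (N.measurable_triple v)
  have hfin : ∀ᵐ ω ∂(cond μ (N.subcaseY v)), N.I1 α v ω < ∞ ∧ N.I2 α v ω < ∞ ∧ N.I3 α v ω < ∞ :=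
    cond_absolutelyContinuous.ae_le (N.ae_interference_lt_top hα v)
  refine condExp_exp_neg _ hX (((N.measurable_I1 α v).const_mul _).add
    (((N.measurable_I2 α v).const_mul _).add ((N.measurable_I3 α v).const_mul _))) ?_ hψ ?_
  · filter_upwards [hfin] with ω hω
    exact ENNReal.add_lt_top.2 ⟨ENNReal.mul_lt_top ENNReal.ofReal_lt_top hω.1,
      ENNReal.add_lt_top.2 ⟨ENNReal.mul_lt_top ENNReal.ofReal_lt_top hω.2.1,
      ENNReal.mul_lt_top ENNReal.ofReal_lt_top hω.2.2⟩⟩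
  · intro S hS
    have hg : Measurable fun z : ℝ × ℝ × ℝ => S.indicator (1 : β → ℝ≥0∞) (π z) :=
      (measurable_one.indicator hS).comp hπ
    have hg2 : Measurable fun z : ℝ × ℝ × ℝ => S.indicator (1 : β → ℝ≥0∞) (π z) * ψ (π z) :=
      hg.mul (hψ.comp hπ)
    refine (N.lintegral_cond_expNeg hlam hp hp1 hv α hg ha hb hc).trans ?_
    rw [N.lintegral_cond_triple hlam hp hp1 hv hg2]
    simp_rw [h]

theorem condExp_I1 (hlam : 0 < lam) (hp : 0 < p) (hp1 : p < 1) {v : ℝ} (hv : 0 ≤ v)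
    {α : ℝ} (hα : 2 < α) {s : ℝ} (hs : 0 < s) :
    (cond μ (N.subcaseY v))[fun ω => Real.exp (-(s * (N.I1 α v ω).toReal)) |
      MeasurableSpace.comap (fun ω => (N.R1 v ω, N.Theta v ω)) inferInstance]
      =ᵐ[cond μ (N.subcaseY v)] fun ω => lap1 q α v s (N.R1 v ω) (N.Theta v ω) := by
  have s2 : Measurable fun z : ℝ × ℝ => (s, dist2 v z.1 z.2) :=
    measurable_const.prodMk (measurable_dist2 v)
  have h := N.condExp_jointLap hlam hp hp1 hv hα (π := fun z => (z.1, z.2.2)) (by fun_prop)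
    (ψ := fun y => ENNReal.ofReal (linkLap q α s (dist2 v y.1 y.2)))
    (((measurable_linkLap q α).comp s2).ennreal_ofReal) hs.le le_rfl le_rfl
    (fun z => by simp [jointLap, extLap2_zero, extLap3_zero])
  simp only [ENNReal.ofReal_zero, zero_mul, add_zero, ENNReal.toReal_mul,
    ENNReal.toReal_ofReal hs.le] at h
  refine h.trans ?_
  filter_upwards [N.ae_triple_mem_region hlam hp hp1 hv] with ω hω
  have h1 : 0 ≤ N.R1 v ω := le_of_lt hω.1
  rw [lap1_eq_linkLap _ _ _ _ hv h1,
    ENNReal.toReal_ofReal (linkLap_nonneg q hs.le (dist2_nonneg _ _ _))]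
  rfl

theorem condExp_I2 (hlam : 0 < lam) (hp : 0 < p) (hp1 : p < 1) {v : ℝ} (hv : 0 ≤ v)
    {α : ℝ} (hα : 2 < α) {s : ℝ} (hs : 0 < s) :
    (cond μ (N.subcaseY v))[fun ω => Real.exp (-(s * (N.I2 α v ω).toReal)) |
      MeasurableSpace.comap (N.R1 v) inferInstance]
      =ᵐ[cond μ (N.subcaseY v)] fun ω => lap2 lam p q α v s (N.R1 v ω) := by
  have hm : Measurable fun y : ℝ => extLap2 lam p q α v s y := by
    have s2 : Measurable fun y : ℝ => (s, y) := measurable_prodMk_left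
    exact (measurable_extLap2 lam p q α v).comp s2
  have h := N.condExp_jointLap hlam hp hp1 hv hα (π := fun z => z.1) (by fun_prop)
    (ψ := fun y => extLap2 lam p q α v s y) hm le_rfl hs.le le_rfl
    (fun z => by simp [jointLap, linkLap_zero, extLap3_zero])
  simp only [ENNReal.ofReal_zero, zero_mul, add_zero, zero_add, ENNReal.toReal_mul,
    ENNReal.toReal_ofReal hs.le] at h
  refine h.trans ?_
  filter_upwards [N.ae_triple_mem_region hlam hp hp1 hv] with ω hω
  rw [extLap2_eq p q hlam.le hα hs hv hω.1, ENNReal.toReal_ofReal (lap2_nonneg _ _ _ _ _ _ _)]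
  rfl

theorem condExp_I3 (hlam : 0 < lam) (hp : 0 < p) (hp1 : p < 1) {v : ℝ} (hv : 0 ≤ v)
    {α : ℝ} (hα : 2 < α) {s : ℝ} (hs : 0 < s) :
    (cond μ (N.subcaseY v))[fun ω => Real.exp (-(s * (N.I3 α v ω).toReal)) |
      MeasurableSpace.comap (fun ω => (N.R1 v ω, N.R2 v ω)) inferInstance]
      =ᵐ[cond μ (N.subcaseY v)] fun ω => lap3 lam p q α v s (N.R1 v ω) (N.R2 v ω) := by
  have h := N.condExp_jointLap hlam hp hp1 hv hα (π := fun z => (z.1, z.2.1)) (by fun_prop)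
    (ψ := fun y => extLap3 lam p q α v s y.1 y.2)
    ((measurable_extLap3 lam p q α v).comp measurable_prodMk_left) le_rfl le_rfl hs.le
    (fun z => by simp [jointLap, linkLap_zero, extLap2_zero])
  simp only [ENNReal.ofReal_zero, zero_mul, zero_add, ENNReal.toReal_mul,
    ENNReal.toReal_ofReal hs.le] at h
  refine h.trans ?_
  filter_upwards [N.ae_triple_mem_region hlam hp hp1 hv] with ω hω
  rw [extLap3_eq p q hlam.le hα hs hv hω.1 hω.2.1,
    ENNReal.toReal_ofReal (lap3_nonneg _ _ _ _ _ _ _ _)]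
  rfl

/-- The coverage probability, as a Lebesgue integral. -/
theorem cond_coverage (hlam : 0 < lam) (hp : 0 < p) (hp1 : p < 1) {v : ℝ} (hv : 0 ≤ v)
    {α : ℝ} (hα : 2 < α) {T : ℝ} (hT : 0 < T) :
    cond μ (N.subcaseY v) {ω | ENNReal.ofReal T < N.SIR α v ω} =
      ∫⁻ z in region v, ENNReal.ofReal (integrand lam p q α v T z.1 z.2.1 z.2.2) := by
  have hm : Measurable fun z : ℝ × ℝ × ℝ => T * |z.2.1| ^ α := by fun_prop
  have h := N.measure_coverage hlam.le hv α hT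
  have e : ∫⁻ z in region v, ENNReal.ofReal (integrand lam p q α v T z.1 z.2.1 z.2.2) =
      ∫⁻ z in region v, jointLap lam p q α v (T * |z.2.1| ^ α) (T * |z.2.1| ^ α)
        (T * |z.2.1| ^ α) z * extDensity lam p v z.1 z.2.1 :=
    setLIntegral_congr_fun (measurableSet_region v)
      fun z hz => ofReal_integrand p q hlam.le hα hv hT hz
  have hp1' : (p : ℝ) < 1 := hp1
  have h0 : ENNReal.ofReal (1 - p) ≠ 0 := by simpa using hp1'
  have h2 := lintegral_extDensity_eq_region (lam := lam) (p := p) hv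
    (measurable_jointLap lam p q α v hm hm hm)
  have h3 : μ (N.subcaseY v ∩ {ω | ENNReal.ofReal T < N.SIR α v ω}) =
      μ (N.pairEvent v ∩ {ω | ENNReal.ofReal T < N.SIR α v ω}) :=
    measure_congr ((N.pairEvent_ae_eq hlam hp hv).symm.inter (ae_eq_refl _))
  rw [cond_apply (N.measurableSet_subcaseY v), h3, h, N.measure_subcaseY hlam v, ← mul_assoc,
    ENNReal.inv_mul_cancel h0 ENNReal.ofReal_ne_top, one_mul, e, ← h2]
  rfl

end Network

lemma integrand_nonneg {lam α v T : ℝ} (p q : unitInterval) (hlam : 0 ≤ lam) (hv : 0 ≤ v)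
    (hT : 0 < T) {z : ℝ × ℝ × ℝ} (hz : z ∈ region v) :
    0 ≤ integrand lam p q α v T z.1 z.2.1 z.2.2 := by
  obtain ⟨h1, h2, -⟩ := hz
  have h0 : 0 < z.2.1 := z1_nonneg.trans_lt h2
  have hs : 0 < T * z.2.1 ^ α := mul_pos hT (Real.rpow_pos_of_pos h0 α)
  have l1 : 0 ≤ lap1 q α v (T * z.2.1 ^ α) z.1 z.2.2 := by
    rw [lap1_eq_linkLap _ _ _ _ hv h1.le]
    exact linkLap_nonneg q hs.le (dist2_nonneg _ _ _)
  have := lap2_nonneg lam p q α v (T * z.2.1 ^ α) z.1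
  have := lap3_nonneg lam p q α v (T * z.2.1 ^ α) z.1 z.2.1
  have := fR2_nonneg hlam p.2.1 hv h1 h2
  have := fR1_nonneg hlam h1.le
  have hpi := Real.pi_pos
  unfold integrand fTheta
  positivity

/-- Joint measurability is not evident for a derivative such as `fR2` that depends on r₁. On the
region the integrand equals a measurable product of `jointLap` and `extDensity`. -/
lemma aemeasurable_integrand {lam α v T : ℝ} (p q : unitInterval) (hlam : 0 ≤ lam) (hα : 2 < α)
    (hv : 0 ≤ v) (hT : 0 < T) :
    AEMeasurable (fun z : ℝ × ℝ × ℝ => integrand lam p q α v T z.1 z.2.1 z.2.2)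
      (volume.restrict (region v)) := by
  have hm : Measurable fun z : ℝ × ℝ × ℝ => T * |z.2.1| ^ α := by fun_prop
  refine ⟨_, ((measurable_jointLap lam p q α v hm hm hm).mul
    (measurable_extDensity lam p v)).ennreal_toReal, ?_⟩
  refine (ae_restrict_iff' (measurableSet_region v)).2 (ae_of_all _ fun z hz => ?_)
  have h := ofReal_integrand p q hlam hα hv hT hz
  simp only [Pi.mul_apply]
  rw [← h, ENNReal.toReal_ofReal (integrand_nonneg p q hlam hv hT hz)]

end D2D

theorem theorem1 {Ω : Type*} [MeasurableSpace Ω] (μ : Measure Ω) [IsProbabilityMeasure μ]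
    (lam : ℝ) (hlam : 0 < lam) (p q : unitInterval) (hp0 : 0 < p) (hp1 : p < 1)
    (N : D2D.Network μ lam p q) (α v T : ℝ) (hα : 2 < α) (hv : 0 ≤ v) (hT : 0 < T) :
    -- the coverage probability as a triple integral
    N.coverageY α v T =
        ∫ r₁ in Ioi (0 : ℝ), ∫ r₂ in Ioi (D2D.z1 v r₁), ∫ θ in (0 : ℝ)..Real.pi,
          D2D.lap1 q α v (T * r₂ ^ α) r₁ θ * D2D.lap2 lam p q α v (T * r₂ ^ α) r₁
            * D2D.lap3 lam p q α v (T * r₂ ^ α) r₁ r₂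
            * D2D.fR2 lam p v r₁ r₂ * D2D.fR1 lam r₁ * D2D.fTheta θ
    ∧ IntegrableOn
        (fun x : ℝ × ℝ × ℝ => D2D.integrand lam p q α v T x.1 x.2.1 x.2.2) (D2D.region v)
    -- the densities: `R₁`, then `Θ`, then `(R₁, R₂, Θ)` jointly
    ∧ (cond μ (N.subcaseY v)).map (N.R1 v) =
        (volume.restrict (Ioi 0)).withDensity (fun r => ENNReal.ofReal (D2D.fR1 lam r))
    ∧ (cond μ (N.subcaseY v)).map (N.Theta v) =
        (volume.restrict (Ioo 0 Real.pi)).withDensity (fun θ => ENNReal.ofReal (D2D.fTheta θ))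
    ∧ (cond μ (N.subcaseY v)).map (fun ω => (N.R1 v ω, N.R2 v ω, N.Theta v ω)) =
        (volume.restrict (D2D.region v)).withDensity (fun x => ENNReal.ofReal
          (D2D.fR2 lam p v x.1 x.2.1 * D2D.fR1 lam x.1 * D2D.fTheta x.2.2))
    -- the interference terms are finite, and the factors are their conditional Laplace transforms
    ∧ (∀ᵐ ω ∂(cond μ (N.subcaseY v)), N.I1 α v ω < ∞ ∧ N.I2 α v ω < ∞ ∧ N.I3 α v ω < ∞)
    ∧ ∀ s : ℝ, 0 < s →
      ((cond μ (N.subcaseY v))[fun ω => Real.exp (-(s * (N.I1 α v ω).toReal)) |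
          MeasurableSpace.comap (fun ω => (N.R1 v ω, N.Theta v ω)) inferInstance]
        =ᵐ[cond μ (N.subcaseY v)] fun ω => D2D.lap1 q α v s (N.R1 v ω) (N.Theta v ω))
      ∧ ((cond μ (N.subcaseY v))[fun ω => Real.exp (-(s * (N.I2 α v ω).toReal)) |
          MeasurableSpace.comap (N.R1 v) inferInstance]
        =ᵐ[cond μ (N.subcaseY v)] fun ω => D2D.lap2 lam p q α v s (N.R1 v ω))
      ∧ ((cond μ (N.subcaseY v))[fun ω => Real.exp (-(s * (N.I3 α v ω).toReal)) |
          MeasurableSpace.comap (fun ω => (N.R1 v ω, N.R2 v ω)) inferInstance]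
        =ᵐ[cond μ (N.subcaseY v)] fun ω => D2D.lap3 lam p q α v s (N.R1 v ω) (N.R2 v ω)) := by
  have hprob := N.isProbabilityMeasure_cond_subcaseY hlam hp1 v
  have hcov := N.cond_coverage hlam hp0 hp1 hv hα hT
  have hmeas := D2D.aemeasurable_integrand p q hlam.le hα hv hT (v := v)
  have hnn : ∀ᵐ z ∂(volume.restrict (D2D.region v)),
      0 ≤ D2D.integrand lam p q α v T z.1 z.2.1 z.2.2 :=
    (ae_restrict_iff' (D2D.measurableSet_region v)).2
      (ae_of_all _ fun z hz => D2D.integrand_nonneg p q hlam.le hv hT hz)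
  -- The integral of this nonnegative function is a conditional probability, hence finite; this also
  -- justifies the iterated integral.
  have hint : IntegrableOn
      (fun x : ℝ × ℝ × ℝ => D2D.integrand lam p q α v T x.1 x.2.1 x.2.2) (D2D.region v) := by
    refine ⟨hmeas.aestronglyMeasurable, ?_⟩
    rw [hasFiniteIntegral_iff_ofReal hnn, ← hcov]
    exact measure_lt_top _ _
  refine ⟨?_, hint, N.map_R1 hlam hp0 hp1 hv, N.map_Theta hlam hp0 hp1 hv,
    N.map_triple hlam hp0 hp1 hv,
    cond_absolutelyContinuous.ae_le (N.ae_interference_lt_top hα v), fun s hs =>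
      ⟨N.condExp_I1 hlam hp0 hp1 hv hα hs, N.condExp_I2 hlam hp0 hp1 hv hα hs,
        N.condExp_I3 hlam hp0 hp1 hv hα hs⟩⟩
  rw [D2D.Network.coverageY, measureReal_def, hcov,
    ← integral_eq_lintegral_of_nonneg_ae hnn hmeas.aestronglyMeasurable,
    D2D.integral_region v hint]
  rfl
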